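/- **Setting (GP 2).** *Host graphs* are finite directed graphs (parallel edges and loops allowed) whose nodes and edges carry a list over $\mathbb Z\cup\mathrm{Char}^*$ and a mark (nodes: none, red, green, blue, grey; edges: none, red, green, blue, dashed); every node is a root or a non-root. A *conditional rule schema* $r=\langle L\leftarrow K\rightarrow R,\Gamma\rangle$ consists of rule graphs $L,R$ labelled with list expressions (over typed variables, list and string concatenation, integer arithmetic, $\mathtt{length}$, $\mathtt{indeg}$, $\mathtt{outdeg}$) and marks or the wildcard $\mathtt{any}$, an interface $K$ consisting of nodes without labels and roots, and an optional application condition $\Gamma$; the expressions in $L$ are simple, the variables of $R$ and $\Gamma$ occur in $L$, and items of $R$ are marked $\mathtt{any}$ only if the same items of $L$ are. $G\Rightarrow_r H$ holds if there are an injective premorphism $g:L\to G$ (it preserves sources, targets, roots and non-roots) and a label assignment $\alpha$ (values of the variables, and marks other than none for the items marked $\mathtt{any}$) such that $g:L^{g,\alpha}\to G$ is a label-preserving morphism, $\Gamma^{g,\alpha}$ is true, and there is a natural double-pushout $L^{g,\alpha}\leftarrow K\to R^{g,\alpha}$, $G\leftarrow D\to H$ (both squares are pushouts and pullbacks of partially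 labelled graphs). *Programs* are built from calls of finite rule sets $\mathcal R$, $P;Q$, $\mathtt{if}\ C\ \mathtt{then}\ P\ \mathtt{else}\ Q$, $\mathtt{try}\ C\ \mathtt{then}\ P\ \mathtt{else}\ Q$, $P!$, $P\ \mathtt{or}\ Q$, $\mathtt{break}$ ($\mathtt{skip}$ is the call of $\emptyset\Rightarrow\emptyset$, $\mathtt{fail}$ the call of the empty rule set), with the standard small-step semantics of GP 2; $[\![P]\!]G$ is the set of all outcomes (graphs, fail, $\bot$) of $P$ on $G$. A triple $\{c\}\,P\,\{d\}$ is *partially correct*, $\vDash\{c\}\,P\,\{d\}$, if $G\vDash c$ implies $H\vDash d$ for all host graphs $G$ and all host graphs $H\in[\![P]\!]G$. **Calculus SEM.** Assertions are arbitrary predicates on host graphs. SLP$(c,P)$ is the strongest liberal postcondition, i.e. an assertion $d$ with $\vDash\{c\}\,P\,\{d\}$ that implies every such assertion; WLP$(P,d)$ is the weakest liberal precondition, i.e. an assertion $c$ with $\vDash\{c\}\,P\,\{d\}$ that is implied by every such assertion. $G\vDash\mathrm{SUCCESS}(P)$ iff $[\![P]\!]G$ contains a host graph; $G\vDash\mathrm{FAIL}(P)$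 iff $\mathrm{fail}\in[\![P]\!]G$. $\mathrm{Break}(c,P,d)$ means: $\langle P,G\rangle\to^*\langle\mathtt{break},H\rangle$ and $G\vDash c$ imply $H\vDash d$. The rules of SEM are - [ruleapp] $\{c\}\,r\,\{\mathrm{SLP}(c,r)\}$ and $\{\mathrm{WLP}(r,d)\}\,r\,\{d\}$ for conditional rule schemata $r$; - [ruleset] from $\{c\}\,r\,\{d\}$ for all $r\in\mathcal R$ infer $\{c\}\,\mathcal R\,\{d\}$; - [comp] from $\{c\}\,P\,\{e\}$ and $\{e\}\,Q\,\{d\}$ infer $\{c\}\,P;Q\,\{d\}$; - [cons] from $c\Rightarrow c'$, $\{c'\}\,P\,\{d'\}$ and $d'\Rightarrow d$ infer $\{c\}\,P\,\{d\}$; - [if] from $\{c\wedge\mathrm{SUCCESS}(C)\}\,P\,\{d\}$ and $\{c\wedge\mathrm{FAIL}(C)\}\,Q\,\{d\}$ infer $\{c\}\ \mathtt{if}\ C\ \mathtt{then}\ P\ \mathtt{else}\ Q\ \{d\}$; - [try] from $\{c\wedge\mathrm{SUCCESS}(C)\}\,C;P\,\{d\}$ and $\{c\wedge\mathrm{FAIL}(C)\}\,Q\,\{d\}$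 infer $\{c\}\ \mathtt{try}\ C\ \mathtt{then}\ P\ \mathtt{else}\ Q\ \{d\}$; - [alap] from $\{c\}\,P\,\{c\}$ and $\mathrm{Break}(c,P,d)$ infer $\{c\}\,P!\,\{(c\wedge\mathrm{FAIL}(P))\vee d\}$. **Calculus SYN.** Assertions are *conditions*: first-order formulas without free node and edge variables, over the quantifiers $\exists_V,\exists_E,\exists_L$ (nodes, edges, label values), equality, integer comparisons, typing predicates, $\mathsf{root}$, $\mathsf{edge}$, and the functions $\mathsf{s},\mathsf{t},\mathsf{l_V},\mathsf{l_E},\mathsf{m_V},\mathsf{m_E},\mathsf{indeg},\mathsf{outdeg},\mathsf{length}$; $G\vDash c$ means that $c$ holds in $G$ for some values of its free label variables. For a condition $c$ and a rule schema $r$, the formulas $\mathrm{Slp}(c,r)=\mathrm{Post}(c,r^\vee)$ and $\mathrm{Slp}(c,r^{-1})=\mathrm{Post}(c,(r^\vee)^{-1})$ are those given by the syntactic transformation Post. Post is computed for generalised rules $w=\langle L\leftarrow K\to R,ac_L,ac_R\rangle$ ($r^\vee$ has $ac_L=\Gamma$ and $ac_R=\mathsf{true}$; $w^{-1}$ exchanges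 $L$ with $R$ and $ac_L$ with $ac_R$; in $r^\vee$ the wildcard $\mathtt{any}$ is replaced by concrete marks, and Slp is the finite disjunction over all choices) in the steps - $\mathrm{Lift}(c,w)=\mathrm{Val}(\mathrm{Split}(c\wedge ac_L)\wedge\mathrm{Dang}(L))$: Split replaces each quantified node (edge) by the disjunction over all nodes (edges) of $L$ and the case that it is different from all of them, in the edge case further split by whether its source and target are nodes of $L$; Dang says that the nodes of $L-K$ have the same in- and outdegrees as in $L$; Val replaces all terms with constant arguments by their values in $L$, where the degrees of an interface node $v$ become $\mathrm{incon}(v)+\mathrm{indeg}_L(v)$ and $\mathrm{outcon}(v)+\mathrm{outdeg}_L(v)$, with $\mathrm{incon}(v),\mathrm{outcon}(v)$ the numbers of incident edges outside $L$; - $\mathrm{Shift}(c,w)=\mathrm{Adj}(\mathrm{Lift}(c,w))\wedge ac_R\wedge\mathrm{Spec}(R)\wedge\mathrm{Dang}(R)$: Adj replaces $\mathrm{incon}(v)$ by $\mathsf{indeg}(v)-\mathrm{indeg}_R(v)$ (similarly outcon), replaces equations with deleted items by $\mathsf{false}$, and restricts quantifiers to items not in $R-K$; Spec describes structure, labels,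 marks, roots of $R$ and the types of its variables (degrees in labels of the rule refer to the graph on the $L$ side of $r$ and are rewritten accordingly); - $\mathrm{Post}(c,w)$ replaces the node and edge constants in $\mathrm{Shift}(c,w)$ by pairwise distinct fresh variables and existentially quantifies all free variables. For loop-free $P$ (no subcommand $Q!$), $\mathrm{Success}(P)=\mathrm{Pre}(P,\mathsf{true})$ and $\mathrm{Fail}(P)$ are the formulas defined by - $\mathrm{Pre}(\mathcal R,c)=\bigvee_{r\in\mathcal R}\mathrm{Slp}(c,r^{-1})$, $\mathrm{Pre}(P;Q,c)=\mathrm{Pre}(P,\mathrm{Pre}(Q,c))$, $\mathrm{Pre}(\mathtt{if}\ C\ \mathtt{then}\ P\ \mathtt{else}\ Q,c)=(\mathrm{Success}(C)\wedge\mathrm{Pre}(P,c))\vee(\mathrm{Fail}(C)\wedge\mathrm{Pre}(Q,c))$, $\mathrm{Pre}(\mathtt{try}\ C\ \mathtt{then}\ P\ \mathtt{else}\ Q,c)=\mathrm{Pre}(C,\mathrm{Pre}(P,c))\vee(\mathrm{Fail}(C)\wedge\mathrm{Pre}(Q,c))$, $\mathrm{Pre}(P\ \mathtt{or}\ Q,c)=\mathrm{Pre}(P,c)\vee\mathrm{Pre}(Q,c)$,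 $\mathrm{Pre}(\mathtt{break},c)=\mathsf{false}$; - $\mathrm{Fail}(\mathcal R)=\neg\mathrm{Success}(\mathcal R)$, $\mathrm{Fail}(P;Q)=\mathrm{Fail}(P)\vee\mathrm{Pre}(P,\mathrm{Fail}(Q))$, $\mathrm{Fail}(\mathtt{if}\ C\ \mathtt{then}\ P\ \mathtt{else}\ Q)=(\mathrm{Success}(C)\wedge\mathrm{Fail}(P))\vee(\mathrm{Fail}(C)\wedge\mathrm{Fail}(Q))$, $\mathrm{Fail}(\mathtt{try}\ C\ \mathtt{then}\ P\ \mathtt{else}\ Q)=\mathrm{Pre}(C,\mathrm{Fail}(P))\vee(\mathrm{Fail}(C)\wedge\mathrm{Fail}(Q))$, $\mathrm{Fail}(P\ \mathtt{or}\ Q)=\mathrm{Fail}(P)\vee\mathrm{Fail}(Q)$, $\mathrm{Fail}(\mathtt{break})=\mathsf{false}$. *Non-failing commands* are $\mathtt{break}$, $\mathtt{skip}$, loops $P!$, calls of non-empty rule sets all of whose members have an empty left-hand graph and no application condition, and $P;Q$, $\mathtt{if}\ C\ \mathtt{then}\ P\ \mathtt{else}\ Q$, $\mathtt{try}\ C\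 \mathtt{then}\ P\ \mathtt{else}\ Q$ for non-failing $P,Q$. *Iteration commands* are loop-free programs, non-failing commands, and $C;P$ with $C$ loop-free and $P$ an iteration command. For an iteration command $S$, $\mathrm{Fail}(S)$ is $\mathsf{false}$ if $S$ is non-failing, the formula above if $S$ is loop-free, and $\mathrm{Fail}(C)$ if $S=C;P$ with $C$ loop-free and $P$ non-failing. *Control commands* are those in which all conditions of branching commands are loop-free and all loop bodies are iteration commands. The rules of SYN are those of SEM for conditions $c,d,d',e$, loop-free $C$, control commands $P,Q$, with Success and Fail in place of SUCCESS and FAIL, with the [ruleapp] axioms $\{c\}\,r\,\{\mathrm{Slp}(c,r)\}$ and $\{\neg\mathrm{Slp}(\neg d,r^{-1})\}\,r\,\{d\}$, and with [alap]: from $\{c\}\,S\,\{c\}$ and $\mathrm{Break}(c,S,d)$ infer $\{c\}\,S!\,\{(c\wedge\mathrm{Fail}(S))\vee d\}$ for iteration commands $S$. **Theorem (Soundness).** Let $P$ be a graph program. 1. For all assertions $c,d$: if $\{c\}\,P\,\{d\}$ is derivable in SEM, then $\vDash\{c\}\,P\,\{d\}$. 2. For all conditions $c,d$: if $\{c\}\,P\,\{d\}$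 is derivable in SYN, then $\vDash\{c\}\,P\,\{d\}$. -/

import Mathlib

open CategoryTheory

namespace GP2

/-! ### Values, variables and expressions -/

/-- The five types of label variables. -/
inductive LTy | list | atom | int | string | char
  deriving DecidableEq

/-- Printable ASCII characters other than the double quote. -/
abbrev GPChar := {k : ℕ // k = 32 ∨ k = 33 ∨ (35 ≤ k ∧ k ≤ 126)}

/-- An atom is an integer or a character string. -/
inductive Atom
  | int (z : ℤ)
  | str (s : List GPChar)

/-- Host graph lists. An atom is identified with the list of length one that contains it. -/
abbrev HList := List Atom

/-- The domain of each type of label variables. -/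
def LTy.Dom : LTy → Type
  | .list => HList
  | .atom => Atom
  | .int => ℤ
  | .string => List GPChar
  | .char => GPChar

/-- The subtype relationships: every value is a list. -/
def LTy.toList : (t : LTy) → t.Dom → HList
  | .list, v => v
  | .atom, v => [v]
  | .int, v => [Atom.int v]
  | .string, v => [Atom.str v]
  | .char, v => [Atom.str [v]]

/-- A label variable: a name together with its type. -/
structure LVar where
  ty : LTy
  name : ℕ
  deriving DecidableEq

/-- An assignment of label variables (each variable gets a value of its own domain). -/
abbrev Env := (x : LVar) → x.ty.Dom

/-- String expressions. -/
inductive StrE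
  | lit (s : List GPChar)
  | svar (n : ℕ)
  | cvar (n : ℕ)
  | cat (a b : StrE)

inductive IntOp | add | sub | mul | div

/-- Integer expressions. `I` is the type of the basic integer terms that refer to the graph
(such as `indeg(v)`); `lenL`, `lenA`, `lenS` are `length` of a list, atom, string variable. -/
inductive IntE (I : Type)
  | lit (z : ℤ)
  | var (n : ℕ)
  | op (o : IntOp) (a b : IntE I)
  | lenL (n : ℕ)
  | lenA (n : ℕ)
  | lenS (n : ℕ)
  | leaf (i : I)

/-- Atom expressions. -/
inductive AtE (I : Type)
  | int (e : IntE I)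
  | str (s : StrE)
  | avar (n : ℕ)

/-- List expressions. `X` is the type of the basic list terms that refer to the graph
(such as `l_V(v)`). -/
inductive LstE (I X : Type)
  | empty
  | atm (a : AtE I)
  | cat (a b : LstE I X)
  | lvar (n : ℕ)
  | leaf (x : X)

def StrE.eval (ρ : Env) : StrE → List GPChar
  | .lit s => s
  | .svar n => ρ ⟨.string, n⟩
  | .cvar n => [ρ ⟨.char, n⟩]
  | .cat a b => a.eval ρ ++ b.eval ρ

/-- The division of GP 2 is integer division (rounding towards zero). -/
def IntOp.eval : IntOp → ℤ → ℤ → ℤ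
  | .add, a, b => a + b
  | .sub, a, b => a - b
  | .mul, a, b => a * b
  | .div, a, b => a.tdiv b

/-- Evaluation; an atom has length one (as a list). -/
def IntE.eval {I : Type} (ρ : Env) (fi : I → ℤ) : IntE I → ℤ
  | .lit z => z
  | .var n => ρ ⟨.int, n⟩
  | .op o a b => o.eval (a.eval ρ fi) (b.eval ρ fi)
  | .lenL n => ((LTy.toList .list (ρ ⟨.list, n⟩)).length : ℤ)
  | .lenA n => ((LTy.toList .atom (ρ ⟨.atom, n⟩)).length : ℤ)
  | .lenS n => (((StrE.svar n).eval ρ).length : ℤ)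
  | .leaf i => fi i

def AtE.eval {I : Type} (ρ : Env) (fi : I → ℤ) : AtE I → Atom
  | .int e => Atom.int (e.eval ρ fi)
  | .str s => Atom.str (s.eval ρ)
  | .avar n => ρ ⟨.atom, n⟩

def LstE.eval {I X : Type} (ρ : Env) (fi : I → ℤ) (fx : X → HList) : LstE I X → HList
  | .empty => []
  | .atm a => [a.eval ρ fi]
  | .cat a b => a.eval ρ fi fx ++ b.eval ρ fi fx
  | .lvar n => ρ ⟨.list, n⟩
  | .leaf x => fx x

/-- All occurrences of variables (with multiplicity). -/
def StrE.vars : StrE → List LVar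
  | .lit _ => []
  | .svar n => [⟨.string, n⟩]
  | .cvar n => [⟨.char, n⟩]
  | .cat a b => a.vars ++ b.vars

def IntE.vars {I : Type} : IntE I → List LVar
  | .lit _ => []
  | .var n => [⟨.int, n⟩]
  | .op _ a b => a.vars ++ b.vars
  | .lenL n => [⟨.list, n⟩]
  | .lenA n => [⟨.atom, n⟩]
  | .lenS n => [⟨.string, n⟩]
  | .leaf _ => []

def AtE.vars {I : Type} : AtE I → List LVar
  | .int e => e.vars
  | .str s => s.vars
  | .avar n => [⟨.atom, n⟩]

def LstE.vars {I X : Type} : LstE I X → List LVar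
  | .empty => []
  | .atm a => a.vars
  | .cat a b => a.vars ++ b.vars
  | .lvar n => [⟨.list, n⟩]
  | .leaf _ => []

/-- Renaming of the variables. -/
def LVar.rn (f : ℕ → ℕ) (x : LVar) : LVar := ⟨x.ty, f x.name⟩

def StrE.rn (f : ℕ → ℕ) : StrE → StrE
  | .lit s => .lit s
  | .svar n => .svar (f n)
  | .cvar n => .cvar (f n)
  | .cat a b => .cat (a.rn f) (b.rn f)

def IntE.rn {I : Type} (f : ℕ → ℕ) : IntE I → IntE I
  | .lit z => .lit z
  | .var n => .var (f n)
  | .op o a b => .op o (a.rn f) (b.rn f)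
  | .lenL n => .lenL (f n)
  | .lenA n => .lenA (f n)
  | .lenS n => .lenS (f n)
  | .leaf i => .leaf i

def AtE.rn {I : Type} (f : ℕ → ℕ) : AtE I → AtE I
  | .int e => .int (e.rn f)
  | .str s => .str (s.rn f)
  | .avar n => .avar (f n)

def LstE.rn {I X : Type} (f : ℕ → ℕ) : LstE I X → LstE I X
  | .empty => .empty
  | .atm a => .atm (a.rn f)
  | .cat a b => .cat (a.rn f) (b.rn f)
  | .lvar n => .lvar (f n)
  | .leaf x => .leaf x

/-- Replacement of the basic terms that refer to the graph. -/
def IntE.bind {I J : Type} (f : I → IntE J) : IntE I → IntE J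
  | .lit z => .lit z
  | .var n => .var n
  | .op o a b => .op o (a.bind f) (b.bind f)
  | .lenL n => .lenL n
  | .lenA n => .lenA n
  | .lenS n => .lenS n
  | .leaf i => f i

def AtE.bind {I J : Type} (f : I → IntE J) : AtE I → AtE J
  | .int e => .int (e.bind f)
  | .str s => .str s
  | .avar n => .avar n

def LstE.bind {I X J Y : Type} (f : I → IntE J) (g : X → LstE J Y) : LstE I X → LstE J Y
  | .empty => .empty
  | .atm a => .atm (a.bind f)
  | .cat a b => .cat (a.bind f g) (b.bind f g)
  | .lvar n => .lvar n
  | .leaf x => g x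

def IntE.NoArith {I : Type} : IntE I → Prop
  | .op _ _ _ => False
  | _ => True

/-- No arithmetic operators, and at most one occurrence of a string variable in each string
subexpression. -/
def LstE.SimpleAtoms {I X : Type} : LstE I X → Prop
  | .empty => True
  | .atm (.int e) => e.NoArith
  | .atm (.str s) => (s.vars.filter (fun x => x.ty = .string)).length ≤ 1
  | .atm (.avar _) => True
  | .cat a b => a.SimpleAtoms ∧ b.SimpleAtoms
  | .lvar _ => True
  | .leaf _ => True

/-- Simple expressions: moreover, at most one occurrence of a list variable. -/
def LstE.Simple {I X : Type} (e : LstE I X) : Prop :=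
  e.SimpleAtoms ∧ (e.vars.filter (fun x => x.ty = .list)).length ≤ 1

/-! ### Marks and graphs -/

inductive NodeMark | none | red | green | blue | grey
  deriving DecidableEq

inductive EdgeMark | none | red | green | blue | dashed
  deriving DecidableEq

instance : Fintype NodeMark :=
  ⟨{.none, .red, .green, .blue, .grey}, fun x => by cases x <;> simp⟩

instance : Fintype EdgeMark :=
  ⟨{.none, .red, .green, .blue, .dashed}, fun x => by cases x <;> simp⟩

/-- A mark or the wildcard `any`. -/
inductive WithAny (M : Type)
  | mark (m : M)
  | any

/-- Replacement of `any` by the mark `a`. -/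
def WithAny.inst {M : Type} (a : M) : WithAny M → M
  | .mark m => m
  | .any => a

/-- The mark `a` fits the mark expression; `any` stands for every mark except `none`. -/
def WithAny.Fits {M : Type} (nomark a : M) : WithAny M → Prop
  | .mark m => a = m
  | .any => a ≠ nomark

instance {M : Type} [DecidableEq M] (nomark a : M) (w : WithAny M) :
    Decidable (w.Fits nomark a) := by
  cases w <;> unfold WithAny.Fits <;> infer_instance

/-- A total rule graph with node set `V`, edge set `E`, labels in `Λ`, node marks in `MV` and edge
marks in `ME`. -/
structure RGraph (V E Λ MV ME : Type) where
  src : E → V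
  tgt : E → V
  nlist : V → Λ
  nmark : V → MV
  root : V → Bool
  elist : E → Λ
  emark : E → ME

def RGraph.indeg {V E Λ MV ME : Type} [Fintype E] [DecidableEq V]
    (A : RGraph V E Λ MV ME) (v : V) : ℕ :=
  (Finset.univ.filter (fun e => A.tgt e = v)).card

def RGraph.outdeg {V E Λ MV ME : Type} [Fintype E] [DecidableEq V]
    (A : RGraph V E Λ MV ME) (v : V) : ℕ :=
  (Finset.univ.filter (fun e => A.src e = v)).card

/-- Host graphs. -/
structure HostGraph where
  V : Type
  E : Type
  [finV : Finite V]
  [finE : Finite E]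
  src : E → V
  tgt : E → V
  nlist : V → HList
  nmark : V → NodeMark
  root : V → Bool
  elist : E → HList
  emark : E → EdgeMark

noncomputable def HostGraph.indeg (G : HostGraph) (v : G.V) : ℤ :=
  (({e : G.E | G.tgt e = v}.ncard : ℕ) : ℤ)

noncomputable def HostGraph.outdeg (G : HostGraph) (v : G.V) : ℤ :=
  (({e : G.E | G.src e = v}.ncard : ℕ) : ℤ)

/-- Graphs over evaluated labels whose node labels (list and mark) and root function may be
partial: the objects in which rule applications take place. -/
structure PGraph where
  V : Type
  E : Type
  [finV : Finite V]
  [finE : Finite E]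
  src : E → V
  tgt : E → V
  nodeLabel : V → Option (HList × NodeMark)
  root : V → Option Bool
  edgeLabel : E → HList × EdgeMark

/-- Graph morphisms preserve sources, targets, and those labels, roots and non-roots that are
defined. -/
@[ext] structure PGraph.Hom (A B : PGraph) where
  fV : A.V → B.V
  fE : A.E → B.E
  src : ∀ e, B.src (fE e) = fV (A.src e)
  tgt : ∀ e, B.tgt (fE e) = fV (A.tgt e)
  node : ∀ v l, A.nodeLabel v = some l → B.nodeLabel (fV v) = some l
  root : ∀ v b, A.root v = some b → B.root (fV v) = some b
  edge : ∀ e, B.edgeLabel (fE e) = A.edgeLabel e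

instance : Category PGraph where
  Hom := PGraph.Hom
  id A := ⟨id, id, fun _ => rfl, fun _ => rfl, fun _ _ h => h, fun _ _ h => h, fun _ => rfl⟩
  comp f g :=
    ⟨g.fV ∘ f.fV, g.fE ∘ f.fE,
      fun e => by simp [g.src, f.src], fun e => by simp [g.tgt, f.tgt],
      fun v l h => g.node _ _ (f.node v l h), fun v b h => g.root _ _ (f.root v b h),
      fun e => by simp [g.edge, f.edge]⟩

def HostGraph.toPGraph (G : HostGraph) : PGraph :=
  { V := G.V, E := G.E, finV := G.finV, finE := G.finE, src := G.src, tgt := G.tgt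
    nodeLabel := fun v => some (G.nlist v, G.nmark v)
    root := fun v => some (G.root v)
    edgeLabel := fun e => (G.elist e, G.emark e) }

/-! ### Conditional rule schemata -/

/-- The degree operators applied to node identifiers. -/
inductive Deg (V : Type)
  | indeg (v : V)
  | outdeg (v : V)

/-- List and integer expressions in rule schemata, with node identifiers in `V`. -/
abbrev RInt (V : Type) := IntE (Deg V)
abbrev RLst (V : Type) := LstE (Deg V) Empty

inductive TyPred | int | char | string | atom

inductive Cmp | lt | le | gt | ge

/-- Application conditions. -/
inductive RCond (V : Type)
  | typ (t : TyPred) (x : LVar)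
  | leq (a b : RLst V)
  | lne (a b : RLst V)
  | cmp (o : Cmp) (a b : RInt V)
  | edge (u v : V) (l : Option (RLst V)) (m : Option (WithAny EdgeMark))
  | not (γ : RCond V)
  | and (γ δ : RCond V)
  | or (γ δ : RCond V)

def RCond.vars {V : Type} : RCond V → List LVar
  | .typ _ x => [x]
  | .leq a b => a.vars ++ b.vars
  | .lne a b => a.vars ++ b.vars
  | .cmp _ a b => a.vars ++ b.vars
  | .edge _ _ l _ => (l.map LstE.vars).getD []
  | .not γ => γ.vars
  | .and γ δ => γ.vars ++ δ.vars
  | .or γ δ => γ.vars ++ δ.vars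

/-- All occurrences of variables in a rule graph whose nodes and edges are enumerated. -/
def RGraph.vars {V E I MV ME : Type} (A : RGraph V E (LstE I Empty) MV ME)
    (nodes : List V) (edges : List E) : List LVar :=
  nodes.flatMap (fun v => (A.nlist v).vars) ++ edges.flatMap (fun e => (A.elist e).vars)

/-- Enumeration of the disjoint union of two finite index sets. -/
def nodeList (a b : ℕ) : List (Fin a ⊕ Fin b) :=
  (List.finRange a).map Sum.inl ++ (List.finRange b).map Sum.inr

/-- Rule schemata `L ← K → R`. The interface `K` has the nodes `Fin nK`, without labels and roots;
the nodes of `L` are those of `K` and the `nD` deleted nodes, the nodes of `R` are those of `K` and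
the `nN` new nodes. All edges of `L` are outside `K`, as are all edges of `R`; `same e = some e'`
means that the edge `e` of `R` has the same identifier as the edge `e'` of `L`. Node identifiers
inside expressions are nodes of `L`. An item of `R` may be marked `any` only if the item of `L` with
the same identifier is. -/
structure RuleSchema where
  nK : ℕ
  nD : ℕ
  nN : ℕ
  eL : ℕ
  eR : ℕ
  left : RGraph (Fin nK ⊕ Fin nD) (Fin eL) (RLst (Fin nK ⊕ Fin nD))
    (WithAny NodeMark) (WithAny EdgeMark)
  right : RGraph (Fin nK ⊕ Fin nN) (Fin eR) (RLst (Fin nK ⊕ Fin nD))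
    (WithAny NodeMark) (WithAny EdgeMark)
  same : Fin eR → Option (Fin eL)
  same_inj : ∀ e e' f, same e = some f → same e' = some f → e = e'
  any_node : ∀ v, right.nmark (Sum.inl v) = .any → left.nmark (Sum.inl v) = .any
  any_new : ∀ v, right.nmark (Sum.inr v) ≠ .any
  any_edge : ∀ e, right.emark e = .any → ∃ f, same e = some f ∧ left.emark f = .any
  simple_node : ∀ v, (left.nlist v).Simple
  simple_edge : ∀ e, (left.elist e).Simple
  vars_sub : ∀ x ∈ right.vars (nodeList nK nN) (List.finRange eR),
    x ∈ left.vars (nodeList nK nD) (List.finRange eL)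

/-- Conditional rule schemata; `cond = none` means that there is no application condition. -/
structure Rule extends RuleSchema where
  cond : Option (RCond (Fin nK ⊕ Fin nD))
  cond_vars : ∀ γ ∈ cond, ∀ x ∈ γ.vars, x ∈ left.vars (nodeList nK nD) (List.finRange eL)

abbrev RuleSchema.LNode (r : RuleSchema) := Fin r.nK ⊕ Fin r.nD
abbrev RuleSchema.RNode (r : RuleSchema) := Fin r.nK ⊕ Fin r.nN

/-- The mark part of a label assignment: marks other than `none` for the items marked `any`
(the values at the other items are irrelevant). -/
abbrev RuleSchema.NMarks (r : RuleSchema) := r.LNode → {m : NodeMark // m ≠ .none}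
abbrev RuleSchema.EMarks (r : RuleSchema) := Fin r.eL → {m : EdgeMark // m ≠ .none}

/-- The marks of the instantiated right-hand graph. -/
def RuleSchema.rightNMark (r : RuleSchema) (μ : r.NMarks) : r.RNode → NodeMark
  | .inl k => (r.right.nmark (.inl k)).inst (μ (.inl k)).1
  | .inr n => (r.right.nmark (.inr n)).inst .none

def RuleSchema.rightEMark (r : RuleSchema) (η : r.EMarks) (e : Fin r.eR) : EdgeMark :=
  (r.right.emark e).inst (match r.same e with
    | some f => (η f).1
    | none => .none)

/-- Evaluation of rule expressions in a host graph with respect to a map `g` of node identifiers. -/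
noncomputable def Deg.eval {V : Type} (G : HostGraph) (g : V → G.V) : Deg V → ℤ
  | .indeg v => G.indeg (g v)
  | .outdeg v => G.outdeg (g v)

noncomputable def rEval {V : Type} (G : HostGraph) (g : V → G.V) (ρ : Env) (e : RLst V) : HList :=
  e.eval ρ (Deg.eval G g) Empty.elim

def TyPred.Holds : TyPred → HList → Prop
  | .int, l => ∃ z, l = [Atom.int z]
  | .char, l => ∃ c, l = [Atom.str [c]]
  | .string, l => ∃ s, l = [Atom.str s]
  | .atom, l => ∃ a, l = [a]

def Cmp.Holds : Cmp → ℤ → ℤ → Prop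
  | .lt, a, b => a < b
  | .le, a, b => a ≤ b
  | .gt, a, b => b < a
  | .ge, a, b => b ≤ a

/-- Truth of an application condition; `edge(u,v,l,m)` expresses the existence of an edge from `u`
to `v` with list `l` and mark `m` (when these are given). -/
def RCond.Holds {V : Type} (G : HostGraph) (g : V → G.V) (ρ : Env) : RCond V → Prop
  | .typ t x => t.Holds (x.ty.toList (ρ x))
  | .leq a b => rEval G g ρ a = rEval G g ρ b
  | .lne a b => rEval G g ρ a ≠ rEval G g ρ b
  | .cmp o a b => o.Holds (a.eval ρ (Deg.eval G g)) (b.eval ρ (Deg.eval G g))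
  | .edge u v l m => ∃ e : G.E, G.src e = g u ∧ G.tgt e = g v ∧
      (∀ a ∈ l, G.elist e = rEval G g ρ a) ∧ (∀ w ∈ m, w.Fits .none (G.emark e))
  | .not γ => ¬ γ.Holds G g ρ
  | .and γ δ => γ.Holds G g ρ ∧ δ.Holds G g ρ
  | .or γ δ => γ.Holds G g ρ ∨ δ.Holds G g ρ

/-- Injective premorphisms from the left-hand graph of a rule schema to a host graph. -/
structure PreMatch (r : RuleSchema) (G : HostGraph) where
  gV : r.LNode → G.V
  gE : Fin r.eL → G.E
  injV : Function.Injective gV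
  injE : Function.Injective gE
  src : ∀ e, G.src (gE e) = gV (r.left.src e)
  tgt : ∀ e, G.tgt (gE e) = gV (r.left.tgt e)
  root : ∀ v, G.root (gV v) = r.left.root v

/-- The instance of the left-hand graph. -/
noncomputable def leftInst (r : RuleSchema) (G : HostGraph) (g : r.LNode → G.V) (ρ : Env)
    (μ : r.NMarks) (η : r.EMarks) : PGraph where
  V := r.LNode
  E := Fin r.eL
  src := r.left.src
  tgt := r.left.tgt
  nodeLabel := fun v => some (rEval G g ρ (r.left.nlist v), (r.left.nmark v).inst (μ v).1)
  root := fun v => some (r.left.root v)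
  edgeLabel := fun e => (rEval G g ρ (r.left.elist e), (r.left.emark e).inst (η e).1)

/-- The instance of the right-hand graph. -/
noncomputable def rightInst (r : RuleSchema) (G : HostGraph) (g : r.LNode → G.V) (ρ : Env)
    (μ : r.NMarks) (η : r.EMarks) : PGraph where
  V := r.RNode
  E := Fin r.eR
  src := r.right.src
  tgt := r.right.tgt
  nodeLabel := fun v => some (rEval G g ρ (r.right.nlist v), r.rightNMark μ v)
  root := fun v => some (r.right.root v)
  edgeLabel := fun e => (rEval G g ρ (r.right.elist e), r.rightEMark η e)

/-- The interface graph. -/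
def interface (r : RuleSchema) : PGraph where
  V := Fin r.nK
  E := Empty
  src := Empty.elim
  tgt := Empty.elim
  nodeLabel := fun _ => none
  root := fun _ => none
  edgeLabel := Empty.elim

def inclLeft (r : RuleSchema) (G : HostGraph) (g : r.LNode → G.V) (ρ : Env)
    (μ : r.NMarks) (η : r.EMarks) : interface r ⟶ leftInst r G g ρ μ η :=
  PGraph.Hom.mk (A := interface r) (B := leftInst r G g ρ μ η) Sum.inl Empty.elim
    (fun e => e.elim) (fun e => e.elim) (fun _ _ h => by cases h) (fun _ _ h => by cases h)
    (fun e => e.elim)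

def inclRight (r : RuleSchema) (G : HostGraph) (g : r.LNode → G.V) (ρ : Env)
    (μ : r.NMarks) (η : r.EMarks) : interface r ⟶ rightInst r G g ρ μ η :=
  PGraph.Hom.mk (A := interface r) (B := rightInst r G g ρ μ η) Sum.inl Empty.elim
    (fun e => e.elim) (fun e => e.elim) (fun _ _ h => by cases h) (fun _ _ h => by cases h)
    (fun e => e.elim)

/-- Direct derivation `G ⇒_{r,g} H`: for some label assignment, `g` is a label preserving morphism,
the application condition holds, and there is a natural double-pushout (both squares are pushouts
and pullbacks). -/
def DerivesBy (r : Rule) {G : HostGraph} (g : PreMatch r.toRuleSchema G) (H : HostGraph) : Prop :=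
  ∃ (ρ : Env) (μ : r.NMarks) (η : r.EMarks)
    (m : leftInst r.toRuleSchema G g.gV ρ μ η ⟶ G.toPGraph),
    m.fV = g.gV ∧ m.fE = g.gE ∧
    (∀ γ ∈ r.cond, γ.Holds G g.gV ρ) ∧
    ∃ (D : PGraph) (k : interface r.toRuleSchema ⟶ D) (d : D ⟶ G.toPGraph) (h : D ⟶ H.toPGraph)
      (m' : rightInst r.toRuleSchema G g.gV ρ μ η ⟶ H.toPGraph),
      BicartesianSq (inclLeft r.toRuleSchema G g.gV ρ μ η) k m d ∧
      BicartesianSq (inclRight r.toRuleSchema G g.gV ρ μ η) k m' h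

/-- `G ⇒_R H` for a set `R` of conditional rule schemata. -/
def Derives (R : List Rule) (G H : HostGraph) : Prop :=
  ∃ r ∈ R, ∃ g : PreMatch r.toRuleSchema G, DerivesBy r g H

/-! ### Graph programs -/

/-- Command sequences, after the (non-recursive) procedures have been expanded. A single rule schema
`r` is the rule set call `{r}`. -/
inductive Com
  | call (R : List Rule)
  | seq (P Q : Com)
  | ifte (C P Q : Com)
  | tryte (C P Q : Com)
  | loop (P : Com)
  | choice (P Q : Com)
  | brk

/-- The rule schema `∅ ⇒ ∅`. -/
def emptyRule : Rule where
  nK := 0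
  nD := 0
  nN := 0
  eL := 0
  eR := 0
  left := ⟨finZeroElim, finZeroElim, Sum.elim finZeroElim finZeroElim,
    Sum.elim finZeroElim finZeroElim, Sum.elim finZeroElim finZeroElim, finZeroElim, finZeroElim⟩
  right := ⟨finZeroElim, finZeroElim, Sum.elim finZeroElim finZeroElim,
    Sum.elim finZeroElim finZeroElim, Sum.elim finZeroElim finZeroElim, finZeroElim, finZeroElim⟩
  same := finZeroElim
  same_inj := fun e => e.elim0
  any_node := fun e => e.elim0
  any_new := fun e => e.elim0
  any_edge := fun e => e.elim0
  simple_node := fun v => v.elim (fun e => e.elim0) (fun e => e.elim0)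
  simple_edge := fun e => e.elim0
  vars_sub := by intro x hx; simp [RGraph.vars, nodeList] at hx
  cond := none
  cond_vars := by intro γ hγ; cases hγ

/-- `skip` is the call of `∅ ⇒ ∅`, and `fail` is the call of the empty rule set. -/
def Com.skip : Com := .call [emptyRule]
def Com.fail : Com := .call []

/-- The branching commands with omitted parts. -/
def Com.ift (C P : Com) : Com := .ifte C P .skip
def Com.tryt (C P : Com) : Com := .tryte C P .skip
def Com.trye (C Q : Com) : Com := .tryte C .skip Q
def Com.try1 (C : Com) : Com := .tryte C .skip .skip

/-- Configurations. -/
inductive Config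
  | run (P : Com) (G : HostGraph)
  | graph (G : HostGraph)
  | fail

/-- The transitive closure (the same relation as `Relation.TransGen`, in a form that may occur inside
the inductive definition of the steps). -/
inductive Plus {α : Type 1} (r : α → α → Prop) : α → α → Prop
  | single {a b} : r a b → Plus r a b
  | head {a b c} : r a b → Plus r b c → Plus r a c

/-- The reflexive transitive closure. -/
inductive Star {α : Type 1} (r : α → α → Prop) : α → α → Prop
  | refl {a} : Star r a a
  | head {a b c} : r a b → Star r b c → Star r a c

theorem plus_iff {α : Type 1} {r : α → α → Prop} {a b : α} :
    Plus r a b ↔ Relation.TransGen r a b := by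
  constructor
  · intro h
    induction h with
    | single h => exact .single h
    | head h _ ih => exact .head h ih
  · intro h
    induction h using Relation.TransGen.head_induction_on with
    | single h => exact .single h
    | head h _ ih => exact .head h ih

theorem star_iff {α : Type 1} {r : α → α → Prop} {a b : α} :
    Star r a b ↔ Relation.ReflTransGen r a b := by
  constructor
  · intro h
    induction h with
    | refl => exact .refl
    | head h _ ih => exact .head h ih
  · intro h
    induction h using Relation.ReflTransGen.head_induction_on with
    | refl => exact .refl
    | head h _ ih => exact .head h ih

/-- The semantic inference rules. -/
inductive Step : Config → Config → Prop
  | call₁ {R G H} : Derives R G H → Step (.run (.call R) G) (.graph H)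
  | call₂ {R G} : (¬ ∃ H, Derives R G H) → Step (.run (.call R) G) .fail
  | seq₁ {P P' Q G H} : Step (.run P G) (.run P' H) →
      Step (.run (.seq P Q) G) (.run (.seq P' Q) H)
  | seq₂ {P Q G H} : Step (.run P G) (.graph H) → Step (.run (.seq P Q) G) (.run Q H)
  | seq₃ {P Q G} : Step (.run P G) .fail → Step (.run (.seq P Q) G) .fail
  | brk {P G} : Step (.run (.seq .brk P) G) (.run .brk G)
  | if₁ {C P Q G H} : Plus Step (.run C G) (.graph H) →
      Step (.run (.ifte C P Q) G) (.run P G)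
  | if₂ {C P Q G} : Plus Step (.run C G) .fail → Step (.run (.ifte C P Q) G) (.run Q G)
  | try₁ {C P Q G H} : Plus Step (.run C G) (.graph H) →
      Step (.run (.tryte C P Q) G) (.run P H)
  | try₂ {C P Q G} : Plus Step (.run C G) .fail → Step (.run (.tryte C P Q) G) (.run Q G)
  | loop₁ {P G H} : Plus Step (.run P G) (.graph H) →
      Step (.run (.loop P) G) (.run (.loop P) H)
  | loop₂ {P G} : Plus Step (.run P G) .fail → Step (.run (.loop P) G) (.graph G)
  | loop₃ {P G H} : Star Step (.run P G) (.run .brk H) →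
      Step (.run (.loop P) G) (.graph H)
  | or₁ {P Q G} : Step (.run (.choice P Q) G) (.run P G)
  | or₂ {P Q G} : Step (.run (.choice P Q) G) (.run Q G)

/-- Outcomes of program runs. -/
inductive Outcome
  | graph (H : HostGraph)
  | fail
  | bot

/-- The semantic function `⟦P⟧G`. -/
def Com.sem (P : Com) (G : HostGraph) : Set Outcome :=
  {X | match X with
    | .graph H => Relation.TransGen Step (.run P G) (.graph H)
    | .fail => Relation.TransGen Step (.run P G) .fail
    | .bot => ∃ f : ℕ → Config, f 0 = .run P G ∧ ∀ i, Step (f i) (f (i + 1))}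

/-! ### Assertions and the semantic calculus -/

abbrev Assertion := HostGraph → Prop

def PartiallyCorrect (c : Assertion) (P : Com) (d : Assertion) : Prop :=
  ∀ G, c G → ∀ H, Outcome.graph H ∈ P.sem G → d H

def IsLiberalPost (c : Assertion) (P : Com) (d : Assertion) : Prop :=
  ∀ G H, c G ∧ Outcome.graph H ∈ P.sem G → d H

/-- `d` is a strongest liberal postcondition `SLP(c,P)`. -/
def IsSLP (c : Assertion) (P : Com) (d : Assertion) : Prop :=
  IsLiberalPost c P d ∧ ∀ d', IsLiberalPost c P d' → ∀ H, d H → d' H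

def IsLiberalPre (P : Com) (d : Assertion) (c : Assertion) : Prop :=
  ∀ G H, c G ∧ Outcome.graph H ∈ P.sem G → d H

/-- `c` is a weakest liberal precondition `WLP(P,d)`. -/
def IsWLP (P : Com) (d : Assertion) (c : Assertion) : Prop :=
  IsLiberalPre P d c ∧ ∀ c', IsLiberalPre P d c' → ∀ G, c' G → c G

def SUCCESS (P : Com) : Assertion := fun G => ∃ H, Outcome.graph H ∈ P.sem G

def FAIL (P : Com) : Assertion := fun G => Outcome.fail ∈ P.sem G

/-- The predicate `Break(c,P,d)`. -/
def Break (c : Assertion) (P : Com) (d : Assertion) : Prop :=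
  ∀ G H, Relation.ReflTransGen Step (.run P G) (.run .brk H) → c G → d H

/-- Derivability in the semantic calculus. -/
inductive SEM : Assertion → Com → Assertion → Prop
  | ruleapp_slp {c d : Assertion} (r : Rule) : IsSLP c (.call [r]) d → SEM c (.call [r]) d
  | ruleapp_wlp {c d : Assertion} (r : Rule) : IsWLP (.call [r]) d c → SEM c (.call [r]) d
  | ruleset {c d : Assertion} (R : List Rule) :
      (∀ r ∈ R, SEM c (.call [r]) d) → SEM c (.call R) d
  | comp {c e d : Assertion} {P Q : Com} : SEM c P e → SEM e Q d → SEM c (.seq P Q) d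
  | cons {c c' d d' : Assertion} {P : Com} :
      (∀ G, c G → c' G) → SEM c' P d' → (∀ G, d' G → d G) → SEM c P d
  | ite {c d : Assertion} {C P Q : Com} :
      SEM (fun G => c G ∧ SUCCESS C G) P d → SEM (fun G => c G ∧ FAIL C G) Q d →
      SEM c (.ifte C P Q) d
  | tryte {c d : Assertion} {C P Q : Com} :
      SEM (fun G => c G ∧ SUCCESS C G) (.seq C P) d → SEM (fun G => c G ∧ FAIL C G) Q d →
      SEM c (.tryte C P Q) d
  | alap {c d : Assertion} {P : Com} :
      SEM c P c → Break c P d → SEM c (.loop P) (fun G => (c G ∧ FAIL P G) ∨ d G)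

/-! ### First-order formulas -/

/-- The constants that may occur in a formula: node constants, edge constants, and the nodes `v` for
which `incon(v)`, `outcon(v)` may occur. -/
structure Sig where
  N : Type
  E : Type
  C : Type

/-- The signature of first-order formulas: no constants. -/
abbrev Sig.FO : Sig := ⟨Empty, Empty, Empty⟩

/-- Node terms in the scope of `n` node and `m` edge variables (de Bruijn indices, `0` is the
variable bound last). -/
inductive NodeTm (S : Sig) (n m : ℕ)
  | ref (x : S.N ⊕ Fin n)
  | src (e : S.E ⊕ Fin m)
  | tgt (e : S.E ⊕ Fin m)

/-- Basic integer terms. For a node `v` of a rule graph, `incon(v)` and `outcon(v)` count the edges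
outside the rule graph that are incident to `v`. -/
inductive ILeaf (S : Sig) (n m : ℕ)
  | indeg (x : NodeTm S n m)
  | outdeg (x : NodeTm S n m)
  | incon (v : S.C)
  | outcon (v : S.C)

/-- Basic list terms. -/
inductive XLeaf (S : Sig) (n m : ℕ)
  | lV (x : NodeTm S n m)
  | lE (e : S.E ⊕ Fin m)

abbrev ITm (S : Sig) (n m : ℕ) := IntE (ILeaf S n m)
abbrev LTm (S : Sig) (n m : ℕ) := LstE (ILeaf S n m) (XLeaf S n m)

/-- Atomic formulas; `neq` and `eeq` are the equality of nodes and of edges. -/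
inductive Atomic (S : Sig) (n m : ℕ)
  | typ (t : TyPred) (x : LVar)
  | leq (a b : LTm S n m)
  | cmp (o : Cmp) (a b : ITm S n m)
  | root (x : NodeTm S n m)
  | nodeEq (x y : NodeTm S n m)
  | edgeEq (e f : S.E ⊕ Fin m)
  | mV (x : NodeTm S n m) (w : WithAny NodeMark)
  | mE (e : S.E ⊕ Fin m) (w : WithAny EdgeMark)

/-- First-order formulas with constants in `S` and with free node and edge variables `Fin n` and
`Fin m`. A label variable is quantified over the domain of its type. -/
inductive Fm (S : Sig) : ℕ → ℕ → Type
  | tru {n m} : Fm S n m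
  | fls {n m} : Fm S n m
  | at {n m} (a : Atomic S n m) : Fm S n m
  | neg {n m} (φ : Fm S n m) : Fm S n m
  | and {n m} (φ ψ : Fm S n m) : Fm S n m
  | or {n m} (φ ψ : Fm S n m) : Fm S n m
  | exV {n m} (φ : Fm S (n + 1) m) : Fm S n m
  | exE {n m} (φ : Fm S n (m + 1)) : Fm S n m
  | exL {n m} (x : LVar) (φ : Fm S n m) : Fm S n m

/-- Conditions: first-order formulas without free node and edge variables. -/
abbrev Cond := Fm Sig.FO 0 0

/-- An interpretation of the constants of `S` in a host graph. -/
structure Interp (S : Sig) (G : HostGraph) where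
  node : S.N → G.V
  edge : S.E → G.E
  incon : S.C → ℤ
  outcon : S.C → ℤ

def NodeTm.eval {S : Sig} {n m : ℕ} {G : HostGraph} (J : Interp S G) (a : Fin n → G.V)
    (b : Fin m → G.E) : NodeTm S n m → G.V
  | .ref x => Sum.elim J.node a x
  | .src e => G.src (Sum.elim J.edge b e)
  | .tgt e => G.tgt (Sum.elim J.edge b e)

noncomputable def ILeaf.eval {S : Sig} {n m : ℕ} {G : HostGraph} (J : Interp S G) (a : Fin n → G.V)
    (b : Fin m → G.E) : ILeaf S n m → ℤ
  | .indeg x => G.indeg (x.eval J a b)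
  | .outdeg x => G.outdeg (x.eval J a b)
  | .incon v => J.incon v
  | .outcon v => J.outcon v

def XLeaf.eval {S : Sig} {n m : ℕ} {G : HostGraph} (J : Interp S G) (a : Fin n → G.V)
    (b : Fin m → G.E) : XLeaf S n m → HList
  | .lV x => G.nlist (x.eval J a b)
  | .lE e => G.elist (Sum.elim J.edge b e)

def Atomic.Sat {S : Sig} {n m : ℕ} {G : HostGraph} (J : Interp S G) (a : Fin n → G.V)
    (b : Fin m → G.E) (ρ : Env) : Atomic S n m → Prop
  | .typ t x => t.Holds (x.ty.toList (ρ x))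
  | .leq l l' => l.eval ρ (ILeaf.eval J a b) (XLeaf.eval J a b) =
      l'.eval ρ (ILeaf.eval J a b) (XLeaf.eval J a b)
  | .cmp o i i' => o.Holds (i.eval ρ (ILeaf.eval J a b)) (i'.eval ρ (ILeaf.eval J a b))
  | .root x => G.root (x.eval J a b) = true
  | .nodeEq x y => x.eval J a b = y.eval J a b
  | .edgeEq e f => Sum.elim J.edge b e = Sum.elim J.edge b f
  | .mV x w => w.Fits .none (G.nmark (x.eval J a b))
  | .mE e w => w.Fits .none (G.emark (Sum.elim J.edge b e))

/-- Satisfaction with respect to assignments of the free variables. -/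
def Fm.Sat {S : Sig} {G : HostGraph} (J : Interp S G) : {n m : ℕ} → (Fin n → G.V) →
    (Fin m → G.E) → Env → Fm S n m → Prop
  | _, _, _, _, _, .tru => True
  | _, _, _, _, _, .fls => False
  | _, _, a, b, ρ, .at A => A.Sat J a b ρ
  | _, _, a, b, ρ, .neg φ => ¬ φ.Sat J a b ρ
  | _, _, a, b, ρ, .and φ ψ => φ.Sat J a b ρ ∧ ψ.Sat J a b ρ
  | _, _, a, b, ρ, .or φ ψ => φ.Sat J a b ρ ∨ ψ.Sat J a b ρ
  | _, _, a, b, ρ, .exV φ => ∃ v : G.V, φ.Sat J (Fin.cons v a : Fin (_ + 1) → G.V) b ρ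
  | _, _, a, b, ρ, .exE φ => ∃ e : G.E, φ.Sat J a (Fin.cons e b : Fin (_ + 1) → G.E) ρ
  | _, _, a, b, ρ, .exL x φ => ∃ u : x.ty.Dom, φ.Sat J a b (Function.update ρ x u)

def Interp.FO (G : HostGraph) : Interp Sig.FO G := ⟨Empty.elim, Empty.elim, Empty.elim, Empty.elim⟩

/-- `G ⊨ c`: the condition `c` holds for some assignment of its free (label) variables. -/
def Cond.Models (c : Cond) : Assertion :=
  fun G => ∃ ρ : Env, Fm.Sat (Interp.FO G) finZeroElim finZeroElim ρ c

/-! ### Operations on formulas -/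

def Fm.bigAnd {S : Sig} {n m : ℕ} (l : List (Fm S n m)) : Fm S n m := l.foldr .and .tru

def Fm.bigOr {S : Sig} {n m : ℕ} (l : List (Fm S n m)) : Fm S n m := l.foldr .or .fls

def Atomic.vars {S : Sig} {n m : ℕ} : Atomic S n m → List LVar
  | .typ _ x => [x]
  | .leq l l' => l.vars ++ l'.vars
  | .cmp _ i i' => i.vars ++ i'.vars
  | _ => []

/-- The free label variables. -/
def Fm.freeL {S : Sig} : {n m : ℕ} → Fm S n m → List LVar
  | _, _, .tru => []
  | _, _, .fls => []
  | _, _, .at A => A.vars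
  | _, _, .neg φ => φ.freeL
  | _, _, .and φ ψ => φ.freeL ++ ψ.freeL
  | _, _, .or φ ψ => φ.freeL ++ ψ.freeL
  | _, _, .exV φ => φ.freeL
  | _, _, .exE φ => φ.freeL
  | _, _, .exL x φ => φ.freeL.filter (fun y => y ≠ x)

/-- Renaming of all (free and bound) label variables. -/
def Atomic.rn {S : Sig} {n m : ℕ} (f : ℕ → ℕ) : Atomic S n m → Atomic S n m
  | .typ t x => .typ t (x.rn f)
  | .leq l l' => .leq (l.rn f) (l'.rn f)
  | .cmp o i i' => .cmp o (i.rn f) (i'.rn f)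
  | A => A

def Fm.rn {S : Sig} (f : ℕ → ℕ) : {n m : ℕ} → Fm S n m → Fm S n m
  | _, _, .tru => .tru
  | _, _, .fls => .fls
  | _, _, .at A => .at (A.rn f)
  | _, _, .neg φ => .neg (φ.rn f)
  | _, _, .and φ ψ => .and (φ.rn f) (ψ.rn f)
  | _, _, .or φ ψ => .or (φ.rn f) (ψ.rn f)
  | _, _, .exV φ => .exV (φ.rn f)
  | _, _, .exE φ => .exE (φ.rn f)
  | _, _, .exL x φ => .exL (x.rn f) (φ.rn f)

/-- A substitution for constants, node and edge variables. If `src y = some v` then the terms `s(y)`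
are replaced by the constant `v`, and likewise for `tgt`. -/
structure Sub (S : Sig) (n m : ℕ) (S' : Sig) (n' m' : ℕ) where
  node : S.N ⊕ Fin n → S'.N ⊕ Fin n'
  edge : S.E ⊕ Fin m → S'.E ⊕ Fin m'
  con : S.C → S'.C
  src : Fin m → Option S'.N
  tgt : Fin m → Option S'.N

section
variable {S S' : Sig} {n m n' m' : ℕ}

def NodeTm.sub (σ : Sub S n m S' n' m') : NodeTm S n m → NodeTm S' n' m'
  | .ref x => .ref (σ.node x)
  | .src (.inl e) => .src (σ.edge (.inl e))
  | .src (.inr y) => match σ.src y with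
    | some v => .ref (.inl v)
    | none => .src (σ.edge (.inr y))
  | .tgt (.inl e) => .tgt (σ.edge (.inl e))
  | .tgt (.inr y) => match σ.tgt y with
    | some v => .ref (.inl v)
    | none => .tgt (σ.edge (.inr y))

def ILeaf.sub (σ : Sub S n m S' n' m') : ILeaf S n m → ILeaf S' n' m'
  | .indeg x => .indeg (x.sub σ)
  | .outdeg x => .outdeg (x.sub σ)
  | .incon v => .incon (σ.con v)
  | .outcon v => .outcon (σ.con v)

def XLeaf.sub (σ : Sub S n m S' n' m') : XLeaf S n m → XLeaf S' n' m'
  | .lV x => .lV (x.sub σ)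
  | .lE e => .lE (σ.edge e)

def ITm.sub (σ : Sub S n m S' n' m') (i : ITm S n m) : ITm S' n' m' :=
  i.bind (fun j => .leaf (j.sub σ))

def LTm.sub (σ : Sub S n m S' n' m') (l : LTm S n m) : LTm S' n' m' :=
  l.bind (fun j => .leaf (j.sub σ)) (fun x => .leaf (x.sub σ))

def Atomic.sub (σ : Sub S n m S' n' m') : Atomic S n m → Atomic S' n' m'
  | .typ t x => .typ t x
  | .leq l l' => .leq (LTm.sub σ l) (LTm.sub σ l')
  | .cmp o i i' => .cmp o (ITm.sub σ i) (ITm.sub σ i')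
  | .root x => .root (x.sub σ)
  | .nodeEq x y => .nodeEq (x.sub σ) (y.sub σ)
  | .edgeEq e f => .edgeEq (σ.edge e) (σ.edge f)
  | .mV x w => .mV (x.sub σ) w
  | .mE e w => .mE (σ.edge e) w

/-- Extension of a substitution to one more node variable, which is replaced by the constant `v`. -/
def Sub.nodeConst (σ : Sub S n m S' n' m') (v : S'.N) : Sub S (n + 1) m S' n' m' where
  node := Sum.elim (fun c => σ.node (.inl c))
    (Fin.cons (.inl v) (fun x => σ.node (.inr x)) : Fin (n + 1) → S'.N ⊕ Fin n')
  edge := σ.edge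
  con := σ.con
  src := σ.src
  tgt := σ.tgt

/-- Extension of a substitution to one more node variable, which stays a variable. -/
def Sub.nodeVar (σ : Sub S n m S' n' m') : Sub S (n + 1) m S' (n' + 1) m' where
  node := Sum.elim (fun c => Sum.map id Fin.succ (σ.node (.inl c)))
    (Fin.cons (.inr 0) (fun x => Sum.map id Fin.succ (σ.node (.inr x))) :
      Fin (n + 1) → S'.N ⊕ Fin (n' + 1))
  edge := σ.edge
  con := σ.con
  src := σ.src
  tgt := σ.tgt

/-- Extension of a substitution to one more edge variable, which is replaced by the constant `e`. -/
def Sub.edgeConst (σ : Sub S n m S' n' m') (e : S'.E) : Sub S n (m + 1) S' n' m' where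
  node := σ.node
  edge := Sum.elim (fun c => σ.edge (.inl c))
    (Fin.cons (.inl e) (fun x => σ.edge (.inr x)) : Fin (m + 1) → S'.E ⊕ Fin m')
  con := σ.con
  src := Fin.cons none σ.src
  tgt := Fin.cons none σ.tgt

/-- Extension of a substitution to one more edge variable `x`, which stays a variable; `s(x)` and
`t(x)` are replaced by the constants `p` and `q`, if given. -/
def Sub.edgeVar (σ : Sub S n m S' n' m') (p q : Option S'.N) : Sub S n (m + 1) S' n' (m' + 1) where
  node := σ.node
  edge := Sum.elim (fun c => Sum.map id Fin.succ (σ.edge (.inl c)))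
    (Fin.cons (.inr 0) (fun x => Sum.map id Fin.succ (σ.edge (.inr x))) :
      Fin (m + 1) → S'.E ⊕ Fin (m' + 1))
  con := σ.con
  src := Fin.cons p σ.src
  tgt := Fin.cons q σ.tgt

end

/-- Substitution in formulas. -/
def Fm.sub {S S' : Sig} : {n m n' m' : ℕ} → Sub S n m S' n' m' → Fm S n m → Fm S' n' m'
  | _, _, _, _, _, .tru => .tru
  | _, _, _, _, _, .fls => .fls
  | _, _, _, _, σ, .at A => .at (A.sub σ)
  | _, _, _, _, σ, .neg φ => .neg (φ.sub σ)
  | _, _, _, _, σ, .and φ ψ => .and (φ.sub σ) (ψ.sub σ)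
  | _, _, _, _, σ, .or φ ψ => .or (φ.sub σ) (ψ.sub σ)
  | _, _, _, _, σ, .exV φ => .exV (φ.sub σ.nodeVar)
  | _, _, _, _, σ, .exE φ => .exE (φ.sub (σ.edgeVar none none))
  | _, _, _, _, σ, .exL x φ => .exL x (φ.sub σ)

/-- The identity substitution. -/
def Sub.idS (S : Sig) (n m : ℕ) : Sub S n m S n m := ⟨id, id, id, fun _ => none, fun _ => none⟩

/-- Weakening by one edge variable. -/
def Sub.weakE (S : Sig) (n m : ℕ) : Sub S n m S n (m + 1) :=
  ⟨id, Sum.map id Fin.succ, id, fun _ => none, fun _ => none⟩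

/-- The predicate `edge(x,y,l,w)` (with optional `l` and `w`): there is an edge from `x` to `y` with
list `l` and mark `w`. -/
def Fm.edge {S : Sig} {n m : ℕ} (x y : NodeTm S n m) (l : Option (LTm S n m))
    (w : Option (WithAny EdgeMark)) : Fm S n m :=
  .exE (.and (.at (.nodeEq (.src (.inr 0)) (x.sub (Sub.weakE S n m))))
    (.and (.at (.nodeEq (.tgt (.inr 0)) (y.sub (Sub.weakE S n m))))
      (.and (match l with
        | some l => .at (.leq (.leaf (.lE (.inr 0))) (LTm.sub (Sub.weakE S n m) l))
        | none => .tru)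
      (match w with
        | some w => .at (.mE (.inr 0) w)
        | none => .tru))))

/-! ### Generalised rules -/

/-- Basic terms of the labels in a generalised rule: the numbers of edges outside the rule graph
that are incident to an interface node. -/
inductive CDeg (K : Type)
  | incon (v : K)
  | outcon (v : K)

abbrev CLst (K : Type) := LstE (CDeg K) Empty

/-- The signature of conditions over a graph with nodes `V` and edges `E`. -/
abbrev Sig.over (V E : Type) : Sig := ⟨V, E, Empty⟩

/-- The same, when `incon(v)` and `outcon(v)` are allowed for `v` in `K`. -/
abbrev Sig.overC (V E K : Type) : Sig := ⟨V, E, K⟩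

/-- Generalised rules `⟨L ← K → R, ac_L, ac_R⟩` (unrestricted rule schemata with left and right
application condition, without the mark `any`). -/
structure GRule where
  nK : ℕ
  nD : ℕ
  nN : ℕ
  eL : ℕ
  eR : ℕ
  left : RGraph (Fin nK ⊕ Fin nD) (Fin eL) (CLst (Fin nK)) NodeMark EdgeMark
  right : RGraph (Fin nK ⊕ Fin nN) (Fin eR) (CLst (Fin nK)) NodeMark EdgeMark
  acL : Fm (Sig.over (Fin nK ⊕ Fin nD) (Fin eL)) 0 0
  acR : Fm (Sig.over (Fin nK ⊕ Fin nN) (Fin eR)) 0 0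

/-- The inverse of a generalised rule. -/
def GRule.inv (w : GRule) : GRule :=
  ⟨w.nK, w.nN, w.nD, w.eR, w.eL, w.right, w.left, w.acR, w.acL⟩

abbrev GRule.LNode (w : GRule) := Fin w.nK ⊕ Fin w.nD
abbrev GRule.RNode (w : GRule) := Fin w.nK ⊕ Fin w.nN

/-- Conditions over `L` and over `R`, and conditions over `L` that may contain `incon`, `outcon`. -/
abbrev GRule.SL (w : GRule) : Sig := Sig.over w.LNode (Fin w.eL)
abbrev GRule.SR (w : GRule) : Sig := Sig.over w.RNode (Fin w.eR)
abbrev GRule.SC (w : GRule) : Sig := Sig.overC w.LNode (Fin w.eL) (Fin w.nK)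

/-- Degrees of nodes of `L` before a rule application, expressed through `incon` and `outcon` (the
deleted nodes have no incident edges outside `L`). -/
def RuleSchema.degToC (r : RuleSchema) : Deg r.LNode → IntE (CDeg (Fin r.nK))
  | .indeg (.inl k) => .op .add (.leaf (.incon k)) (.lit (r.left.indeg (.inl k)))
  | .indeg (.inr d) => .lit (r.left.indeg (.inr d))
  | .outdeg (.inl k) => .op .add (.leaf (.outcon k)) (.lit (r.left.outdeg (.inl k)))
  | .outdeg (.inr d) => .lit (r.left.outdeg (.inr d))

def RuleSchema.lstToC (r : RuleSchema) (l : RLst r.LNode) : CLst (Fin r.nK) :=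
  l.bind r.degToC Empty.elim

/-- Rule expressions as terms of conditions over `L`. -/
def Deg.toTm {V E : Type} : Deg V → ITm (Sig.over V E) 0 0
  | .indeg v => .leaf (.indeg (.ref (.inl v)))
  | .outdeg v => .leaf (.outdeg (.ref (.inl v)))

def RInt.toTm {V E : Type} (i : RInt V) : ITm (Sig.over V E) 0 0 := i.bind Deg.toTm

def RLst.toTm {V E : Type} (l : RLst V) : LTm (Sig.over V E) 0 0 := l.bind Deg.toTm Empty.elim

/-- The condition `Γ^∨` over `L` that corresponds to an application condition `Γ`. -/
def RCond.toFm {V E : Type} : RCond V → Fm (Sig.over V E) 0 0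
  | .typ t x => .at (.typ t x)
  | .leq a b => .at (.leq (RLst.toTm a) (RLst.toTm b))
  | .lne a b => .neg (.at (.leq (RLst.toTm a) (RLst.toTm b)))
  | .cmp o a b => .at (.cmp o (RInt.toTm a) (RInt.toTm b))
  | .edge u v l w => .edge (.ref (.inl u)) (.ref (.inl v)) (l.map RLst.toTm) w
  | .not γ => .neg γ.toFm
  | .and γ δ => .and γ.toFm δ.toFm
  | .or γ δ => .or γ.toFm δ.toFm

/-- The generalised rule `r^∨`, for a given choice of marks for the items marked `any`. -/
def Rule.gen (r : Rule) (μ : r.NMarks) (η : r.EMarks) : GRule where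
  nK := r.nK
  nD := r.nD
  nN := r.nN
  eL := r.eL
  eR := r.eR
  left := ⟨r.left.src, r.left.tgt, fun v => r.lstToC (r.left.nlist v),
    fun v => (r.left.nmark v).inst (μ v).1, r.left.root, fun e => r.lstToC (r.left.elist e),
    fun e => (r.left.emark e).inst (η e).1⟩
  right := ⟨r.right.src, r.right.tgt, fun v => r.lstToC (r.right.nlist v),
    r.rightNMark μ, r.right.root, fun e => r.lstToC (r.right.elist e), r.rightEMark η⟩
  acL := match r.cond with
    | some γ => γ.toFm
    | none => .tru
  acR := .tru

/-! ### The strongest liberal postcondition of a rule schema -/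

/-- The condition that the source (or target) `t` of an edge variable is the node constant `p`, or
that it is none of the nodes in `Ns`. -/
def endpoint {S : Sig} {n m : ℕ} (Ns : List S.N) (t : NodeTm S n m) : Option S.N → Fm S n m
  | some v => .at (.nodeEq t (.ref (.inl v)))
  | none => .bigAnd (Ns.map fun v => .neg (.at (.nodeEq t (.ref (.inl v)))))

/-- The transformation Split for a rule graph with nodes `Ns` and edges `Es`. A quantified node or
edge is one of the given constants or different from all of them; in the latter case an edge has
its source and target among `Ns` or not. The substitutions that Split performs in subformulas are
accumulated in `σ`. -/
def Fm.split {S S' : Sig} (Ns : List S'.N) (Es : List S'.E) :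
    {n m n' m' : ℕ} → Sub S n m S' n' m' → Fm S n m → Fm S' n' m'
  | _, _, _, _, _, .tru => .tru
  | _, _, _, _, _, .fls => .fls
  | _, _, _, _, σ, .at A => .at (A.sub σ)
  | _, _, _, _, σ, .neg φ => .neg (φ.split Ns Es σ)
  | _, _, _, _, σ, .and φ ψ => .and (φ.split Ns Es σ) (ψ.split Ns Es σ)
  | _, _, _, _, σ, .or φ ψ => .or (φ.split Ns Es σ) (ψ.split Ns Es σ)
  | _, _, _, _, σ, .exV φ =>
      .or (.bigOr (Ns.map fun v => φ.split Ns Es (σ.nodeConst v)))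
        (.exV (.and
          (.bigAnd (Ns.map fun v => .neg (.at (.nodeEq (.ref (.inr 0)) (.ref (.inl v))))))
          (φ.split Ns Es σ.nodeVar)))
  | _, _, _, _, σ, .exE φ =>
      .or (.bigOr (Es.map fun e => φ.split Ns Es (σ.edgeConst e)))
        (.exE (.and
          (.bigAnd (Es.map fun e => .neg (.at (.edgeEq (.inr 0) (.inl e)))))
          (.bigOr ((Ns.map some ++ [none]).flatMap fun p => (Ns.map some ++ [none]).map fun q =>
            .and (endpoint Ns (.src (.inr 0)) p)
              (.and (endpoint Ns (.tgt (.inr 0)) q) (φ.split Ns Es (σ.edgeVar p q)))))))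
  | _, _, _, _, σ, .exL x φ => .exL x (φ.split Ns Es σ)

/-- `i = k` for an integer term `i`. -/
def eqLit {S : Sig} {n m : ℕ} (i : ITm S n m) (k : ℤ) : Fm S n m :=
  .at (.leq (.atm (.int i)) (.atm (.int (.lit k))))

namespace GRule
variable (w : GRule)

/-- The condition Dang over `L`: no node of `L - K` is incident to an edge outside `L`. -/
def dang : Fm w.SL 0 0 :=
  .bigAnd ((List.finRange w.nD).map fun d =>
    .and (eqLit (.leaf (.indeg (.ref (.inl (.inr d))))) (w.left.indeg (.inr d)))
      (eqLit (.leaf (.outdeg (.ref (.inl (.inr d))))) (w.left.outdeg (.inr d))))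

section
variable {n m : ℕ}

/-- Valuation in `L`: every term with a constant argument is replaced by its value in `L`. -/
def valNode : NodeTm w.SL n m → NodeTm w.SC n m
  | .ref x => .ref x
  | .src (.inl e) => .ref (.inl (w.left.src e))
  | .src (.inr y) => .src (.inr y)
  | .tgt (.inl e) => .ref (.inl (w.left.tgt e))
  | .tgt (.inr y) => .tgt (.inr y)

/-- Labels of a generalised rule as terms over `L`. -/
def cToL : CDeg (Fin w.nK) → ITm w.SC n m
  | .incon k => .leaf (.incon k)
  | .outcon k => .leaf (.outcon k)

def lstToL (l : CLst (Fin w.nK)) : LTm w.SC n m := l.bind w.cToL Empty.elim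

def valI : ILeaf w.SL n m → ITm w.SC n m
  | .indeg x => match w.valNode x with
    | .ref (.inl (.inl k)) => .op .add (.leaf (.incon k)) (.lit (w.left.indeg (.inl k)))
    | .ref (.inl (.inr d)) => .lit (w.left.indeg (.inr d))
    | y => .leaf (.indeg y)
  | .outdeg x => match w.valNode x with
    | .ref (.inl (.inl k)) => .op .add (.leaf (.outcon k)) (.lit (w.left.outdeg (.inl k)))
    | .ref (.inl (.inr d)) => .lit (w.left.outdeg (.inr d))
    | y => .leaf (.outdeg y)
  | .incon v => v.elim
  | .outcon v => v.elim

def valX : XLeaf w.SL n m → LTm w.SC n m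
  | .lV x => match w.valNode x with
    | .ref (.inl v) => w.lstToL (w.left.nlist v)
    | y => .leaf (.lV y)
  | .lE (.inl e) => w.lstToL (w.left.elist e)
  | .lE (.inr y) => .leaf (.lE (.inr y))

end

/-- A decided atomic formula. -/
def ofDec {S : Sig} {n m : ℕ} (p : Prop) [Decidable p] : Fm S n m := if p then .tru else .fls

def valAtomic {n m : ℕ} : Atomic w.SL n m → Fm w.SC n m
  | .typ t x => .at (.typ t x)
  | .leq l l' => .at (.leq (l.bind w.valI w.valX) (l'.bind w.valI w.valX))
  | .cmp o i i' => .at (.cmp o (i.bind w.valI) (i'.bind w.valI))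
  | .root x => match w.valNode x with
    | .ref (.inl v) => ofDec (w.left.root v = true)
    | y => .at (.root y)
  | .nodeEq x y => match w.valNode x, w.valNode y with
    | .ref (.inl u), .ref (.inl v) => ofDec (u = v)
    | x', y' => .at (.nodeEq x' y')
  | .edgeEq (.inl e) (.inl f) => ofDec (e = f)
  | .edgeEq e f => .at (.edgeEq e f)
  | .mV x a => match w.valNode x with
    | .ref (.inl v) => ofDec (a.Fits .none (w.left.nmark v))
    | y => .at (.mV y a)
  | .mE (.inl e) a => ofDec (a.Fits .none (w.left.emark e))
  | .mE (.inr y) a => .at (.mE (.inr y) a)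

/-- The transformation Val. -/
def val : {n m : ℕ} → Fm w.SL n m → Fm w.SC n m
  | _, _, .tru => .tru
  | _, _, .fls => .fls
  | _, _, .at A => w.valAtomic A
  | _, _, .neg φ => .neg (val φ)
  | _, _, .and φ ψ => .and (val φ) (val ψ)
  | _, _, .or φ ψ => .or (val φ) (val ψ)
  | _, _, .exV φ => .exV (val φ)
  | _, _, .exE φ => .exE (val φ)
  | _, _, .exL x φ => .exL x (val φ)

/-- A number larger than the names of all label variables of the rule. -/
def fresh : ℕ :=
  ((w.left.vars (nodeList w.nK w.nD) (List.finRange w.eL) ++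
    w.right.vars (nodeList w.nK w.nN) (List.finRange w.eR) ++
    w.acL.freeL ++ w.acR.freeL).map fun x => x.name + 1).foldr max 0

/-- A precondition as a condition over `L`, sharing no label variables with the rule. -/
def prepare (c : Cond) : Fm w.SL 0 0 :=
  (c.rn (fun k => k + w.fresh)).sub
    ⟨Sum.elim Empty.elim Fin.elim0, Sum.elim Empty.elim Fin.elim0, Empty.elim, Fin.elim0, Fin.elim0⟩

/-- The transformation Lift, giving a left application condition. -/
def lift (c : Cond) : Fm w.SC 0 0 :=
  w.val (.and
    ((Fm.and (w.prepare c) w.acL).split (nodeList w.nK w.nD) (List.finRange w.eL)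
      (Sub.idS w.SL 0 0))
    w.dang)

section
variable {n m : ℕ}

/-- Node terms over `R`; terms that refer to deleted items have no counterpart. -/
def adjNode : NodeTm w.SC n m → Option (NodeTm w.SR n m)
  | .ref (.inl (.inl k)) => some (.ref (.inl (.inl k)))
  | .ref (.inl (.inr _)) => none
  | .ref (.inr x) => some (.ref (.inr x))
  | .src (.inl _) => none
  | .src (.inr y) => some (.src (.inr y))
  | .tgt (.inl _) => none
  | .tgt (.inr y) => some (.tgt (.inr y))

/-- `incon(v)` becomes `indeg(v) - indeg_R(v)`, and likewise for `outcon(v)`. -/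
def cToR : CDeg (Fin w.nK) → ITm w.SR n m
  | .incon k => .op .sub (.leaf (.indeg (.ref (.inl (.inl k))))) (.lit (w.right.indeg (.inl k)))
  | .outcon k => .op .sub (.leaf (.outdeg (.ref (.inl (.inl k))))) (.lit (w.right.outdeg (.inl k)))

def lstToR (l : CLst (Fin w.nK)) : LTm w.SR n m := l.bind w.cToR Empty.elim

/-- (The defaults `0` and `empty` for arguments without counterpart are never used, because
valuation has replaced all such terms.) -/
def adjI : ILeaf w.SC n m → ITm w.SR n m
  | .indeg x => match w.adjNode x with
    | some y => .leaf (.indeg y)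
    | none => .lit 0
  | .outdeg x => match w.adjNode x with
    | some y => .leaf (.outdeg y)
    | none => .lit 0
  | .incon k => w.cToR (.incon k)
  | .outcon k => w.cToR (.outcon k)

def adjX : XLeaf w.SC n m → LTm w.SR n m
  | .lV x => match w.adjNode x with
    | some y => .leaf (.lV y)
    | none => .empty
  | .lE (.inl _) => .empty
  | .lE (.inr y) => .leaf (.lE (.inr y))

def adjAtomic : Atomic w.SC n m → Fm w.SR n m
  | .typ t x => .at (.typ t x)
  | .leq l l' => .at (.leq (l.bind w.adjI w.adjX) (l'.bind w.adjI w.adjX))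
  | .cmp o i i' => .at (.cmp o (i.bind w.adjI) (i'.bind w.adjI))
  | .root x => match w.adjNode x with
    | some y => .at (.root y)
    | none => .fls
  | .nodeEq x y => match w.adjNode x, w.adjNode y with
    | some x', some y' => .at (.nodeEq x' y')
    | _, _ => .fls
  | .edgeEq (.inr e) (.inr f) => .at (.edgeEq (.inr e) (.inr f))
  | .edgeEq _ _ => .fls
  | .mV x a => match w.adjNode x with
    | some y => .at (.mV y a)
    | none => .fls
  | .mE (.inl _) _ => .fls
  | .mE (.inr y) a => .at (.mE (.inr y) a)

end

/-- The adjustment Adj: equations with deleted items become false, and quantified nodes and edges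
are different from the new nodes and edges. -/
def adj : {n m : ℕ} → Fm w.SC n m → Fm w.SR n m
  | _, _, .tru => .tru
  | _, _, .fls => .fls
  | _, _, .at A => w.adjAtomic A
  | _, _, .neg φ => .neg (adj φ)
  | _, _, .and φ ψ => .and (adj φ) (adj ψ)
  | _, _, .or φ ψ => .or (adj φ) (adj ψ)
  | _, _, .exV φ => .exV (.and
      (.bigAnd ((List.finRange w.nN).map fun v =>
        .neg (.at (.nodeEq (.ref (.inr 0)) (.ref (.inl (.inr v)))))))
      (adj φ))
  | _, _, .exE φ => .exE (.and
      (.bigAnd ((List.finRange w.eR).map fun e => .neg (.at (.edgeEq (.inr 0) (.inl e)))))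
      (adj φ))
  | _, _, .exL x φ => .exL x (adj φ)

/-- The predicate that states the type of a label variable. -/
def typeOf (x : LVar) : Fm w.SR 0 0 :=
  match x.ty with
  | .list => .tru
  | .atom => .at (.typ .atom x)
  | .int => .at (.typ .int x)
  | .string => .at (.typ .string x)
  | .char => .at (.typ .char x)

/-- The specification Spec of the right-hand graph. -/
def spec : Fm w.SR 0 0 :=
  .bigAnd (
    (w.right.vars (nodeList w.nK w.nN) (List.finRange w.eR)).map w.typeOf ++
    (nodeList w.nK w.nN).map (fun v =>
      .and (.at (.leq (.leaf (.lV (.ref (.inl v)))) (w.lstToR (w.right.nlist v))))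
        (.and (.at (.mV (.ref (.inl v)) (.mark (w.right.nmark v))))
          (if w.right.root v then .at (.root (.ref (.inl v)))
            else .neg (.at (.root (.ref (.inl v))))))) ++
    (List.finRange w.eR).map (fun e =>
      .and (.at (.nodeEq (.src (.inl e)) (.ref (.inl (w.right.src e)))))
        (.and (.at (.nodeEq (.tgt (.inl e)) (.ref (.inl (w.right.tgt e)))))
          (.and (.at (.leq (.leaf (.lE (.inl e))) (w.lstToR (w.right.elist e))))
            (.at (.mE (.inl e) (.mark (w.right.emark e))))))))

/-- The transformation Shift, giving a right application condition. -/
def shift (c : Cond) : Fm w.SR 0 0 :=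
  .and (w.adj (w.lift c)) (.and w.acR (.and w.spec w.inv.dang))

/-- The constants of `R` are pairwise different. -/
def distinct : Fm w.SR 0 0 :=
  .and
    (.bigAnd ((nodeList w.nK w.nN).flatMap fun u =>
      ((nodeList w.nK w.nN).filter fun v => v ≠ u).map fun v =>
        .neg (.at (.nodeEq (.ref (.inl u)) (.ref (.inl v))))))
    (.bigAnd ((List.finRange w.eR).flatMap fun e =>
      ((List.finRange w.eR).filter fun f => f ≠ e).map fun f =>
        .neg (.at (.edgeEq (.inl e) (.inl f)))))

/-- The transformation Var: node and edge constants are replaced by pairwise different fresh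
variables. -/
def var (φ : Fm w.SR 0 0) : Fm Sig.FO (w.nK + w.nN) w.eR :=
  (Fm.and w.distinct φ).sub
    ⟨Sum.elim (fun v => .inr (finSumFinEquiv v)) Fin.elim0, Sum.elim .inr Fin.elim0, Empty.elim,
      Fin.elim0, Fin.elim0⟩

end GRule

/-- Existential closures. -/
def closeV {S : Sig} {m : ℕ} : (n : ℕ) → Fm S n m → Fm S 0 m
  | 0, φ => φ
  | n + 1, φ => closeV n (.exV φ)

def closeE {S : Sig} {n : ℕ} : (m : ℕ) → Fm S n m → Fm S n 0
  | 0, φ => φ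
  | m + 1, φ => closeE m (.exE φ)

def closeL {S : Sig} {n m : ℕ} (φ : Fm S n m) : Fm S n m := φ.freeL.dedup.foldr .exL φ

/-- The formula Post. -/
def GRule.post (w : GRule) (c : Cond) : Cond :=
  closeV _ (closeE _ (closeL (w.var (w.shift c))))

/-- All choices of marks for the items marked `any`. -/
noncomputable def Rule.choices (r : Rule) : List (r.NMarks × r.EMarks) := Finset.univ.toList

/-- The formula `Slp(c,r)`. -/
noncomputable def Slp (c : Cond) (r : Rule) : Cond :=
  .bigOr (r.choices.map fun p => (r.gen p.1 p.2).post c)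

/-- The formula `Slp(c,r⁻¹)`. -/
noncomputable def SlpInv (c : Cond) (r : Rule) : Cond :=
  .bigOr (r.choices.map fun p => (r.gen p.1 p.2).inv.post c)

/-! ### Success, Fail and the syntactic calculus -/

/-- Loop-free programs. -/
def Com.LoopFree : Com → Prop
  | .call _ => True
  | .seq P Q => P.LoopFree ∧ Q.LoopFree
  | .ifte C P Q => C.LoopFree ∧ P.LoopFree ∧ Q.LoopFree
  | .tryte C P Q => C.LoopFree ∧ P.LoopFree ∧ Q.LoopFree
  | .loop _ => False
  | .choice P Q => P.LoopFree ∧ Q.LoopFree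
  | .brk => True

mutual
/-- For a loop-free program `P`: the formula expressing that some graph in `⟦P⟧G` satisfies `c`. -/
noncomputable def Com.pre : Com → Cond → Cond
  | .call R, c => .bigOr (R.map fun r => SlpInv c r)
  | .seq P Q, c => P.pre (Q.pre c)
  | .ifte C P Q, c => .or (.and (C.pre .tru) (P.pre c)) (.and C.failLF (Q.pre c))
  | .tryte C P Q, c => .or (C.pre (P.pre c)) (.and C.failLF (Q.pre c))
  | .loop _, _ => .fls
  | .choice P Q, c => .or (P.pre c) (Q.pre c)
  | .brk, _ => .fls

/-- The formula Fail for a loop-free program. -/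
noncomputable def Com.failLF : Com → Cond
  | .call R => .neg (.bigOr (R.map fun r => SlpInv .tru r))
  | .seq P Q => .or P.failLF (P.pre Q.failLF)
  | .ifte C P Q => .or (.and (C.pre .tru) P.failLF) (.and C.failLF Q.failLF)
  | .tryte C P Q => .or (C.pre P.failLF) (.and C.failLF Q.failLF)
  | .loop _ => .fls
  | .choice P Q => .or P.failLF Q.failLF
  | .brk => .fls
end

/-- The formula Success for a loop-free program. -/
noncomputable def Com.success (P : Com) : Cond := P.pre .tru

/-- Non-failing commands. -/
def Com.NonFailing : Com → Prop
  | .call R => R ≠ [] ∧ ∀ r ∈ R, r.nK = 0 ∧ r.nD = 0 ∧ r.cond = none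
  | .seq P Q => P.NonFailing ∧ Q.NonFailing
  | .ifte _ P Q => P.NonFailing ∧ Q.NonFailing
  | .tryte _ P Q => P.NonFailing ∧ Q.NonFailing
  | .loop _ => True
  | .choice _ _ => False
  | .brk => True

/-- The commands of a command sequence. -/
def Com.items : Com → List Com
  | .seq P Q => P.items ++ Q.items
  | P => [P]

/-- `S` is the sequence `C;P` (up to bracketing). -/
def Com.IsSeq (S C P : Com) : Prop := S.items = C.items ++ P.items

/-- Iteration commands. -/
inductive Com.Iteration : Com → Prop
  | loopFree {S : Com} : S.LoopFree → Iteration S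
  | nonFailing {S : Com} : S.NonFailing → Iteration S
  | seq {S C P : Com} : C.LoopFree → Iteration P → S.IsSeq C P → Iteration S

/-- `FailOf S f`: the formula `f` is `Fail(S)`, for an iteration command `S`. -/
inductive FailOf : Com → Cond → Prop
  | nonFailing {S : Com} : S.NonFailing → FailOf S .fls
  | loopFree {S : Com} : S.LoopFree → FailOf S S.failLF
  | seq {S C P : Com} : C.LoopFree → P.NonFailing → S.IsSeq C P → FailOf S C.failLF

/-- Control commands. -/
def Com.Control : Com → Prop
  | .call _ => True
  | .seq P Q => P.Control ∧ Q.Control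
  | .ifte C P Q => C.LoopFree ∧ P.Control ∧ Q.Control
  | .tryte C P Q => C.LoopFree ∧ P.Control ∧ Q.Control
  | .loop P => P.Iteration ∧ P.Control
  | .choice P Q => P.Control ∧ Q.Control
  | .brk => True

/-- Derivability in the syntactic calculus. -/
inductive SYN : Cond → Com → Cond → Prop
  | ruleapp_slp (c : Cond) (r : Rule) : SYN c (.call [r]) (Slp c r)
  | ruleapp_wlp (d : Cond) (r : Rule) : SYN (.neg (SlpInv (.neg d) r)) (.call [r]) d
  | ruleset {c d : Cond} (R : List Rule) :
      (∀ r ∈ R, SYN c (.call [r]) d) → SYN c (.call R) d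
  | comp {c e d : Cond} {P Q : Com} : P.Control → Q.Control →
      SYN c P e → SYN e Q d → SYN c (.seq P Q) d
  | cons {c c' d d' : Cond} {P : Com} : P.Control →
      (∀ G, c.Models G → c'.Models G) → SYN c' P d' → (∀ G, d'.Models G → d.Models G) → SYN c P d
  | ite {c d : Cond} {C P Q : Com} : C.LoopFree → P.Control → Q.Control →
      SYN (.and c C.success) P d → SYN (.and c C.failLF) Q d → SYN c (.ifte C P Q) d
  | tryte {c d : Cond} {C P Q : Com} : C.LoopFree → P.Control → Q.Control →
      SYN (.and c C.success) (.seq C P) d → SYN (.and c C.failLF) Q d → SYN c (.tryte C P Q) d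
  | alap {c d f : Cond} {S : Com} : S.Iteration → FailOf S f →
      SYN c S c → Break c.Models S d.Models → SYN c (.loop S) (.or (.and c f) d)

end GP2

-- Each proof rule preserves partial correctness, so both parts go by induction on derivations, with
-- terminating runs of composite commands decomposed by inversion of their first step (`Leads.seq`,
-- `Leads.ifte`, `Leads.tryte`, `Leads.loop`). For the semantic calculus nothing more is needed: its
-- axioms are liberal by definition. The syntactic calculus rests on three facts about its formulas.
--
-- The first is that Slp(c,r) holds after every application of r to a model of c, and Slp(c,r⁻¹)
-- before every application with a result satisfying c. A natural double pushout along an unlabelled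
-- discrete interface amounts to one context D into which L is glued to give G and R to give H
-- (`glue_of_bicartesianSq`, `Glue.bicartesianSq`). This description, `Transition`, is symmetric, so
-- the inverse rule comes for free. A node of G lies in L or in D outside the interface, and an edge
-- of G lies in L or in D. Split separates these cases for every quantifier and for the endpoints of
-- quantified edges. Val then computes whatever concerns L, expressing degrees of interface nodes
-- through their degrees in D. What remains concerns context items, whose labels, roots and
-- incidences agree in G and H, and Adj recovers the context degrees from H. Thus the transformed
-- formula holds in H exactly when the original holds in G (`Transition.sat_adj_val_split`), and
-- Post follows (`Transition.models_post`).
--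
-- The second fact is that Success and Fail hold whenever a run succeeds or fails. For Pre this is
-- one-directional and follows from the first fact. But Fail of a rule set is a negation, so there a
-- converse is needed: Spec, Dang and the application condition on the L side yield a match with no
-- dangling edges, whose context can be glued with R (`exists_derivesBy_of_models`). The structural
-- induction is `Com.LoopFree.models`; non-failing commands are treated separately, since their Fail
-- is false (`Com.NonFailing.not_leads_fail`).
--
-- The third fact is that Post closes all label variables, so Success, Fail and Slp(c,r⁻¹) do not
-- depend on an assignment (`Com.closed_pre`, `closed_SlpInv`). As a model of a condition needs only
-- some assignment of its free label variables, conjunction and negation would otherwise not have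
-- their semantic meaning.

namespace GP2

/-! ### Natural double pushouts, concretely -/

/-- Rule graphs with evaluated labels. -/
abbrev EGraph (nK nX nE : ℕ) := RGraph (Fin nK ⊕ Fin nX) (Fin nE) HList NodeMark EdgeMark

variable {nK nX nE : ℕ}

def EGraph.toPGraph (A : EGraph nK nX nE) : PGraph where
  V := Fin nK ⊕ Fin nX
  E := Fin nE
  src := A.src
  tgt := A.tgt
  nodeLabel := fun v => some (A.nlist v, A.nmark v)
  root := fun v => some (A.root v)
  edgeLabel := fun e => (A.elist e, A.emark e)

/-- The graph with `nK` unlabelled nodes and without edges. -/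
def discrete (nK : ℕ) : PGraph where
  V := Fin nK
  E := Empty
  src := Empty.elim
  tgt := Empty.elim
  nodeLabel := fun _ => none
  root := fun _ => none
  edgeLabel := Empty.elim

/-- The morphism from a discrete graph that is given by a map of nodes. -/
def discreteHom (D : PGraph) (k : Fin nK → D.V) : discrete nK ⟶ D :=
  PGraph.Hom.mk (A := discrete nK) k Empty.elim (fun e => e.elim) (fun e => e.elim)
    (fun _ _ h => by cases h) (fun _ _ h => by cases h) (fun e => e.elim)

theorem discrete_hom_ext {D : PGraph} {f g : discrete nK ⟶ D} (h : f.fV = g.fV) : f = g :=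
  PGraph.Hom.ext h (funext fun e => e.elim)

def EGraph.incl (A : EGraph nK nX nE) : discrete nK ⟶ A.toPGraph :=
  discreteHom A.toPGraph Sum.inl

/-- The host graph `G` is obtained by gluing the rule graph `A` and the graph `D` along the
interface nodes `k`, which are the nodes of `D` without labels and roots. -/
structure Glue (A : EGraph nK nX nE) (D : PGraph) (k : Fin nK → D.V) (G : HostGraph) where
  m : A.toPGraph ⟶ G.toPGraph
  d : D ⟶ G.toPGraph
  comm : ∀ v, m.fV (Sum.inl v) = d.fV (k v)
  injV_m : Function.Injective m.fV
  injE_m : Function.Injective m.fE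
  injV_d : Function.Injective d.fV
  injE_d : Function.Injective d.fE
  disjV : ∀ x j, d.fV x ≠ m.fV (Sum.inr j)
  disjE : ∀ q f, d.fE q ≠ m.fE f
  surjV : ∀ v : G.V, (∃ x, d.fV x = v) ∨ ∃ j, m.fV (Sum.inr j) = v
  surjE : ∀ e : G.E, (∃ q, d.fE q = e) ∨ ∃ f, m.fE f = e
  node_k : ∀ v, D.nodeLabel (k v) = none
  root_k : ∀ v, D.root (k v) = none
  node_d : ∀ x, x ∉ Set.range k → ∃ l, D.nodeLabel x = some l
  root_d : ∀ x, x ∉ Set.range k → ∃ b, D.root x = some b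

section
open Classical

/-- The pushout of a rule graph and a graph with unlabelled interface nodes. -/
noncomputable def glueObj (A : EGraph nK nX nE) (D : PGraph) (k : Fin nK → D.V) : PGraph where
  V := D.V ⊕ Fin nX
  E := D.E ⊕ Fin nE
  finV := by have := D.finV; infer_instance
  finE := by have := D.finE; infer_instance
  src := Sum.elim (fun q => .inl (D.src q)) (fun f => Sum.map k id (A.src f))
  tgt := Sum.elim (fun q => .inl (D.tgt q)) (fun f => Sum.map k id (A.tgt f))
  nodeLabel := Sum.elim
    (fun x => if h : ∃ v, k v = x then some (A.nlist (.inl h.choose), A.nmark (.inl h.choose))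
      else D.nodeLabel x)
    (fun j => some (A.nlist (.inr j), A.nmark (.inr j)))
  root := Sum.elim
    (fun x => if h : ∃ v, k v = x then some (A.root (.inl h.choose)) else D.root x)
    (fun j => some (A.root (.inr j)))
  edgeLabel := Sum.elim D.edgeLabel (fun f => (A.elist f, A.emark f))

variable {A : EGraph nK nX nE} {D : PGraph} {k : Fin nK → D.V}

/-- Injectivity of the interface map leaves only one possible value for the choice made in
`glueObj`. -/
theorem glueObj_nodeLabel_inl (hk : Function.Injective k) (v : Fin nK) :
    (glueObj A D k).nodeLabel (.inl (k v)) = some (A.nlist (.inl v), A.nmark (.inl v)) := by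
  have h : ∃ u, k u = k v := ⟨v, rfl⟩
  have e : h.choose = v := hk h.choose_spec
  simp only [glueObj, Sum.elim_inl]
  rw [dif_pos h, e]

theorem glueObj_root_inl (hk : Function.Injective k) (v : Fin nK) :
    (glueObj A D k).root (.inl (k v)) = some (A.root (.inl v)) := by
  have h : ∃ u, k u = k v := ⟨v, rfl⟩
  have e : h.choose = v := hk h.choose_spec
  simp only [glueObj, Sum.elim_inl]
  rw [dif_pos h, e]

theorem glueObj_nodeLabel_of_notMem {x : D.V} (hx : x ∉ Set.range k) :
    (glueObj A D k).nodeLabel (.inl x) = D.nodeLabel x :=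
  dif_neg (c := ∃ v, k v = x) hx

theorem glueObj_root_of_notMem {x : D.V} (hx : x ∉ Set.range k) :
    (glueObj A D k).root (.inl x) = D.root x :=
  dif_neg (c := ∃ v, k v = x) hx

noncomputable def glueLeft (A : EGraph nK nX nE) (D : PGraph) (k : Fin nK → D.V)
    (hk : Function.Injective k) : A.toPGraph ⟶ glueObj A D k :=
  PGraph.Hom.mk (A := A.toPGraph) (B := glueObj A D k) (Sum.map k id) Sum.inr
    (fun _ => rfl) (fun _ => rfl)
    (by
      rintro (v | j) l h
      · exact (glueObj_nodeLabel_inl hk v).trans h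
      · exact h)
    (by
      rintro (v | j) l h
      · exact (glueObj_root_inl hk v).trans h
      · exact h)
    (fun _ => rfl)

/-- Interface nodes receive the labels and roots of the rule graph. This is compatible with a
morphism from `D` only because `D` leaves them undefined there. -/
noncomputable def glueRight (A : EGraph nK nX nE) (D : PGraph) (k : Fin nK → D.V)
    (hn : ∀ v, D.nodeLabel (k v) = none) (hr : ∀ v, D.root (k v) = none) : D ⟶ glueObj A D k :=
  PGraph.Hom.mk (A := D) (B := glueObj A D k) Sum.inl Sum.inl
    (fun _ => rfl) (fun _ => rfl)
    (by
      intro x l h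
      have hx : ¬ ∃ v, k v = x := by
        rintro ⟨v, rfl⟩
        simp [hn] at h
      exact (glueObj_nodeLabel_of_notMem hx).trans h)
    (by
      intro x l h
      have hx : ¬ ∃ v, k v = x := by
        rintro ⟨v, rfl⟩
        simp [hr] at h
      exact (glueObj_root_of_notMem hx).trans h)
    (fun _ => rfl)

/-- The morphism from the glued graph to any common target. -/
noncomputable def glueDesc {T : PGraph} (m : A.toPGraph ⟶ T) (d : D ⟶ T)
    (comm : ∀ v, m.fV (Sum.inl v) = d.fV (k v)) : glueObj A D k ⟶ T :=
  PGraph.Hom.mk (A := glueObj A D k) (B := T)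
    (Sum.elim d.fV (fun j => m.fV (Sum.inr j))) (Sum.elim d.fE m.fE)
    (by
      rintro (q | f)
      · exact d.src q
      · refine (m.src f).trans ?_
        change m.fV (A.src f) = Sum.elim d.fV (fun j => m.fV (Sum.inr j)) (Sum.map k id (A.src f))
        rcases A.src f with v | j
        · exact comm v
        · rfl)
    (by
      rintro (q | f)
      · exact d.tgt q
      · refine (m.tgt f).trans ?_
        change m.fV (A.tgt f) = Sum.elim d.fV (fun j => m.fV (Sum.inr j)) (Sum.map k id (A.tgt f))
        rcases A.tgt f with v | j
        · exact comm v
        · rfl)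
    (by
      rintro (x | j) l h
      · simp only [glueObj, Sum.elim_inl] at h
        split_ifs at h with hx
        · have := m.node _ _ h
          rw [comm, hx.choose_spec] at this
          exact this
        · exact d.node _ _ h
      · exact m.node _ _ h)
    (by
      rintro (x | j) l h
      · simp only [glueObj, Sum.elim_inl] at h
        split_ifs at h with hx
        · have := m.root _ _ h
          rw [comm, hx.choose_spec] at this
          exact this
        · exact d.root _ _ h
      · exact m.root _ _ h)
    (by
      rintro (q | f)
      · exact d.edge q
      · exact m.edge f)

end

section
variable {A : EGraph nK nX nE} {D : PGraph} {G : HostGraph}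

/-- The graph with a single node and no edges. -/
def singleNode (l : Option (HList × NodeMark)) (b : Option Bool) : PGraph where
  V := Unit
  E := Empty
  src := Empty.elim
  tgt := Empty.elim
  nodeLabel := fun _ => l
  root := fun _ => b
  edgeLabel := Empty.elim

def singleNodeHom {l : Option (HList × NodeMark)} {b : Option Bool} (T : PGraph) (x : T.V)
    (hl : ∀ a, l = some a → T.nodeLabel x = some a) (hb : ∀ a, b = some a → T.root x = some a) :
    singleNode l b ⟶ T :=
  PGraph.Hom.mk (A := singleNode l b) (B := T) (fun _ => x) Empty.elim (fun e => e.elim)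
    (fun e => e.elim) (fun _ => hl) (fun _ => hb) (fun e => e.elim)

/-- The interface nodes of a natural pushout complement have neither labels nor roots. -/
theorem unlabelled_of_isPullback {k : discrete nK ⟶ D} {m : A.toPGraph ⟶ G.toPGraph}
    {d : D ⟶ G.toPGraph} (h : IsPullback A.incl k m d) (v : Fin nK) :
    D.nodeLabel (k.fV v) = none ∧ D.root (k.fV v) = none := by
  have comm : m.fV (Sum.inl v) = d.fV (k.fV v) := congrFun (congrArg PGraph.Hom.fV h.w) v
  -- The test object is one node carrying exactly the label and root that `D` has at the interface
  -- node. It also maps to `A`: labels and roots are total in `A`, and both morphisms into `G`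
  -- preserve them, so the values must agree.
  let a := singleNodeHom (l := D.nodeLabel (k.fV v)) (b := D.root (k.fV v)) A.toPGraph (Sum.inl v)
    (by
      intro l hl
      have h1 := d.node _ _ hl
      have h2 := m.node (Sum.inl v) _ rfl
      rw [comm, h1] at h2
      exact h2.symm)
    (by
      intro l hl
      have h1 := d.root _ _ hl
      have h2 := m.root (Sum.inl v) _ rfl
      rw [comm, h1] at h2
      exact h2.symm)
  let b := singleNodeHom (l := D.nodeLabel (k.fV v)) (b := D.root (k.fV v)) D (k.fV v)
    (fun _ h => h) (fun _ h => h)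
  obtain ⟨t, -, -⟩ := h.exists_lift a b
    (PGraph.Hom.ext (funext fun _ => comm) (funext fun e => e.elim))
  -- The lift lands in a graph without labels and roots. Morphisms preserve defined values, so the
  -- test node can carry none.
  constructor
  · cases hl : D.nodeLabel (k.fV v) with
    | none => rfl
    | some l => exact absurd (t.node () l hl) (by simp [discrete])
  · cases hl : D.root (k.fV v) with
    | none => rfl
    | some l => exact absurd (t.root () l hl) (by simp [discrete])

/-- A natural pushout along an injective interface is a gluing. -/
theorem glue_of_bicartesianSq {k : discrete nK ⟶ D} {m : A.toPGraph ⟶ G.toPGraph}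
    {d : D ⟶ G.toPGraph} (h : BicartesianSq A.incl k m d) (hk : Function.Injective k.fV) :
    ∃ γ : Glue A D k.fV G, γ.m = m ∧ γ.d = d := by
  have hu := unlabelled_of_isPullback h.toIsPullback
  have comm : ∀ v, m.fV (Sum.inl v) = d.fV (k.fV v) :=
    fun v => congrFun (congrArg PGraph.Hom.fV h.w) v
  let a := glueLeft A D k.fV hk
  let b := glueRight A D k.fV (fun v => (hu v).1) (fun v => (hu v).2)
  -- Compare `G` with the explicit glued graph. On it the images of `A` and `D` are visibly
  -- injective and meet only in the interface, and these properties pull back along `u`.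
  obtain ⟨u, hua, hub⟩ := h.toIsPushout.exists_desc a b
    (discrete_hom_ext (funext fun v => rfl))
  have ua : ∀ v, u.fV (m.fV v) = Sum.map k.fV id v := congrFun (congrArg PGraph.Hom.fV hua)
  have ub : ∀ x, u.fV (d.fV x) = Sum.inl x := congrFun (congrArg PGraph.Hom.fV hub)
  have va : ∀ f, u.fE (m.fE f) = Sum.inr f := congrFun (congrArg PGraph.Hom.fE hua)
  have vb : ∀ q, u.fE (d.fE q) = Sum.inl q := congrFun (congrArg PGraph.Hom.fE hub)
  let w := glueDesc m d comm
  -- This one-sided inverse suffices: it shows that every item of `G` comes from `D` or from `A`.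
  have huw : u ≫ w = 𝟙 _ := by
    apply h.toIsPushout.hom_ext
    · rw [← Category.assoc, hua]
      refine PGraph.Hom.ext (funext ?_) (funext fun _ => rfl)
      rintro (v | j)
      · exact (comm v).symm
      · rfl
    · rw [← Category.assoc, hub]
      rfl
  have wV : ∀ v : G.V, w.fV (u.fV v) = v := congrFun (congrArg PGraph.Hom.fV huw)
  have wE : ∀ e : G.E, w.fE (u.fE e) = e := congrFun (congrArg PGraph.Hom.fE huw)
  refine ⟨⟨m, d, comm, ?_, ?_, ?_, ?_, ?_, ?_, ?_, ?_, fun v => (hu v).1, fun v => (hu v).2,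
    ?_, ?_⟩, rfl, rfl⟩
  · intro x y hxy
    have := (ua x).symm.trans ((congrArg u.fV hxy).trans (ua y))
    exact (Function.Injective.sumMap hk Function.injective_id) this
  · intro x y hxy
    exact Sum.inr_injective ((va x).symm.trans ((congrArg u.fE hxy).trans (va y)))
  · intro x y hxy
    exact Sum.inl_injective ((ub x).symm.trans ((congrArg u.fV hxy).trans (ub y)))
  · intro x y hxy
    exact Sum.inl_injective ((vb x).symm.trans ((congrArg u.fE hxy).trans (vb y)))
  · intro x j hxy
    exact Sum.inl_ne_inr ((ub x).symm.trans ((congrArg u.fV hxy).trans (ua (.inr j))))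
  · intro x j hxy
    exact Sum.inl_ne_inr ((vb x).symm.trans ((congrArg u.fE hxy).trans (va j)))
  · intro v
    have hv := wV v
    rcases hx : u.fV v with x | j
    · rw [hx] at hv
      exact .inl ⟨x, hv⟩
    · rw [hx] at hv
      exact .inr ⟨j, hv⟩
  · intro e
    have hv := wE e
    rcases hx : u.fE e with x | j
    · rw [hx] at hv
      exact .inl ⟨x, hv⟩
    · rw [hx] at hv
      exact .inr ⟨j, hv⟩
  -- Labels and roots are total in `G` and are preserved by `u`. Outside the interface the glued
  -- graph has the values of `D`, which are therefore defined.
  · intro x hx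
    have h1 := u.node (d.fV x) _ rfl
    rw [ub] at h1
    exact ⟨_, (glueObj_nodeLabel_of_notMem (k := k.fV) hx).symm.trans h1⟩
  · intro x hx
    have h1 := u.root (d.fV x) _ rfl
    rw [ub] at h1
    exact ⟨_, (glueObj_root_of_notMem (k := k.fV) hx).symm.trans h1⟩

theorem hom_ext_of_surj {G T : PGraph} {B D : PGraph} (m : B ⟶ G) (d : D ⟶ G)
    (sV : ∀ v, (∃ x, d.fV x = v) ∨ ∃ x, m.fV x = v) (sE : ∀ e, (∃ q, d.fE q = e) ∨ ∃ f, m.fE f = e)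
    {φ ψ : G ⟶ T} (h1 : m ≫ φ = m ≫ ψ) (h2 : d ≫ φ = d ≫ ψ) : φ = ψ := by
  refine PGraph.Hom.ext (funext fun v => ?_) (funext fun e => ?_)
  · rcases sV v with ⟨x, rfl⟩ | ⟨x, rfl⟩
    · exact congrFun (congrArg PGraph.Hom.fV h2) x
    · exact congrFun (congrArg PGraph.Hom.fV h1) x
  · rcases sE e with ⟨x, rfl⟩ | ⟨x, rfl⟩
    · exact congrFun (congrArg PGraph.Hom.fE h2) x
    · exact congrFun (congrArg PGraph.Hom.fE h1) x

variable {k : Fin nK → D.V}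

theorem Glue.injective_k (γ : Glue A D k G) : Function.Injective k := by
  intro u v h
  have := (γ.comm u).trans ((congrArg γ.d.fV h).trans (γ.comm v).symm)
  exact Sum.inl_injective (γ.injV_m this)

/-- The inverse of the comparison morphism from the glued graph. -/
theorem Glue.exists_inv (γ : Glue A D k G) : ∃ u : G.toPGraph ⟶ glueObj A D k,
    γ.m ≫ u = glueLeft A D k γ.injective_k ∧ γ.d ≫ u = glueRight A D k γ.node_k γ.root_k := by
  have h1 : ∀ v : G.V, ∃ x : D.V ⊕ Fin nX, (glueDesc γ.m γ.d γ.comm).fV x = v := by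
    intro v
    rcases γ.surjV v with ⟨x, hx⟩ | ⟨j, hj⟩
    · exact ⟨.inl x, hx⟩
    · exact ⟨.inr j, hj⟩
  have h2 : ∀ v : G.E, ∃ x : D.E ⊕ Fin nE, (glueDesc γ.m γ.d γ.comm).fE x = v := by
    intro v
    rcases γ.surjE v with ⟨x, hx⟩ | ⟨j, hj⟩
    · exact ⟨.inl x, hx⟩
    · exact ⟨.inr j, hj⟩
  choose fV hV using h1
  choose fE hE using h2
  have iV : Function.Injective (glueDesc γ.m γ.d γ.comm).fV := by
    rintro (x | x) (y | y) h
    · exact congrArg _ (γ.injV_d h)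
    · exact absurd h (γ.disjV x y)
    · exact absurd h.symm (γ.disjV y x)
    · exact congrArg _ (Sum.inr_injective (γ.injV_m h))
  have iE : Function.Injective (glueDesc γ.m γ.d γ.comm).fE := by
    rintro (x | x) (y | y) h
    · exact congrArg _ (γ.injE_d h)
    · exact absurd h (γ.disjE x y)
    · exact absurd h.symm (γ.disjE y x)
    · exact congrArg _ (γ.injE_m h)
  let w := glueDesc γ.m γ.d γ.comm
  have fm : ∀ v, fV (γ.m.fV v) = Sum.map k id v := by
    intro v
    refine iV ((hV _).trans ?_)
    rcases v with v | j
    · exact γ.comm v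
    · rfl
  have fd : ∀ x, fV (γ.d.fV x) = Sum.inl x := fun x => iV (hV _)
  have em : ∀ f, fE (γ.m.fE f) = Sum.inr f := fun x => iE (hE _)
  have ed : ∀ q, fE (γ.d.fE q) = Sum.inl q := fun x => iE (hE _)
  -- A bijective morphism of partially labelled graphs need not be invertible, since it may add
  -- labels. Totality on the source excludes this.
  have lab : ∀ x : D.V ⊕ Fin nX, (∃ l, (glueObj A D k).nodeLabel x = some l) ∧
      ∃ b, (glueObj A D k).root x = some b := by
    rintro (x | j)
    · by_cases hx : x ∈ Set.range k
      · obtain ⟨v, rfl⟩ := hx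
        exact ⟨⟨_, glueObj_nodeLabel_inl γ.injective_k v⟩, ⟨_, glueObj_root_inl γ.injective_k v⟩⟩
      · rw [glueObj_nodeLabel_of_notMem hx, glueObj_root_of_notMem hx]
        exact ⟨γ.node_d x hx, γ.root_d x hx⟩
    · exact ⟨⟨_, rfl⟩, ⟨_, rfl⟩⟩
  let u : G.toPGraph ⟶ glueObj A D k :=
    PGraph.Hom.mk (A := G.toPGraph) (B := glueObj A D k) fV fE
      (fun e => iV ((w.src (fE e)).symm.trans ((congrArg G.src (hE e)).trans (hV _).symm)))
      (fun e => iV ((w.tgt (fE e)).symm.trans ((congrArg G.tgt (hE e)).trans (hV _).symm)))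
      (by
        intro v l hl
        obtain ⟨l', h'⟩ := (lab (fV v)).1
        have := w.node _ _ h'
        rw [hV v] at this
        rw [h', ← this, ← hl])
      (by
        intro v l hl
        obtain ⟨l', h'⟩ := (lab (fV v)).2
        have := w.root _ _ h'
        rw [hV v] at this
        rw [h', ← this, ← hl])
      (by
        intro e
        have := w.edge (fE e)
        rw [hE e] at this
        exact this.symm)
  exact ⟨u, PGraph.Hom.ext (funext fm) (funext em), PGraph.Hom.ext (funext fd) (funext ed)⟩

/-- The pullback property holds because the images of `A` and `D` share no edges, share only
interface nodes, and the latter are unlabelled in `D`. The pushout property is transported from the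
explicit glued graph. -/
theorem Glue.bicartesianSq (γ : Glue A D k G) :
    BicartesianSq A.incl (discreteHom D k) γ.m γ.d := by
  have hw : A.incl ≫ γ.m = discreteHom D k ≫ γ.d := discrete_hom_ext (funext γ.comm)
  refine ⟨IsPullback.mk' hw ?_ ?_, (IsPushout.mk' hw ?_ ?_).isColimit'⟩
  · intro T φ ψ h1 _
    refine PGraph.Hom.ext (funext fun v => ?_) (funext fun e => (φ.fE e).elim)
    exact Sum.inl_injective (congrFun (congrArg PGraph.Hom.fV h1) v)
  · intro T a b h
    have hV : ∀ x, γ.m.fV (a.fV x) = γ.d.fV (b.fV x) := congrFun (congrArg PGraph.Hom.fV h)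
    have hE : ∀ x, γ.m.fE (a.fE x) = γ.d.fE (b.fE x) := congrFun (congrArg PGraph.Hom.fE h)
    have h1 : ∀ x, ∃ v, a.fV x = Sum.inl v ∧ b.fV x = k v := by
      intro x
      rcases hx : a.fV x with v | j
      · refine ⟨v, rfl, γ.injV_d ?_⟩
        rw [← hV, ← γ.comm, hx]
      · have := hV x
        rw [hx] at this
        exact absurd this.symm (γ.disjV _ _)
    choose t ht1 ht2 using h1
    -- An edge of the test object would have a common image under `m` and `d`, but the edge images
    -- are disjoint.
    have noE : ∀ e : T.E, False := fun e => γ.disjE _ _ (hE e).symm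
    refine ⟨PGraph.Hom.mk (A := T) (B := discrete nK) t (fun e => (noE e).elim)
      (fun e => (noE e).elim) (fun e => (noE e).elim) ?_ ?_ (fun e => (noE e).elim), ?_, ?_⟩
    · intro x l hl
      have := b.node _ _ hl
      rw [ht2, γ.node_k] at this
      cases this
    · intro x l hl
      have := b.root _ _ hl
      rw [ht2, γ.root_k] at this
      cases this
    · exact PGraph.Hom.ext (funext fun x => (ht1 x).symm) (funext fun e => (noE e).elim)
    · exact PGraph.Hom.ext (funext fun x => (ht2 x).symm) (funext fun e => (noE e).elim)
  · intro T φ ψ h1 h2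
    refine hom_ext_of_surj γ.m γ.d (fun v => ?_) γ.surjE h1 h2
    exact (γ.surjV v).imp id fun ⟨j, hj⟩ => ⟨_, hj⟩
  · intro T a b h
    obtain ⟨u, h1, h2⟩ := γ.exists_inv
    -- The map out of `G` factors through the glued graph, where it can be defined by cases.
    refine ⟨u ≫ glueDesc a b (fun v => congrFun (congrArg PGraph.Hom.fV h) v), ?_, ?_⟩
    · rw [← Category.assoc, h1]
      refine PGraph.Hom.ext (funext ?_) (funext fun _ => rfl)
      rintro (v | j)
      · exact (congrFun (congrArg PGraph.Hom.fV h) v).symm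
      · rfl
    · rw [← Category.assoc, h2]
      rfl

end

end GP2

namespace GP2

-- Contexts of matches and gluing in another rule graph

section
variable {nK nX nE nY nF : ℕ} {A : EGraph nK nX nE} {G : HostGraph}

/-- The context of a match: what remains of `G` when the rule graph except its interface is
removed. -/
noncomputable def context (m : A.toPGraph ⟶ G.toPGraph)
    (dang : ∀ e j, G.src e = m.fV (Sum.inr j) ∨ G.tgt e = m.fV (Sum.inr j) →
      e ∈ Set.range m.fE) : PGraph where
  V := {v : G.V // ∀ j, v ≠ m.fV (Sum.inr j)}
  E := {e : G.E // e ∉ Set.range m.fE}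
  finV := by have := G.finV; infer_instance
  finE := by have := G.finE; infer_instance
  src := fun e => ⟨G.src e.1, fun j h => e.2 (dang e.1 j (.inl h))⟩
  tgt := fun e => ⟨G.tgt e.1, fun j h => e.2 (dang e.1 j (.inr h))⟩
  nodeLabel := by
    classical
    exact fun v => if ∃ u, m.fV (Sum.inl u) = v.1 then none else some (G.nlist v.1, G.nmark v.1)
  root := by
    classical
    exact fun v => if ∃ u, m.fV (Sum.inl u) = v.1 then none else some (G.root v.1)
  edgeLabel := fun e => (G.elist e.1, G.emark e.1)

variable {m : A.toPGraph ⟶ G.toPGraph}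
    {dang : ∀ e j, G.src e = m.fV (Sum.inr j) ∨ G.tgt e = m.fV (Sum.inr j) → e ∈ Set.range m.fE}

theorem context_node {v : (context m dang).V} (h : ¬ ∃ u, m.fV (Sum.inl u) = v.1) :
    (context m dang).nodeLabel v = some (G.nlist v.1, G.nmark v.1) := if_neg h

theorem context_root {v : (context m dang).V} (h : ¬ ∃ u, m.fV (Sum.inl u) = v.1) :
    (context m dang).root v = some (G.root v.1) := if_neg h

theorem context_node_none {v : (context m dang).V} (h : ∃ u, m.fV (Sum.inl u) = v.1) :
    (context m dang).nodeLabel v = none := if_pos h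

theorem context_root_none {v : (context m dang).V} (h : ∃ u, m.fV (Sum.inl u) = v.1) :
    (context m dang).root v = none := if_pos h

/-- The interface nodes in the context. -/
def contextNode (m : A.toPGraph ⟶ G.toPGraph)
    (dang : ∀ e j, G.src e = m.fV (Sum.inr j) ∨ G.tgt e = m.fV (Sum.inr j) → e ∈ Set.range m.fE)
    (injV : Function.Injective m.fV) (u : Fin nK) : (context m dang).V :=
  ⟨m.fV (Sum.inl u), fun _ h => Sum.inl_ne_inr (injV h)⟩

/-- The dangling condition makes sources and targets well defined on what remains after deletion.
Removing labels and roots exactly at the interface makes the resulting square natural. -/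
theorem exists_glue_context (m : A.toPGraph ⟶ G.toPGraph)
    (dang : ∀ e j, G.src e = m.fV (Sum.inr j) ∨ G.tgt e = m.fV (Sum.inr j) → e ∈ Set.range m.fE)
    (injV : Function.Injective m.fV) (injE : Function.Injective m.fE) :
    ∃ γ : Glue A (context m dang) (contextNode m dang injV) G, γ.m = m := by
  let d : context m dang ⟶ G.toPGraph :=
    PGraph.Hom.mk (A := context m dang) (B := G.toPGraph) Subtype.val Subtype.val
      (fun _ => rfl) (fun _ => rfl)
      (by
        intro v l hl
        by_cases h : ∃ u, m.fV (Sum.inl u) = v.1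
        · rw [context_node_none h] at hl
          cases hl
        · rw [context_node h] at hl
          exact hl)
      (by
        intro v l hl
        by_cases h : ∃ u, m.fV (Sum.inl u) = v.1
        · rw [context_root_none h] at hl
          cases hl
        · rw [context_root h] at hl
          exact hl)
      (fun _ => rfl)
  refine ⟨⟨m, d, fun _ => rfl, injV, injE, Subtype.val_injective, Subtype.val_injective,
    fun x j => x.2 j, fun q f h => q.2 ⟨f, h.symm⟩, fun v => ?_, fun e => ?_,
    fun v => context_node_none ⟨v, rfl⟩, fun v => context_root_none ⟨v, rfl⟩,
    fun x hx => ?_, fun x hx => ?_⟩, rfl⟩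
  · by_cases h : ∃ j, m.fV (Sum.inr j) = v
    · exact .inr h
    · exact .inl ⟨⟨v, fun j hj => h ⟨j, hj.symm⟩⟩, rfl⟩
  · by_cases h : e ∈ Set.range m.fE
    · exact .inr h
    · exact .inl ⟨⟨e, h⟩, rfl⟩
  · exact ⟨_, context_node fun ⟨u, hu⟩ => hx ⟨u, Subtype.ext hu⟩⟩
  · exact ⟨_, context_root fun ⟨u, hu⟩ => hx ⟨u, Subtype.ext hu⟩⟩

open Classical in
/-- The host graph obtained from a context by gluing in the rule graph `B`. -/
noncomputable def glueHost (B : EGraph nK nY nF) (D : PGraph) (k : Fin nK → D.V)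
    (l : D.V → HList × NodeMark) (b : D.V → Bool) : HostGraph where
  V := D.V ⊕ Fin nY
  E := D.E ⊕ Fin nF
  finV := by have := D.finV; infer_instance
  finE := by have := D.finE; infer_instance
  src := Sum.elim (fun q => .inl (D.src q)) (fun f => Sum.map k id (B.src f))
  tgt := Sum.elim (fun q => .inl (D.tgt q)) (fun f => Sum.map k id (B.tgt f))
  nlist := Sum.elim
    (fun x => if h : ∃ v, k v = x then B.nlist (.inl h.choose) else (l x).1)
    (fun j => B.nlist (.inr j))
  nmark := Sum.elim
    (fun x => if h : ∃ v, k v = x then B.nmark (.inl h.choose) else (l x).2)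
    (fun j => B.nmark (.inr j))
  root := Sum.elim
    (fun x => if h : ∃ v, k v = x then B.root (.inl h.choose) else b x)
    (fun j => B.root (.inr j))
  elist := Sum.elim (fun q => (D.edgeLabel q).1) B.elist
  emark := Sum.elim (fun q => (D.edgeLabel q).2) B.emark

/-- The context may be combined with any rule graph over the same interface, because only its own
items and its undefined interface labels matter. The total functions `l` and `b`, read off from `G`,
are used only outside the interface, where they agree with `D`. -/
theorem exists_glueHost (γ : Glue A D k G) (B : EGraph nK nY nF) :
    ∃ H, Nonempty (Glue B D k H) := by
  have hk := γ.injective_k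
  let l : D.V → HList × NodeMark := fun x => (G.nlist (γ.d.fV x), G.nmark (γ.d.fV x))
  let b : D.V → Bool := fun x => G.root (γ.d.fV x)
  have ch : ∀ v, ∀ h : ∃ u, k u = k v, h.choose = v := fun v h => hk h.choose_spec
  let m : B.toPGraph ⟶ (glueHost B D k l b).toPGraph :=
    PGraph.Hom.mk (A := B.toPGraph) (B := (glueHost B D k l b).toPGraph) (Sum.map k id) Sum.inr
      (fun _ => rfl) (fun _ => rfl)
      (by
        rintro (v | j) a h
        · refine Eq.trans ?_ h
          have h' : ∃ u, k u = k v := ⟨v, rfl⟩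
          simp only [HostGraph.toPGraph, glueHost, EGraph.toPGraph, Sum.map_inl, Sum.elim_inl]
          rw [dif_pos h', dif_pos h', ch v h']
        · exact h)
      (by
        rintro (v | j) a h
        · refine Eq.trans ?_ h
          have h' : ∃ u, k u = k v := ⟨v, rfl⟩
          simp only [HostGraph.toPGraph, glueHost, EGraph.toPGraph, Sum.map_inl, Sum.elim_inl]
          rw [dif_pos h', ch v h']
        · exact h)
      (fun _ => rfl)
  let d : D ⟶ (glueHost B D k l b).toPGraph :=
    PGraph.Hom.mk (A := D) (B := (glueHost B D k l b).toPGraph) Sum.inl Sum.inl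
      (fun _ => rfl) (fun _ => rfl)
      (by
        intro x a h
        have hx : ¬ ∃ v, k v = x := by
          rintro ⟨v, rfl⟩
          simp [γ.node_k] at h
        simp only [HostGraph.toPGraph, glueHost, Sum.elim_inl]
        rw [dif_neg hx, dif_neg hx]
        exact γ.d.node _ _ h)
      (by
        intro x a h
        have hx : ¬ ∃ v, k v = x := by
          rintro ⟨v, rfl⟩
          simp [γ.root_k] at h
        simp only [HostGraph.toPGraph, glueHost, Sum.elim_inl]
        rw [dif_neg hx]
        exact γ.d.root _ _ h)
      (fun _ => rfl)
  refine ⟨glueHost B D k l b, ⟨⟨m, d, fun _ => rfl,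
    Function.Injective.sumMap hk Function.injective_id, Sum.inr_injective, Sum.inl_injective,
    Sum.inl_injective, fun _ _ => Sum.inl_ne_inr, fun _ _ => Sum.inl_ne_inr, ?_, ?_, γ.node_k,
    γ.root_k, γ.node_d, γ.root_d⟩⟩⟩
  · rintro (x | j)
    · exact .inl ⟨x, rfl⟩
    · exact .inr ⟨j, rfl⟩
  · rintro (x | j)
    · exact .inl ⟨x, rfl⟩
    · exact .inr ⟨j, rfl⟩

end

/-! ### Degrees -/

/-- The numbers of edges of the context that are incident to the interface nodes. -/
noncomputable def PGraph.cdeg {K : Type} (D : PGraph) (k : K → D.V) : CDeg K → ℤ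
  | .incon v => (({q : D.E | D.tgt q = k v}.ncard : ℕ) : ℤ)
  | .outcon v => (({q : D.E | D.src q = k v}.ncard : ℕ) : ℤ)

namespace Glue
variable {nK nX nE : ℕ} {A : EGraph nK nX nE} {D : PGraph} {k : Fin nK → D.V} {G : HostGraph}
  (γ : Glue A D k G)

def mV (v : Fin nK ⊕ Fin nX) : G.V := γ.m.fV v
def mE (f : Fin nE) : G.E := γ.m.fE f
def dV (x : D.V) : G.V := γ.d.fV x
def dE (q : D.E) : G.E := γ.d.fE q

theorem mV_injective : Function.Injective γ.mV := γ.injV_m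
theorem mE_injective : Function.Injective γ.mE := γ.injE_m
theorem dV_injective : Function.Injective γ.dV := γ.injV_d
theorem dE_injective : Function.Injective γ.dE := γ.injE_d

theorem mV_inl (v : Fin nK) : γ.mV (.inl v) = γ.dV (k v) := γ.comm v
theorem dV_ne_mV_inr (x : D.V) (j : Fin nX) : γ.dV x ≠ γ.mV (.inr j) := γ.disjV x j
theorem dE_ne_mE (q : D.E) (f : Fin nE) : γ.dE q ≠ γ.mE f := γ.disjE q f

theorem dV_ne_mV {x : D.V} (hx : x ∉ Set.range k) (v : Fin nK ⊕ Fin nX) : γ.dV x ≠ γ.mV v := by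
  rcases v with v | j
  · rw [mV_inl]
    exact fun h => hx ⟨v, (γ.dV_injective h).symm⟩
  · exact γ.dV_ne_mV_inr x j

/-- Every node belongs to the rule graph or lies in the context outside the interface. -/
theorem node_cases (v : G.V) : (∃ u, γ.mV u = v) ∨ ∃ x, x ∉ Set.range k ∧ γ.dV x = v := by
  rcases γ.surjV v with ⟨x, hx⟩ | ⟨j, hj⟩
  · by_cases h : x ∈ Set.range k
    · obtain ⟨u, rfl⟩ := h
      exact .inl ⟨.inl u, (γ.mV_inl u).trans hx⟩
    · exact .inr ⟨x, h, hx⟩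
  · exact .inl ⟨_, hj⟩

theorem edge_cases (e : G.E) : (∃ f, γ.mE f = e) ∨ ∃ q, γ.dE q = e := (γ.surjE e).symm

theorem src_mE (f : Fin nE) : G.src (γ.mE f) = γ.mV (A.src f) := γ.m.src f
theorem tgt_mE (f : Fin nE) : G.tgt (γ.mE f) = γ.mV (A.tgt f) := γ.m.tgt f
theorem src_dE (q : D.E) : G.src (γ.dE q) = γ.dV (D.src q) := γ.d.src q
theorem tgt_dE (q : D.E) : G.tgt (γ.dE q) = γ.dV (D.tgt q) := γ.d.tgt q

theorem label_mV (v : Fin nK ⊕ Fin nX) :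
    (G.nlist (γ.mV v), G.nmark (γ.mV v)) = (A.nlist v, A.nmark v) :=
  Option.some_injective _ (γ.m.node v _ rfl)
theorem nlist_mV (v : Fin nK ⊕ Fin nX) : G.nlist (γ.mV v) = A.nlist v :=
  congrArg Prod.fst (γ.label_mV v)
theorem nmark_mV (v : Fin nK ⊕ Fin nX) : G.nmark (γ.mV v) = A.nmark v :=
  congrArg Prod.snd (γ.label_mV v)
theorem root_mV (v : Fin nK ⊕ Fin nX) : G.root (γ.mV v) = A.root v :=
  Option.some_injective _ (γ.m.root v _ rfl)
theorem elist_mE (f : Fin nE) : G.elist (γ.mE f) = A.elist f := congrArg Prod.fst (γ.m.edge f)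
theorem emark_mE (f : Fin nE) : G.emark (γ.mE f) = A.emark f := congrArg Prod.snd (γ.m.edge f)

/-- The label is determined by `D` alone, so two host graphs glued from the same context agree on
it. -/
theorem nodeLabel_eq {x : D.V} (hx : x ∉ Set.range k) :
    D.nodeLabel x = some (G.nlist (γ.dV x), G.nmark (γ.dV x)) := by
  obtain ⟨l, hl⟩ := γ.node_d x hx
  exact hl.trans (γ.d.node x l hl).symm

theorem root_eq {x : D.V} (hx : x ∉ Set.range k) : D.root x = some (G.root (γ.dV x)) := by
  obtain ⟨l, hl⟩ := γ.root_d x hx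
  exact hl.trans (γ.d.root x l hl).symm

theorem edgeLabel_eq (q : D.E) : D.edgeLabel q = (G.elist (γ.dE q), G.emark (γ.dE q)) :=
  (γ.d.edge q).symm

/-- The edges of a gluing are the disjoint union of the context edges and the rule edges; all degree
formulas below are instances of this count. -/
theorem ncard_edges (p : G.E → Prop) :
    {e | p e}.ncard = {q | p (γ.dE q)}.ncard + {f | p (γ.mE f)}.ncard := by
  have := G.finE
  have h : {e | p e} = γ.dE '' {q | p (γ.dE q)} ∪ γ.mE '' {f | p (γ.mE f)} := by
    ext e
    constructor
    · intro he
      rcases γ.edge_cases e with ⟨f, rfl⟩ | ⟨q, rfl⟩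
      · exact .inr ⟨f, he, rfl⟩
      · exact .inl ⟨q, he, rfl⟩
    · rintro (⟨q, hq, rfl⟩ | ⟨q, hq, rfl⟩) <;> exact hq
  have hd : Disjoint (γ.dE '' {q | p (γ.dE q)}) (γ.mE '' {f | p (γ.mE f)}) := by
    rw [Set.disjoint_left]
    rintro _ ⟨q, -, rfl⟩ ⟨f, -, hf⟩
    exact γ.dE_ne_mE q f hf.symm
  rw [h, Set.ncard_union_eq hd (Set.toFinite _) (Set.toFinite _),
    Set.ncard_image_of_injective _ γ.dE_injective, Set.ncard_image_of_injective _ γ.mE_injective]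

theorem ncard_fin (p : Fin nE → Prop) [DecidablePred p] :
    {f | p f}.ncard = (Finset.univ.filter p).card := by
  rw [← Set.ncard_coe_finset]
  simp

/-- The first summand depends only on the context. It is the semantic value of incon, common to both
sides of a rule application. -/
theorem indeg_inl (v : Fin nK) : G.indeg (γ.mV (.inl v)) =
    D.cdeg k (.incon v) + (A.indeg (.inl v) : ℤ) := by
  simp only [HostGraph.indeg, γ.ncard_edges, tgt_dE, tgt_mE, γ.mV_injective.eq_iff]
  simp only [mV_inl, γ.dV_injective.eq_iff, PGraph.cdeg, RGraph.indeg, ncard_fin, Nat.cast_add]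

theorem outdeg_inl (v : Fin nK) : G.outdeg (γ.mV (.inl v)) =
    D.cdeg k (.outcon v) + (A.outdeg (.inl v) : ℤ) := by
  simp only [HostGraph.outdeg, γ.ncard_edges, src_dE, src_mE, γ.mV_injective.eq_iff]
  simp only [mV_inl, γ.dV_injective.eq_iff, PGraph.cdeg, RGraph.outdeg, ncard_fin, Nat.cast_add]

/-- A context edge has both ends in the context, so it cannot touch this node. This is the content
of Dang. -/
theorem indeg_inr (j : Fin nX) : G.indeg (γ.mV (.inr j)) = (A.indeg (.inr j) : ℤ) := by
  simp [HostGraph.indeg, γ.ncard_edges, tgt_dE, tgt_mE, γ.mV_injective.eq_iff, dV_ne_mV_inr,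
    RGraph.indeg, ncard_fin]

theorem outdeg_inr (j : Fin nX) : G.outdeg (γ.mV (.inr j)) = (A.outdeg (.inr j) : ℤ) := by
  simp [HostGraph.outdeg, γ.ncard_edges, src_dE, src_mE, γ.mV_injective.eq_iff, dV_ne_mV_inr,
    RGraph.outdeg, ncard_fin]

/-- Rule edges end at rule nodes, hence only context edges are counted outside the interface and the
degree is unchanged by a rule application. -/
theorem indeg_dV {x : D.V} (hx : x ∉ Set.range k) :
    G.indeg (γ.dV x) = (({q : D.E | D.tgt q = x}.ncard : ℕ) : ℤ) := by
  simp [HostGraph.indeg, γ.ncard_edges, tgt_dE, tgt_mE, γ.dV_injective.eq_iff,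
    (γ.dV_ne_mV hx _).symm]

theorem outdeg_dV {x : D.V} (hx : x ∉ Set.range k) :
    G.outdeg (γ.dV x) = (({q : D.E | D.src q = x}.ncard : ℕ) : ℤ) := by
  simp [HostGraph.outdeg, γ.ncard_edges, src_dE, src_mE, γ.dV_injective.eq_iff,
    (γ.dV_ne_mV hx _).symm]

end Glue

end GP2

namespace GP2

/-! ### Evaluation of expressions -/

theorem IntE.eval_bind {I J : Type} (ρ : Env) (f : I → IntE J) (g : J → ℤ) (e : IntE I) :
    (e.bind f).eval ρ g = e.eval ρ (fun i => (f i).eval ρ g) := by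
  induction e with
  | op o a b iha ihb => simp only [IntE.bind, IntE.eval, iha, ihb]
  | _ => rfl

theorem AtE.eval_bind {I J : Type} (ρ : Env) (f : I → IntE J) (g : J → ℤ) (e : AtE I) :
    (e.bind f).eval ρ g = e.eval ρ (fun i => (f i).eval ρ g) := by
  cases e with
  | int e => simp only [AtE.bind, AtE.eval, IntE.eval_bind]
  | _ => rfl

theorem LstE.eval_bind {I X J Y : Type} (ρ : Env) (f : I → IntE J) (g : X → LstE J Y)
    (h : J → ℤ) (k : Y → HList) (e : LstE I X) :
    (e.bind f g).eval ρ h k =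
      e.eval ρ (fun i => (f i).eval ρ h) (fun x => (g x).eval ρ h k) := by
  induction e with
  | cat a b iha ihb => simp only [LstE.bind, LstE.eval, iha, ihb]
  | atm a => simp only [LstE.bind, LstE.eval, AtE.eval_bind]
  | _ => rfl

theorem StrE.eval_congr {ρ ρ' : Env} (e : StrE) (h : ∀ x ∈ e.vars, ρ x = ρ' x) :
    e.eval ρ = e.eval ρ' := by
  induction e with
  | lit => rfl
  | svar n => exact h _ (List.mem_singleton_self _)
  | cvar n => exact congrArg (fun c => [c]) (h _ (List.mem_singleton_self _))
  | cat a b iha ihb =>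
    simp only [StrE.vars, List.mem_append] at h
    simp only [StrE.eval, iha fun x hx => h x (.inl hx), ihb fun x hx => h x (.inr hx)]

theorem IntE.eval_congr {I : Type} {ρ ρ' : Env} (f : I → ℤ) (e : IntE I)
    (h : ∀ x ∈ e.vars, ρ x = ρ' x) : e.eval ρ f = e.eval ρ' f := by
  induction e with
  | lit => rfl
  | leaf => rfl
  | var n => exact h _ (List.mem_singleton_self _)
  | op o a b iha ihb =>
    simp only [IntE.vars, List.mem_append] at h
    simp only [IntE.eval, iha fun x hx => h x (.inl hx), ihb fun x hx => h x (.inr hx)]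
  | lenL n => simp only [IntE.eval, h _ (List.mem_singleton_self _)]
  | lenA n => simp only [IntE.eval, h _ (List.mem_singleton_self _)]
  | lenS n =>
    simp only [IntE.eval, StrE.eval_congr (.svar n) h]

theorem LstE.eval_congr {I X : Type} {ρ ρ' : Env} (f : I → ℤ) (g : X → HList) (e : LstE I X)
    (h : ∀ x ∈ e.vars, ρ x = ρ' x) : e.eval ρ f g = e.eval ρ' f g := by
  induction e with
  | empty => rfl
  | leaf => rfl
  | lvar n => exact h _ (List.mem_singleton_self _)
  | cat a b iha ihb =>
    simp only [LstE.vars, List.mem_append] at h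
    simp only [LstE.eval, iha fun x hx => h x (.inl hx), ihb fun x hx => h x (.inr hx)]
  | atm a =>
    cases a with
    | int e => simp only [LstE.eval, AtE.eval, IntE.eval_congr f e h]
    | str s => simp only [LstE.eval, AtE.eval, StrE.eval_congr s h]
    | avar n =>
      simp only [LstE.eval, AtE.eval, h _ (List.mem_singleton_self _)]

/-- The assignment `x ↦ ρ (x.rn f)`. -/
def Env.rn (ρ : Env) (f : ℕ → ℕ) : Env := fun x => ρ (x.rn f)

theorem StrE.eval_rn (ρ : Env) (f : ℕ → ℕ) (e : StrE) : (e.rn f).eval ρ = e.eval (ρ.rn f) := by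
  induction e with
  | cat a b iha ihb => simp only [StrE.rn, StrE.eval, iha, ihb]
  | _ => rfl

theorem IntE.eval_rn {I : Type} (ρ : Env) (f : ℕ → ℕ) (g : I → ℤ) (e : IntE I) :
    (e.rn f).eval ρ g = e.eval (ρ.rn f) g := by
  induction e with
  | op o a b iha ihb => simp only [IntE.rn, IntE.eval, iha, ihb]
  | _ => rfl

theorem LstE.eval_rn {I X : Type} (ρ : Env) (f : ℕ → ℕ) (g : I → ℤ) (h : X → HList)
    (e : LstE I X) : (e.rn f).eval ρ g h = e.eval (ρ.rn f) g h := by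
  induction e with
  | cat a b iha ihb => simp only [LstE.rn, LstE.eval, iha, ihb]
  | atm a =>
    cases a with
    | int e => simp only [LstE.rn, AtE.rn, LstE.eval, AtE.eval, IntE.eval_rn]
    | str s => simp only [LstE.rn, AtE.rn, LstE.eval, AtE.eval, StrE.eval_rn]
    | avar n => rfl
  | _ => rfl

/-! ### Satisfaction -/

/-- Induction on formulas. -/
theorem Fm.inductionOn {S : Sig} {motive : ∀ {n m : ℕ}, Fm S n m → Prop} {n m : ℕ} (φ : Fm S n m)
    (tru : ∀ {n m : ℕ}, motive (.tru : Fm S n m)) (fls : ∀ {n m : ℕ}, motive (.fls : Fm S n m))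
    (atomic : ∀ {n m : ℕ} (A : Atomic S n m), motive (.at A))
    (neg : ∀ {n m : ℕ} (φ : Fm S n m), motive φ → motive φ.neg)
    (and : ∀ {n m : ℕ} (φ ψ : Fm S n m), motive φ → motive ψ → motive (φ.and ψ))
    (or : ∀ {n m : ℕ} (φ ψ : Fm S n m), motive φ → motive ψ → motive (φ.or ψ))
    (exV : ∀ {n m : ℕ} (φ : Fm S (n + 1) m), motive φ → motive φ.exV)
    (exE : ∀ {n m : ℕ} (φ : Fm S n (m + 1)), motive φ → motive φ.exE)
    (exL : ∀ {n m : ℕ} (x : LVar) (φ : Fm S n m), motive φ → motive (.exL x φ)) : motive φ :=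
  Fm.rec (motive := fun _ _ φ => motive φ) tru fls atomic neg and or exV exE exL φ

section
variable {S : Sig} {G : HostGraph}

theorem Fm.sat_bigOr {J : Interp S G} {n m : ℕ} {a : Fin n → G.V} {b : Fin m → G.E} {ρ : Env}
    (l : List (Fm S n m)) : (Fm.bigOr l).Sat J a b ρ ↔ ∃ φ ∈ l, φ.Sat J a b ρ := by
  induction l with
  | nil => simp [Fm.bigOr, Fm.Sat]
  | cons φ l ih =>
    simp only [Fm.bigOr, List.foldr_cons, Fm.Sat, List.exists_mem_cons_iff] at ih ⊢
    rw [ih]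

theorem Fm.sat_bigAnd {J : Interp S G} {n m : ℕ} {a : Fin n → G.V} {b : Fin m → G.E} {ρ : Env}
    (l : List (Fm S n m)) : (Fm.bigAnd l).Sat J a b ρ ↔ ∀ φ ∈ l, φ.Sat J a b ρ := by
  induction l with
  | nil => simp [Fm.bigAnd, Fm.Sat]
  | cons φ l ih =>
    simp only [Fm.bigAnd, List.foldr_cons, Fm.Sat, List.forall_mem_cons] at ih ⊢
    rw [ih]

theorem Atomic.sat_congr {J : Interp S G} {n m : ℕ} {a : Fin n → G.V} {b : Fin m → G.E}
    {ρ ρ' : Env} (A : Atomic S n m) (h : ∀ x ∈ A.vars, ρ x = ρ' x) :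
    A.Sat J a b ρ ↔ A.Sat J a b ρ' := by
  cases A with
  | typ t x => simp only [Atomic.Sat, h x (List.mem_singleton_self _)]
  | leq l l' =>
    simp only [Atomic.vars, List.mem_append] at h
    simp only [Atomic.Sat, LstE.eval_congr _ _ l fun x hx => h x (.inl hx),
      LstE.eval_congr _ _ l' fun x hx => h x (.inr hx)]
  | cmp o l l' =>
    simp only [Atomic.vars, List.mem_append] at h
    simp only [Atomic.Sat, IntE.eval_congr _ l fun x hx => h x (.inl hx),
      IntE.eval_congr _ l' fun x hx => h x (.inr hx)]
  | _ => exact Iff.rfl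

theorem Fm.sat_congr {J : Interp S G} {n m : ℕ} {a : Fin n → G.V} {b : Fin m → G.E}
    {ρ ρ' : Env} (φ : Fm S n m) (h : ∀ x ∈ φ.freeL, ρ x = ρ' x) :
    φ.Sat J a b ρ ↔ φ.Sat J a b ρ' := by
  induction φ using Fm.inductionOn generalizing ρ ρ' with
  | tru => exact Iff.rfl
  | fls => exact Iff.rfl
  | atomic A => exact A.sat_congr h
  | neg φ ih => exact not_congr (ih h)
  | and φ ψ ih1 ih2 =>
    simp only [Fm.freeL, List.mem_append] at h
    exact and_congr (ih1 fun x hx => h x (.inl hx)) (ih2 fun x hx => h x (.inr hx))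
  | or φ ψ ih1 ih2 =>
    simp only [Fm.freeL, List.mem_append] at h
    exact or_congr (ih1 fun x hx => h x (.inl hx)) (ih2 fun x hx => h x (.inr hx))
  | exV φ ih => exact exists_congr fun v => ih h
  | exE φ ih => exact exists_congr fun v => ih h
  | exL x φ ih =>
    refine exists_congr fun u => ih fun y hy => ?_
    by_cases hyx : y = x
    · subst hyx
      simp
    · rw [Function.update_of_ne hyx, Function.update_of_ne hyx]
      exact h y (by simp [Fm.freeL, hy, hyx])

theorem Atomic.sat_rn {J : Interp S G} {n m : ℕ} {a : Fin n → G.V} {b : Fin m → G.E}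
    {ρ : Env} (f : ℕ → ℕ) (A : Atomic S n m) :
    (A.rn f).Sat J a b ρ ↔ A.Sat J a b (ρ.rn f) := by
  cases A with
  | leq l l' => simp only [Atomic.rn, Atomic.Sat, LstE.eval_rn]
  | cmp o l l' => simp only [Atomic.rn, Atomic.Sat, IntE.eval_rn]
  | _ => exact Iff.rfl

/-- Injectivity guarantees that changing a renamed variable affects no other variable after pulling
the assignment back. -/
theorem Env.rn_update {f : ℕ → ℕ} (hf : Function.Injective f) (ρ : Env) (x : LVar)
    (u : x.ty.Dom) :
    Env.rn (Function.update ρ (x.rn f) u) f = Function.update (ρ.rn f) x u := by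
  funext y
  by_cases hyx : y = x
  · subst hyx
    rw [Function.update_self]
    exact Function.update_self (β := fun x : LVar => x.ty.Dom) (y.rn f) u ρ
  · rw [Function.update_of_ne hyx]
    refine Function.update_of_ne (fun h => hyx ?_) _ _
    rcases x with ⟨t, i⟩
    rcases y with ⟨t', i'⟩
    simp only [LVar.rn, LVar.mk.injEq] at h ⊢
    exact ⟨h.1, hf h.2⟩

theorem Fm.sat_rn {J : Interp S G} {f : ℕ → ℕ} (hf : Function.Injective f) {n m : ℕ}
    {a : Fin n → G.V} {b : Fin m → G.E} {ρ : Env} (φ : Fm S n m) :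
    (φ.rn f).Sat J a b ρ ↔ φ.Sat J a b (ρ.rn f) := by
  induction φ using Fm.inductionOn generalizing ρ with
  | tru => exact Iff.rfl
  | fls => exact Iff.rfl
  | atomic A => exact A.sat_rn f
  | neg φ ih => exact not_congr ih
  | and φ ψ ih1 ih2 => exact and_congr ih1 ih2
  | or φ ψ ih1 ih2 => exact or_congr ih1 ih2
  | exV φ ih => exact exists_congr fun v => ih
  | exE φ ih => exact exists_congr fun v => ih
  | exL x φ ih =>
    refine exists_congr fun u => ih.trans ?_
    exact iff_of_eq (congrArg (fun ρ' => φ.Sat J a b ρ') (Env.rn_update hf ρ x u))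

theorem Fm.sat_closeV {J : Interp S G} {m : ℕ} {b : Fin m → G.E} {ρ : Env} (n : ℕ)
    (φ : Fm S n m) : (closeV n φ).Sat J finZeroElim b ρ ↔ ∃ a, φ.Sat J a b ρ := by
  induction n with
  | zero => exact ⟨fun h => ⟨_, h⟩, fun ⟨a, h⟩ => by rwa [Subsingleton.elim a finZeroElim] at h⟩
  | succ n ih =>
    rw [closeV, ih]
    constructor
    · rintro ⟨a, v, h⟩
      exact ⟨_, h⟩
    · rintro ⟨a, h⟩
      refine ⟨Fin.tail a, a 0, ?_⟩
      rwa [Fin.cons_self_tail]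

theorem Fm.sat_closeE {J : Interp S G} {n : ℕ} {a : Fin n → G.V} {ρ : Env} (m : ℕ)
    (φ : Fm S n m) : (closeE m φ).Sat J a finZeroElim ρ ↔ ∃ b, φ.Sat J a b ρ := by
  induction m with
  | zero => exact ⟨fun h => ⟨_, h⟩, fun ⟨a, h⟩ => by rwa [Subsingleton.elim a finZeroElim] at h⟩
  | succ n ih =>
    rw [closeE, ih]
    constructor
    · rintro ⟨a, v, h⟩
      exact ⟨_, h⟩
    · rintro ⟨a, h⟩
      refine ⟨Fin.tail a, a 0, ?_⟩
      rwa [Fin.cons_self_tail]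

theorem Fm.sat_foldr_exL {J : Interp S G} {n m : ℕ} {a : Fin n → G.V} {b : Fin m → G.E} {ρ : Env}
    (φ : Fm S n m) (l : List LVar) :
    (l.foldr .exL φ).Sat J a b ρ ↔ ∃ ρ' : Env, (∀ x, x ∉ l → ρ' x = ρ x) ∧ φ.Sat J a b ρ' := by
  induction l generalizing ρ with
  | nil =>
    refine ⟨fun h => ⟨ρ, fun _ _ => rfl, h⟩, ?_⟩
    rintro ⟨ρ', h, h'⟩
    rwa [funext fun x => h x (List.not_mem_nil)] at h'
  | cons x l ih =>
    simp only [List.foldr_cons, Fm.Sat, ih]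
    constructor
    · rintro ⟨u, ρ', h, h'⟩
      refine ⟨ρ', fun y hy => ?_, h'⟩
      simp only [List.mem_cons, not_or] at hy
      rw [h y hy.2, Function.update_of_ne hy.1]
    · rintro ⟨ρ', h, h'⟩
      refine ⟨ρ' x, ρ', fun y hy => ?_, h'⟩
      by_cases hyx : y = x
      · subst hyx
        simp
      · rw [Function.update_of_ne hyx]
        exact h y (by simp [hyx, hy])

/-- Since every free label variable is bound, truth no longer depends on the outer assignment; this
is the origin of `Cond.Closed`. -/
theorem Fm.sat_closeL {J : Interp S G} {n m : ℕ} {a : Fin n → G.V} {b : Fin m → G.E} {ρ : Env}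
    (φ : Fm S n m) : (closeL φ).Sat J a b ρ ↔ ∃ ρ', φ.Sat J a b ρ' := by
  classical
  rw [closeL, Fm.sat_foldr_exL]
  refine ⟨fun ⟨ρ', _, h⟩ => ⟨ρ', h⟩, fun ⟨ρ', h⟩ => ?_⟩
  -- Take the given witness on the free variables, the only ones that matter, and leave the outer
  -- assignment elsewhere, since the quantifiers cannot change it there.
  refine ⟨fun x => if x ∈ φ.freeL then ρ' x else ρ x, fun x hx => ?_, ?_⟩
  · rw [List.mem_dedup] at hx
    exact if_neg hx
  · refine (φ.sat_congr fun x hx => ?_).mp h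
    exact (if_pos hx).symm

end

/-! ### Substitution -/

section
variable {S S' : Sig} {G : HostGraph}

/-- The substituted terms have the values of the original ones. -/
structure Sub.Compat (J : Interp S G) (J' : Interp S' G) {n m n' m' : ℕ}
    (σ : Sub S n m S' n' m') (a : Fin n → G.V) (b : Fin m → G.E) (a' : Fin n' → G.V)
    (b' : Fin m' → G.E) : Prop where
  node : ∀ z, Sum.elim J'.node a' (σ.node z) = Sum.elim J.node a z
  edge : ∀ z, Sum.elim J'.edge b' (σ.edge z) = Sum.elim J.edge b z
  incon : ∀ v, J'.incon (σ.con v) = J.incon v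
  outcon : ∀ v, J'.outcon (σ.con v) = J.outcon v
  src : ∀ y v, σ.src y = some v → J'.node v = G.src (b y)
  tgt : ∀ y v, σ.tgt y = some v → J'.node v = G.tgt (b y)

theorem sumElim_cons_succ {α : Type} {N : Type} {n : ℕ} (f : N → α) (a : Fin n → α) (v : α)
    (z : N ⊕ Fin n) :
    Sum.elim f (Fin.cons v a : Fin (n + 1) → α) (Sum.map id Fin.succ z) = Sum.elim f a z := by
  rcases z with c | x <;> rfl

variable {J : Interp S G} {J' : Interp S' G} {n m n' m' : ℕ} {σ : Sub S n m S' n' m'}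
  {a : Fin n → G.V} {b : Fin m → G.E} {a' : Fin n' → G.V} {b' : Fin m' → G.E}

theorem Sub.Compat.nodeVar (h : σ.Compat J J' a b a' b') (v : G.V) :
    σ.nodeVar.Compat J J' (Fin.cons v a : Fin (n + 1) → G.V) b
      (Fin.cons v a' : Fin (n' + 1) → G.V) b' where
  node z := by
    rcases z with c | x
    · exact (sumElim_cons_succ _ _ _ _).trans (h.node (.inl c))
    · refine Fin.cases rfl (fun x => ?_) x
      exact (sumElim_cons_succ _ _ _ _).trans (h.node (.inr x))
  edge := h.edge
  incon := h.incon
  outcon := h.outcon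
  src := h.src
  tgt := h.tgt

theorem Sub.Compat.edgeVar (h : σ.Compat J J' a b a' b') (e : G.E) :
    (σ.edgeVar none none).Compat J J' a (Fin.cons e b : Fin (m + 1) → G.E) a'
      (Fin.cons e b' : Fin (m' + 1) → G.E) where
  node := h.node
  edge z := by
    rcases z with c | x
    · exact (sumElim_cons_succ _ _ _ _).trans (h.edge (.inl c))
    · refine Fin.cases rfl (fun x => ?_) x
      exact (sumElim_cons_succ _ _ _ _).trans (h.edge (.inr x))
  incon := h.incon
  outcon := h.outcon
  src y v := by
    refine Fin.cases (fun h => by cases h) (fun y => ?_) y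
    exact h.src y v
  tgt y v := by
    refine Fin.cases (fun h => by cases h) (fun y => ?_) y
    exact h.tgt y v

theorem NodeTm.eval_sub (h : σ.Compat J J' a b a' b') (t : NodeTm S n m) :
    (t.sub σ).eval J' a' b' = t.eval J a b := by
  cases t with
  | ref x => exact h.node x
  | src e =>
    rcases e with e | y
    · exact congrArg G.src (h.edge (.inl e))
    · simp only [NodeTm.sub]
      split
      · next v hv => exact h.src y v hv
      · exact congrArg G.src (h.edge (.inr y))
  | tgt e =>
    rcases e with e | y
    · exact congrArg G.tgt (h.edge (.inl e))
    · simp only [NodeTm.sub]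
      split
      · next v hv => exact h.tgt y v hv
      · exact congrArg G.tgt (h.edge (.inr y))

theorem ILeaf.eval_sub (h : σ.Compat J J' a b a' b') (t : ILeaf S n m) :
    (t.sub σ).eval J' a' b' = t.eval J a b := by
  cases t with
  | indeg x => exact congrArg G.indeg (x.eval_sub h)
  | outdeg x => exact congrArg G.outdeg (x.eval_sub h)
  | incon v => exact h.incon v
  | outcon v => exact h.outcon v

theorem XLeaf.eval_sub (h : σ.Compat J J' a b a' b') (t : XLeaf S n m) :
    (t.sub σ).eval J' a' b' = t.eval J a b := by
  cases t with
  | lV x => exact congrArg G.nlist (x.eval_sub h)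
  | lE e => exact congrArg G.elist (h.edge e)

theorem ITm.eval_sub (h : σ.Compat J J' a b a' b') (ρ : Env) (t : ITm S n m) :
    (ITm.sub σ t).eval ρ (ILeaf.eval J' a' b') = t.eval ρ (ILeaf.eval J a b) := by
  rw [ITm.sub, IntE.eval_bind]
  simp only [IntE.eval, ILeaf.eval_sub h]

theorem LTm.eval_sub (h : σ.Compat J J' a b a' b') (ρ : Env) (t : LTm S n m) :
    (LTm.sub σ t).eval ρ (ILeaf.eval J' a' b') (XLeaf.eval J' a' b') =
      t.eval ρ (ILeaf.eval J a b) (XLeaf.eval J a b) := by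
  rw [LTm.sub, LstE.eval_bind]
  simp only [IntE.eval, LstE.eval, ILeaf.eval_sub h, XLeaf.eval_sub h]

theorem Atomic.sat_sub (h : σ.Compat J J' a b a' b') (ρ : Env) (A : Atomic S n m) :
    (A.sub σ).Sat J' a' b' ρ ↔ A.Sat J a b ρ := by
  cases A with
  | typ => exact Iff.rfl
  | leq l l' => simp only [Atomic.sub, Atomic.Sat, LTm.eval_sub h]
  | cmp o i i' => simp only [Atomic.sub, Atomic.Sat, ITm.eval_sub h]
  | root x => simp only [Atomic.sub, Atomic.Sat, NodeTm.eval_sub h]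
  | nodeEq x y => simp only [Atomic.sub, Atomic.Sat, NodeTm.eval_sub h]
  | edgeEq e f => simp only [Atomic.sub, Atomic.Sat, h.edge]
  | mV x w => simp only [Atomic.sub, Atomic.Sat, NodeTm.eval_sub h]
  | mE e w => simp only [Atomic.sub, Atomic.Sat, h.edge]

theorem Fm.sat_sub (φ : Fm S n m) : ∀ {n' m' : ℕ} {σ : Sub S n m S' n' m'} {a : Fin n → G.V}
    {b : Fin m → G.E} {a' : Fin n' → G.V} {b' : Fin m' → G.E} (_ : σ.Compat J J' a b a' b')
    (ρ : Env), (φ.sub σ).Sat J' a' b' ρ ↔ φ.Sat J a b ρ := by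
  induction φ using Fm.inductionOn with
  | tru => exact fun _ _ => Iff.rfl
  | fls => exact fun _ _ => Iff.rfl
  | atomic A => exact fun h ρ => A.sat_sub h ρ
  | neg φ ih => exact fun h ρ => not_congr (ih h ρ)
  | and φ ψ ih1 ih2 => exact fun h ρ => and_congr (ih1 h ρ) (ih2 h ρ)
  | or φ ψ ih1 ih2 => exact fun h ρ => or_congr (ih1 h ρ) (ih2 h ρ)
  | exV φ ih => exact fun h ρ => exists_congr fun v => ih (h.nodeVar v) ρ
  | exE φ ih => exact fun h ρ => exists_congr fun v => ih (h.edgeVar v) ρ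
  | exL x φ ih => exact fun h ρ => exists_congr fun u => ih h _

theorem Sub.weakE_compat (J : Interp S G) (a : Fin n → G.V) (b : Fin m → G.E) (e : G.E) :
    (Sub.weakE S n m).Compat J J a b a (Fin.cons e b : Fin (m + 1) → G.E) where
  node _ := rfl
  edge z := sumElim_cons_succ _ _ _ z
  incon _ := rfl
  outcon _ := rfl
  src _ _ h := by cases h
  tgt _ _ h := by cases h

theorem Fm.sat_edge (J : Interp S G) (a : Fin n → G.V) (b : Fin m → G.E) (ρ : Env)
    (x y : NodeTm S n m) (l : Option (LTm S n m)) (w : Option (WithAny EdgeMark)) :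
    (Fm.edge x y l w).Sat J a b ρ ↔ ∃ e, G.src e = x.eval J a b ∧ G.tgt e = y.eval J a b ∧
      (∀ t ∈ l, G.elist e = t.eval ρ (ILeaf.eval J a b) (XLeaf.eval J a b)) ∧
      ∀ u ∈ w, u.Fits .none (G.emark e) := by
  refine exists_congr fun e => ?_
  have h := Sub.weakE_compat J a b e
  refine and_congr ?_ (and_congr ?_ (and_congr ?_ ?_))
  · change _ = _ ↔ _
    rw [NodeTm.eval_sub h]
    rfl
  · change _ = _ ↔ _
    rw [NodeTm.eval_sub h]
    rfl
  · cases l with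
    | none => simp [Fm.Sat]
    | some t =>
      simp only [Option.mem_some_iff, forall_eq']
      change _ = _ ↔ _
      rw [LTm.eval_sub h]
      rfl
  · cases w with
    | none => simp [Fm.Sat]
    | some t =>
      simp only [Option.mem_some_iff, forall_eq']
      rfl

end

-- Conditions over rule graphs and the formula Post

/-- The interpretation of the items of a rule graph by items of a host graph. -/
def Interp.over {V E : Type} {G : HostGraph} (g : V → G.V) (h : E → G.E) :
    Interp (Sig.over V E) G :=
  ⟨g, h, Empty.elim, Empty.elim⟩

/-- Both sides take degrees in the whole host graph, so the translation only has to be unfolded. -/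
theorem RCond.sat_toFm {V E : Type} {G : HostGraph} (g : V → G.V) (h : E → G.E) (ρ : Env)
    (γ : RCond V) :
    (γ.toFm : Fm (Sig.over V E) 0 0).Sat (Interp.over g h) finZeroElim finZeroElim ρ ↔
      γ.Holds G g ρ := by
  have hd : ∀ d : Deg V, (Deg.toTm (E := E) d).eval ρ
      (ILeaf.eval (Interp.over g h) finZeroElim finZeroElim) = d.eval G g := by
    intro d
    cases d <;> rfl
  have hi : ∀ i : RInt V, (RInt.toTm (E := E) i).eval ρ
      (ILeaf.eval (Interp.over g h) finZeroElim finZeroElim) = i.eval ρ (Deg.eval G g) := by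
    intro i
    rw [RInt.toTm, IntE.eval_bind]
    simp only [hd]
  have hl : ∀ l : RLst V, (RLst.toTm (E := E) l).eval ρ
      (ILeaf.eval (Interp.over g h) finZeroElim finZeroElim)
      (XLeaf.eval (Interp.over g h) finZeroElim finZeroElim) = rEval G g ρ l := by
    intro i
    rw [RLst.toTm, LstE.eval_bind, rEval]
    simp only [hd]
    congr 1
    exact funext fun x => x.elim
  induction γ with
  | typ => exact Iff.rfl
  | leq a b => simp only [RCond.toFm, Fm.Sat, Atomic.Sat, hl, RCond.Holds]
  | lne a b => simp only [RCond.toFm, Fm.Sat, Atomic.Sat, hl, RCond.Holds, ne_eq]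
  | cmp o a b => simp only [RCond.toFm, Fm.Sat, Atomic.Sat, hi, RCond.Holds]
  | edge u v l w =>
    rw [RCond.toFm, Fm.sat_edge]
    refine exists_congr fun e => and_congr_right' (and_congr_right' (and_congr_left' ?_))
    cases l with
    | none => simp
    | some l => simp [hl]
  | not γ ih => exact not_congr ih
  | and γ δ ih1 ih2 => exact and_congr ih1 ih2
  | or γ δ ih1 ih2 => exact or_congr ih1 ih2

namespace GRule
variable (w : GRule) {G : HostGraph}

theorem sat_distinct (g : w.RNode → G.V) (h : Fin w.eR → G.E) (ρ : Env) :
    w.distinct.Sat (Interp.over g h) finZeroElim finZeroElim ρ ↔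
      Function.Injective g ∧ Function.Injective h := by
  have hn : ∀ v : w.RNode, v ∈ nodeList w.nK w.nN := by
    rintro (v | v) <;> simp [nodeList]
  refine and_congr ?_ ?_
  · rw [Fm.sat_bigAnd]
    constructor
    · intro H u v huv
      by_contra hne
      refine H (.neg (.at (.nodeEq (.ref (.inl u)) (.ref (.inl v))))) ?_ huv
      simp only [List.mem_flatMap, List.mem_map, List.mem_filter]
      exact ⟨u, hn u, v, ⟨hn v, by simpa using Ne.symm hne⟩, rfl⟩
    · intro H φ hφ
      simp only [List.mem_flatMap, List.mem_map, List.mem_filter] at hφ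
      obtain ⟨u, -, v, ⟨-, hv⟩, rfl⟩ := hφ
      have hv : v ≠ u := by simpa using hv
      exact fun h => hv (H h).symm
  · rw [Fm.sat_bigAnd]
    constructor
    · intro H u v huv
      by_contra hne
      refine H (.neg (.at (.edgeEq (.inl u) (.inl v)))) ?_ huv
      simp only [List.mem_flatMap, List.mem_map, List.mem_filter]
      exact ⟨u, List.mem_finRange u, v, ⟨List.mem_finRange v, by simpa using Ne.symm hne⟩, rfl⟩
    · intro H φ hφ
      simp only [List.mem_flatMap, List.mem_map, List.mem_filter] at hφ
      obtain ⟨u, -, v, ⟨-, hv⟩, rfl⟩ := hφ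
      have hv : v ≠ u := by simpa using hv
      exact fun h => hv (H h).symm

/-- The variables introduced by Var describe an arbitrary embedding of the constants of R; the
inequalities between them express injectivity. The outer assignment is absent on the right, as all
label variables are closed. -/
theorem sat_post (c : Cond) (ρ : Env) :
    (w.post c).Sat (Interp.FO G) finZeroElim finZeroElim ρ ↔
      ∃ (ρ' : Env) (g : w.RNode → G.V) (h : Fin w.eR → G.E), Function.Injective g ∧
        Function.Injective h ∧
        (w.shift c).Sat (Interp.over g h) finZeroElim finZeroElim ρ' := by
  have key : ∀ (a : Fin (w.nK + w.nN) → G.V) (h : Fin w.eR → G.E) (ρ' : Env),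
      (w.var (w.shift c)).Sat (Interp.FO G) a h ρ' ↔
        (Fm.and w.distinct (w.shift c)).Sat (Interp.over (fun v => a (finSumFinEquiv v)) h)
          finZeroElim finZeroElim ρ' := by
    intro a h ρ'
    refine Fm.sat_sub _ ⟨?_, ?_, fun v => Empty.elim v, fun v => Empty.elim v, fun y => y.elim0,
      fun y => y.elim0⟩ ρ'
    · rintro (v | x)
      · rfl
      · exact x.elim0
    · rintro (v | x)
      · rfl
      · exact x.elim0
  rw [GRule.post, Fm.sat_closeV]
  simp only [Fm.sat_closeE, Fm.sat_closeL, key]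
  constructor
  · rintro ⟨a, h, ρ', h1, h2⟩
    rw [sat_distinct] at h1
    exact ⟨ρ', _, h, h1.1, h1.2, h2⟩
  · rintro ⟨ρ', g, h, h1, h2, h3⟩
    refine ⟨fun i => g (finSumFinEquiv.symm i), h, ρ', ?_⟩
    simp only [Equiv.symm_apply_apply]
    exact ⟨(w.sat_distinct g h ρ').mpr ⟨h1, h2⟩, h3⟩

end GRule

end GP2

-- Transitions by generalised rules and freshness of label variables

namespace GP2

/-- Evaluation of the labels of a generalised rule graph. -/
def RGraph.evalAt {V E K MV ME : Type} (A : RGraph V E (CLst K) MV ME) (ρ : Env) (c : CDeg K → ℤ) :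
    RGraph V E HList MV ME where
  src := A.src
  tgt := A.tgt
  nlist := fun v => (A.nlist v).eval ρ c Empty.elim
  nmark := A.nmark
  root := A.root
  elist := fun e => (A.elist e).eval ρ c Empty.elim
  emark := A.emark

/-- A transition by a generalised rule: both host graphs arise from a common context. -/
structure Transition (w : GRule) (G H : HostGraph) (ρ : Env) where
  D : PGraph
  k : Fin w.nK → D.V
  L : Glue (w.left.evalAt ρ (D.cdeg k)) D k G
  R : Glue (w.right.evalAt ρ (D.cdeg k)) D k H

/-- Every bound label variable has a name which is at least `N`. -/
def Fm.BoundGe {S : Sig} (N : ℕ) : {n m : ℕ} → Fm S n m → Prop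
  | _, _, .tru => True
  | _, _, .fls => True
  | _, _, .at _ => True
  | _, _, .neg φ => φ.BoundGe N
  | _, _, .and φ ψ => φ.BoundGe N ∧ ψ.BoundGe N
  | _, _, .or φ ψ => φ.BoundGe N ∧ ψ.BoundGe N
  | _, _, .exV φ => φ.BoundGe N
  | _, _, .exE φ => φ.BoundGe N
  | _, _, .exL x φ => N ≤ x.name ∧ φ.BoundGe N

/-- Bound names are shifted together with free ones. Rule labels inserted by Val under a quantifier
of the precondition are therefore not captured. -/
theorem Fm.boundGe_rn {S : Sig} (N : ℕ) {n m : ℕ} (φ : Fm S n m) :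
    (φ.rn (fun k => k + N)).BoundGe N := by
  induction φ using Fm.inductionOn with
  | tru => trivial
  | fls => trivial
  | atomic A => trivial
  | neg φ ih => exact ih
  | and φ ψ ih1 ih2 => exact ⟨ih1, ih2⟩
  | or φ ψ ih1 ih2 => exact ⟨ih1, ih2⟩
  | exV φ ih => exact ih
  | exE φ ih => exact ih
  | exL x φ ih => exact ⟨Nat.le_add_left _ _, ih⟩

theorem Fm.BoundGe.sub {S S' : Sig} {N : ℕ} {n m : ℕ} {φ : Fm S n m} (h : φ.BoundGe N)
    {n' m' : ℕ} (σ : Sub S n m S' n' m') : (φ.sub σ).BoundGe N := by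
  induction φ using Fm.inductionOn generalizing n' m' with
  | tru => trivial
  | fls => trivial
  | atomic A => trivial
  | neg φ ih => exact ih h _
  | and φ ψ ih1 ih2 => exact ⟨ih1 h.1 _, ih2 h.2 _⟩
  | or φ ψ ih1 ih2 => exact ⟨ih1 h.1 _, ih2 h.2 _⟩
  | exV φ ih => exact ih h _
  | exE φ ih => exact ih h _
  | exL x φ ih => exact ⟨h.1, ih h.2 _⟩

/-- The only quantifier produced by an application condition is the one over edges, so the bound
holds vacuously. -/
theorem RCond.boundGe_toFm {V E : Type} (N : ℕ) (γ : RCond V) :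
    (γ.toFm : Fm (Sig.over V E) 0 0).BoundGe N := by
  induction γ with
  | edge u v l w => cases l <;> cases w <;> simp [RCond.toFm, Fm.edge, Fm.BoundGe]
  | not γ ih => exact ih
  | and γ δ ih1 ih2 => exact ⟨ih1, ih2⟩
  | or γ δ ih1 ih2 => exact ⟨ih1, ih2⟩
  | _ => trivial

theorem lt_foldr_max {α : Type} (f : α → ℕ) (l : List α) {x : α} (hx : x ∈ l) :
    f x < (l.map fun y => f y + 1).foldr max 0 := by
  induction l with
  | nil => cases hx
  | cons y l ih =>
    simp only [List.map_cons, List.foldr_cons]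
    rcases List.mem_cons.mp hx with rfl | hx
    · exact lt_of_lt_of_le (Nat.lt_succ_self _) (le_max_left _ _)
    · exact lt_of_lt_of_le (ih hx) (le_max_right _ _)

theorem mem_nodeList {a b : ℕ} (v : Fin a ⊕ Fin b) : v ∈ nodeList a b := by
  rcases v with v | v <;> simp [nodeList]

theorem RGraph.evalAt_congr {V E K MV ME : Type} (A : RGraph V E (CLst K) MV ME)
    {nodes : List V} {edges : List E} (hV : ∀ v, v ∈ nodes) (hE : ∀ e, e ∈ edges) {ρ ρ' : Env}
    (c : CDeg K → ℤ) (h : ∀ x ∈ A.vars nodes edges, ρ x = ρ' x) :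
    A.evalAt ρ c = A.evalAt ρ' c := by
  simp only [RGraph.vars, List.mem_append, List.mem_flatMap] at h
  unfold RGraph.evalAt
  congr 1
  · exact funext fun v => LstE.eval_congr _ _ _ fun x hx => h x (.inl ⟨v, hV v, hx⟩)
  · exact funext fun e => LstE.eval_congr _ _ _ fun x hx => h x (.inr ⟨e, hE e, hx⟩)

namespace GRule
variable (w : GRule)

theorem lt_fresh_left {x : LVar}
    (hx : x ∈ w.left.vars (nodeList w.nK w.nD) (List.finRange w.eL)) : x.name < w.fresh :=
  lt_foldr_max LVar.name _ (by simp [hx])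

theorem lt_fresh_right {x : LVar}
    (hx : x ∈ w.right.vars (nodeList w.nK w.nN) (List.finRange w.eR)) : x.name < w.fresh :=
  lt_foldr_max LVar.name _ (by simp [hx])

theorem lt_fresh_acL {x : LVar} (hx : x ∈ w.acL.freeL) : x.name < w.fresh :=
  lt_foldr_max LVar.name _ (by simp [hx])

theorem lt_fresh_acR {x : LVar} (hx : x ∈ w.acR.freeL) : x.name < w.fresh :=
  lt_foldr_max LVar.name _ (by simp [hx])

/-- Quantifiers of the renamed precondition change an assignment only from `w.fresh` on; hence they
leave the labels of the rule graphs fixed. -/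
theorem evalAt_left_congr {ρ ρ' : Env} (h : ∀ x : LVar, x.name < w.fresh → ρ x = ρ' x)
    (c : CDeg (Fin w.nK) → ℤ) : w.left.evalAt ρ c = w.left.evalAt ρ' c :=
  w.left.evalAt_congr mem_nodeList List.mem_finRange c fun x hx => h x (w.lt_fresh_left hx)

theorem evalAt_right_congr {ρ ρ' : Env} (h : ∀ x : LVar, x.name < w.fresh → ρ x = ρ' x)
    (c : CDeg (Fin w.nK) → ℤ) : w.right.evalAt ρ c = w.right.evalAt ρ' c :=
  w.right.evalAt_congr mem_nodeList List.mem_finRange c fun x hx => h x (w.lt_fresh_right hx)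

theorem val_bigOr {n m : ℕ} (l : List (Fm w.SL n m)) :
    w.val (Fm.bigOr l) = Fm.bigOr (l.map w.val) := by
  induction l with
  | nil => rfl
  | cons φ l ih => exact congrArg (Fm.or (w.val φ)) ih

theorem val_bigAnd {n m : ℕ} (l : List (Fm w.SL n m)) :
    w.val (Fm.bigAnd l) = Fm.bigAnd (l.map w.val) := by
  induction l with
  | nil => rfl
  | cons φ l ih => exact congrArg (Fm.and (w.val φ)) ih

theorem adj_bigOr {n m : ℕ} (l : List (Fm w.SC n m)) :
    w.adj (Fm.bigOr l) = Fm.bigOr (l.map w.adj) := by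
  induction l with
  | nil => rfl
  | cons φ l ih => exact congrArg (Fm.or (w.adj φ)) ih

theorem adj_bigAnd {n m : ℕ} (l : List (Fm w.SC n m)) :
    w.adj (Fm.bigAnd l) = Fm.bigAnd (l.map w.adj) := by
  induction l with
  | nil => rfl
  | cons φ l ih => exact congrArg (Fm.and (w.adj φ)) ih

section
variable {n m : ℕ} {x y : NodeTm w.SL n m}

theorem adjAtomic_nodeEq {x y : NodeTm w.SC n m} {x' y' : NodeTm w.SR n m}
    (hx : w.adjNode x = some x') (hy : w.adjNode y = some y') :
    w.adjAtomic (.nodeEq x y) = .at (.nodeEq x' y') := by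
  simp only [adjAtomic, hx, hy]

theorem adjAtomic_nodeEq_none {x y : NodeTm w.SC n m}
    (h : w.adjNode x = none ∨ w.adjNode y = none) : w.adjAtomic (.nodeEq x y) = .fls := by
  rcases h with h | h
  · simp only [adjAtomic, h]
  · rcases hx : w.adjNode x with _ | x' <;> simp only [adjAtomic, h, hx]

theorem valI_indeg (h : ∀ v, w.valNode x ≠ .ref (.inl v)) :
    w.valI (.indeg x) = .leaf (.indeg (w.valNode x)) := by
  simp only [valI]
  split
  · next e => exact absurd e (h _)
  · next e => exact absurd e (h _)
  · rfl

theorem valI_outdeg (h : ∀ v, w.valNode x ≠ .ref (.inl v)) :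
    w.valI (.outdeg x) = .leaf (.outdeg (w.valNode x)) := by
  simp only [valI]
  split
  · next e => exact absurd e (h _)
  · next e => exact absurd e (h _)
  · rfl

theorem valX_lV (h : ∀ v, w.valNode x ≠ .ref (.inl v)) :
    w.valX (.lV x) = .leaf (.lV (w.valNode x)) := by
  simp only [valX]

theorem valAtomic_root (h : ∀ v, w.valNode x ≠ .ref (.inl v)) :
    w.valAtomic (.root x) = .at (.root (w.valNode x)) := by
  simp only [valAtomic]

theorem valAtomic_mV (a : WithAny NodeMark) (h : ∀ v, w.valNode x ≠ .ref (.inl v)) :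
    w.valAtomic (.mV x a) = .at (.mV (w.valNode x) a) := by
  simp only [valAtomic]

theorem valAtomic_nodeEq
    (h : (∀ v, w.valNode x ≠ .ref (.inl v)) ∨ ∀ v, w.valNode y ≠ .ref (.inl v)) :
    w.valAtomic (.nodeEq x y) = .at (.nodeEq (w.valNode x) (w.valNode y)) := by
  simp only [valAtomic]
  split
  · next e1 e2 =>
    rcases h with h | h
    · exact absurd e1 (h _)
    · exact absurd e2 (h _)
  · rfl

end

end GRule

theorem GRule.eval_lstToR (w : GRule) {n m : ℕ} (ρ : Env) (f : ILeaf w.SR n m → ℤ)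
    (g : XLeaf w.SR n m → HList) (l : CLst (Fin w.nK)) :
    (w.lstToR l : LTm w.SR n m).eval ρ f g =
      l.eval ρ (fun c => (w.cToR c : ITm w.SR n m).eval ρ f) Empty.elim := by
  rw [GRule.lstToR, LstE.eval_bind]
  congr 1
  exact funext fun x => x.elim

theorem sat_adj_ofDec {w : GRule} {G : HostGraph} {n m : ℕ} {J : Interp w.SR G}
    {a : Fin n → G.V} {b : Fin m → G.E} {ρ : Env} (p : Prop) [Decidable p] :
    (w.adj (GRule.ofDec p : Fm w.SC n m)).Sat J a b ρ ↔ p := by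
  unfold GRule.ofDec
  split
  · next h => exact ⟨fun _ => h, fun _ => trivial⟩
  · next h => exact ⟨fun h' => h'.elim, fun h' => absurd h' h⟩

namespace Transition
variable {w : GRule} {G H : HostGraph} {ρ₁ : Env} (T : Transition w G H ρ₁)

/-- Both rule graphs are evaluated with the context degrees and the same assignment, so exchanging
the two gluings gives a transition for the inverse rule. -/
noncomputable def inv : Transition w.inv H G ρ₁ := ⟨T.D, T.k, T.R, T.L⟩

noncomputable def JL : Interp w.SL G := Interp.over T.L.mV T.L.mE
noncomputable def JR : Interp w.SR H := Interp.over T.R.mV T.R.mE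

/-- A node of `G` is a given node of the left-hand graph or is none of them. -/
def End (v : G.V) : Option w.LNode → Prop
  | some u => v = T.L.mV u
  | none => ∀ u, v ≠ T.L.mV u

/-- The variables that a substitution replaces by constants denote items of the left-hand graph;
the remaining variables denote corresponding items of the context in `G` and `H`. -/
structure Rel {n m n' m' : ℕ} (σ : Sub w.SL n m w.SL n' m') (a : Fin n → G.V) (b : Fin m → G.E)
    (a' : Fin n' → H.V) (b' : Fin m' → H.E) : Prop where
  nodeC : ∀ c, σ.node (.inl c) = .inl c
  edgeC : ∀ e, σ.edge (.inl e) = .inl e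
  nodeV : ∀ x, (∃ v, σ.node (.inr x) = .inl v ∧ a x = T.L.mV v) ∨
    ∃ x' p, σ.node (.inr x) = .inr x' ∧ p ∉ Set.range T.k ∧ a x = T.L.dV p ∧ a' x' = T.R.dV p
  edgeV : ∀ y, (∃ e, σ.edge (.inr y) = .inl e ∧ b y = T.L.mE e ∧ σ.src y = none ∧
      σ.tgt y = none) ∨
    ∃ y' q, σ.edge (.inr y) = .inr y' ∧ b y = T.L.dE q ∧ b' y' = T.R.dE q ∧
      T.End (G.src (b y)) (σ.src y) ∧ T.End (G.tgt (b y)) (σ.tgt y)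

variable {n m n' m' : ℕ} {σ : Sub w.SL n m w.SL n' m'} {a : Fin n → G.V} {b : Fin m → G.E}
  {a' : Fin n' → H.V} {b' : Fin m' → H.E}

variable {T} in
theorem Rel.nodeConst (h : T.Rel σ a b a' b') (v : w.LNode) :
    T.Rel (σ.nodeConst v) (Fin.cons (T.L.mV v) a : Fin (n + 1) → G.V) b a' b' where
  nodeC := h.nodeC
  edgeC := h.edgeC
  nodeV x := by
    refine Fin.cases ?_ (fun x => ?_) x
    · exact .inl ⟨v, rfl, rfl⟩
    · exact h.nodeV x
  edgeV := h.edgeV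

variable {T} in
theorem Rel.nodeVar (h : T.Rel σ a b a' b') {p : T.D.V} (hp : p ∉ Set.range T.k) :
    T.Rel σ.nodeVar (Fin.cons (T.L.dV p) a : Fin (n + 1) → G.V) b
      (Fin.cons (T.R.dV p) a' : Fin (n' + 1) → H.V) b' where
  nodeC c := congrArg (Sum.map id Fin.succ) (h.nodeC c)
  edgeC := h.edgeC
  nodeV x := by
    refine Fin.cases ?_ (fun x => ?_) x
    · exact .inr ⟨0, p, rfl, hp, rfl, rfl⟩
    · rcases h.nodeV x with ⟨v, h1, h2⟩ | ⟨x', q, h1, h2, h3, h4⟩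
      · exact .inl ⟨v, congrArg (Sum.map id Fin.succ) h1, h2⟩
      · exact .inr ⟨x'.succ, q, congrArg (Sum.map id Fin.succ) h1, h2, h3, h4⟩
  edgeV := h.edgeV

variable {T} in
theorem Rel.edgeConst (h : T.Rel σ a b a' b') (e : Fin w.eL) :
    T.Rel (σ.edgeConst e) a (Fin.cons (T.L.mE e) b : Fin (m + 1) → G.E) a' b' where
  nodeC := h.nodeC
  edgeC := h.edgeC
  nodeV := h.nodeV
  edgeV x := by
    refine Fin.cases ?_ (fun x => ?_) x
    · exact .inl ⟨e, rfl, rfl, rfl, rfl⟩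
    · exact h.edgeV x

variable {T} in
theorem Rel.edgeVar (h : T.Rel σ a b a' b') {q : T.D.E} {s t : Option w.LNode}
    (hs : T.End (G.src (T.L.dE q)) s) (ht : T.End (G.tgt (T.L.dE q)) t) :
    T.Rel (σ.edgeVar s t) a (Fin.cons (T.L.dE q) b : Fin (m + 1) → G.E) a'
      (Fin.cons (T.R.dE q) b' : Fin (m' + 1) → H.E) where
  nodeC := h.nodeC
  edgeC c := congrArg (Sum.map id Fin.succ) (h.edgeC c)
  nodeV := h.nodeV
  edgeV x := by
    refine Fin.cases ?_ (fun x => ?_) x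
    · exact .inr ⟨0, q, rfl, rfl, rfl, hs, ht⟩
    · rcases h.edgeV x with ⟨v, h1, h2⟩ | ⟨x', q, h1, h2, h3, h4⟩
      · exact .inl ⟨v, congrArg (Sum.map id Fin.succ) h1, h2⟩
      · exact .inr ⟨x'.succ, q, congrArg (Sum.map id Fin.succ) h1, h2, h3, h4⟩

variable {T} in
theorem Rel.edge_cases (h : T.Rel σ a b a' b') (z : Fin w.eL ⊕ Fin m) :
    (∃ e, σ.edge z = .inl e ∧ Sum.elim T.JL.edge b z = T.L.mE e) ∨
    ∃ y' q, σ.edge z = .inr y' ∧ Sum.elim T.JL.edge b z = T.L.dE q ∧ b' y' = T.R.dE q := by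
  rcases z with e | y
  · exact .inl ⟨e, h.edgeC e, rfl⟩
  · rcases h.edgeV y with ⟨e, h1, h2, -, -⟩ | ⟨y', q, h1, h2, h3, -, -⟩
    · exact .inl ⟨e, h1, h2⟩
    · exact .inr ⟨y', q, h1, h2, h3⟩

theorem notMem_range_of_ne {x : T.D.V} (h : ∀ u, T.L.dV x ≠ T.L.mV u) : x ∉ Set.range T.k := by
  rintro ⟨v, rfl⟩
  exact h (.inl v) (T.L.mV_inl v).symm

variable {T} in
/-- After the valuation, a node term is a constant or denotes a node of the context outside the
interface. -/
theorem Rel.node_cases (h : T.Rel σ a b a' b') (t : NodeTm w.SL n m) :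
    (∃ v, w.valNode (t.sub σ) = .ref (.inl v) ∧ t.eval T.JL a b = T.L.mV v) ∨
    ∃ z p, (∀ v, w.valNode (t.sub σ) ≠ .ref (.inl v)) ∧ w.adjNode (w.valNode (t.sub σ)) = some z ∧
      p ∉ Set.range T.k ∧ t.eval T.JL a b = T.L.dV p ∧ z.eval T.JR a' b' = T.R.dV p := by
  cases t with
  | ref x =>
    rcases x with c | x
    · exact .inl ⟨c, congrArg NodeTm.ref (h.nodeC c), rfl⟩
    · rcases h.nodeV x with ⟨v, h1, h2⟩ | ⟨x', p, h1, h2, h3, h4⟩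
      · exact .inl ⟨v, congrArg NodeTm.ref h1, h2⟩
      · have e : w.valNode (NodeTm.sub σ (.ref (.inr x))) = .ref (.inr x') :=
          congrArg NodeTm.ref h1
        refine .inr ⟨.ref (.inr x'), p, ?_, ?_, h2, h3, h4⟩
        · intro v hv
          rw [e] at hv
          cases hv
        · rw [e]
          rfl
  | src z =>
    rcases z with e | y
    · refine .inl ⟨w.left.src e, ?_, T.L.src_mE e⟩
      simp only [NodeTm.sub, h.edgeC]
      rfl
    · rcases h.edgeV y with ⟨e, h1, h2, h3, -⟩ | ⟨y', q, h1, h2, h3, h4, -⟩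
      · refine .inl ⟨w.left.src e, ?_, (congrArg G.src h2).trans (T.L.src_mE e)⟩
        simp only [NodeTm.sub, h3, h1]
        rfl
      · cases hs : σ.src y with
        | some v =>
          rw [hs] at h4
          refine .inl ⟨v, ?_, h4⟩
          simp only [NodeTm.sub, hs]
          rfl
        | none =>
          rw [hs] at h4
          have e : w.valNode (NodeTm.sub σ (.src (.inr y))) = .src (.inr y') := by
            simp only [NodeTm.sub, hs, h1]
            rfl
          -- The absent substitution records that the source is no node of L. It is thus a context
          -- node outside the interface, where nothing changes between `G` and `H`.
          have h5 : G.src (b y) = T.L.dV (T.D.src q) := by rw [h2, T.L.src_dE]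
          refine .inr ⟨.src (.inr y'), T.D.src q, ?_, ?_, T.notMem_range_of_ne ?_, h5,
            (congrArg H.src h3).trans (T.R.src_dE q)⟩
          · intro v hv
            rw [e] at hv
            cases hv
          · rw [e]
            rfl
          · rw [← h5]
            exact h4
  | tgt z =>
    rcases z with e | y
    · refine .inl ⟨w.left.tgt e, ?_, T.L.tgt_mE e⟩
      simp only [NodeTm.sub, h.edgeC]
      rfl
    · rcases h.edgeV y with ⟨e, h1, h2, -, h3⟩ | ⟨y', q, h1, h2, h3, -, h4⟩
      · refine .inl ⟨w.left.tgt e, ?_, (congrArg G.tgt h2).trans (T.L.tgt_mE e)⟩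
        simp only [NodeTm.sub, h3, h1]
        rfl
      · cases hs : σ.tgt y with
        | some v =>
          rw [hs] at h4
          refine .inl ⟨v, ?_, h4⟩
          simp only [NodeTm.sub, hs]
          rfl
        | none =>
          rw [hs] at h4
          have e : w.valNode (NodeTm.sub σ (.tgt (.inr y))) = .tgt (.inr y') := by
            simp only [NodeTm.sub, hs, h1]
            rfl
          have h5 : G.tgt (b y) = T.L.dV (T.D.tgt q) := by rw [h2, T.L.tgt_dE]
          refine .inr ⟨.tgt (.inr y'), T.D.tgt q, ?_, ?_, T.notMem_range_of_ne ?_, h5,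
            (congrArg H.tgt h3).trans (T.R.tgt_dE q)⟩
          · intro v hv
            rw [e] at hv
            cases hv
          · rw [e]
            rfl
          · rw [← h5]
            exact h4

/-- In `H` the degree of an interface node is its context degree plus its degree in R, so Adj's
subtraction recovers the context degree. -/
theorem eval_cToR (ρ : Env) (c : CDeg (Fin w.nK)) :
    (w.cToR c).eval ρ (ILeaf.eval T.JR a' b') = T.D.cdeg T.k c := by
  cases c with
  | incon v =>
    change H.indeg (T.R.mV (.inl v)) - (w.right.indeg (.inl v) : ℤ) = _
    rw [T.R.indeg_inl]
    exact add_sub_cancel_right _ _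
  | outcon v =>
    change H.outdeg (T.R.mV (.inl v)) - (w.right.outdeg (.inl v) : ℤ) = _
    rw [T.R.outdeg_inl]
    exact add_sub_cancel_right _ _

theorem eval_lstToR (ρ : Env) (l : CLst (Fin w.nK)) :
    (w.lstToR l).eval ρ (ILeaf.eval T.JR a' b') (XLeaf.eval T.JR a' b') =
      l.eval ρ (T.D.cdeg T.k) Empty.elim := by
  rw [GRule.eval_lstToR]
  simp only [eval_cToR]

/-- Labels refer to the graph only through context degrees, which Adj expresses correctly in `H`. -/
theorem eval_adj_lstToL (ρ : Env) (l : CLst (Fin w.nK)) :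
    ((w.lstToL l).bind w.adjI w.adjX : LTm w.SR n' m').eval ρ (ILeaf.eval T.JR a' b')
      (XLeaf.eval T.JR a' b') = l.eval ρ (T.D.cdeg T.k) Empty.elim := by
  have h : ∀ c : CDeg (Fin w.nK), ((w.cToL c : ITm w.SC n' m').bind w.adjI).eval ρ
      (ILeaf.eval T.JR a' b') = T.D.cdeg T.k c := by
    intro c
    rw [← T.eval_cToR ρ c]
    cases c <;> rfl
  rw [GRule.lstToL, LstE.eval_bind, LstE.eval_bind]
  simp only [← IntE.eval_bind, h]
  congr 1
  exact funext fun x => x.elim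

variable {T} in
-- At interface nodes the context degree recovered in `H` plus the degree in L is the old degree. At
-- deleted nodes Val has inserted the literal. Any other node lies in the context outside the
-- interface and keeps its degree.
theorem Rel.eval_ileaf (h : T.Rel σ a b a' b') (ρ : Env) (i : ILeaf w.SL n m) :
    ((w.valI (i.sub σ)).bind w.adjI).eval ρ (ILeaf.eval T.JR a' b') = i.eval T.JL a b := by
  cases i with
  | indeg x =>
    rcases h.node_cases x with ⟨v, h1, h2⟩ | ⟨z, p, h1, h2, h3, h4, h5⟩
    · simp only [ILeaf.sub, ILeaf.eval, GRule.valI, h1, h2]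
      rcases v with v | d
      · change (w.cToR (.incon v)).eval ρ (ILeaf.eval T.JR a' b') + (w.left.indeg (.inl v) : ℤ) = _
        rw [eval_cToR, T.L.indeg_inl]
        rfl
      · exact (T.L.indeg_inr d).symm
    · simp only [ILeaf.sub, w.valI_indeg h1, IntE.bind, GRule.adjI, h2, IntE.eval, ILeaf.eval,
        h4, h5, T.L.indeg_dV h3, T.R.indeg_dV h3]
  | outdeg x =>
    rcases h.node_cases x with ⟨v, h1, h2⟩ | ⟨z, p, h1, h2, h3, h4, h5⟩
    · simp only [ILeaf.sub, ILeaf.eval, GRule.valI, h1, h2]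
      rcases v with v | d
      · change (w.cToR (.outcon v)).eval ρ (ILeaf.eval T.JR a' b') +
          (w.left.outdeg (.inl v) : ℤ) = _
        rw [eval_cToR, T.L.outdeg_inl]
        rfl
      · exact (T.L.outdeg_inr d).symm
    · simp only [ILeaf.sub, w.valI_outdeg h1, IntE.bind, GRule.adjI, h2, IntE.eval, ILeaf.eval,
        h4, h5, T.L.outdeg_dV h3, T.R.outdeg_dV h3]
  | incon v => exact Empty.elim v
  | outcon v => exact Empty.elim v

theorem context_label {p : T.D.V} (hp : p ∉ Set.range T.k) :
    (H.nlist (T.R.dV p), H.nmark (T.R.dV p)) = (G.nlist (T.L.dV p), G.nmark (T.L.dV p)) :=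
  Option.some_injective _ ((T.R.nodeLabel_eq hp).symm.trans (T.L.nodeLabel_eq hp))

theorem context_root_eq {p : T.D.V} (hp : p ∉ Set.range T.k) :
    H.root (T.R.dV p) = G.root (T.L.dV p) :=
  Option.some_injective _ ((T.R.root_eq hp).symm.trans (T.L.root_eq hp))

theorem context_edgeLabel (q : T.D.E) :
    (H.elist (T.R.dE q), H.emark (T.R.dE q)) = (G.elist (T.L.dE q), G.emark (T.L.dE q)) :=
  (T.R.edgeLabel_eq q).symm.trans (T.L.edgeLabel_eq q)

variable {T} in
-- The labels of matched items in `G` are evaluated with `ρ₁`, those inserted by Val with the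
-- current assignment. The hypothesis on `evalAt` says that this makes no difference.
theorem Rel.eval_xleaf (h : T.Rel σ a b a' b') {ρ : Env}
    (hρ : w.left.evalAt ρ (T.D.cdeg T.k) = w.left.evalAt ρ₁ (T.D.cdeg T.k)) (i : XLeaf w.SL n m) :
    ((w.valX (i.sub σ)).bind w.adjI w.adjX).eval ρ (ILeaf.eval T.JR a' b')
      (XLeaf.eval T.JR a' b') = i.eval T.JL a b := by
  cases i with
  | lV x =>
    rcases h.node_cases x with ⟨v, h1, h2⟩ | ⟨z, p, h1, h2, h3, h4, h5⟩
    · simp only [XLeaf.sub, XLeaf.eval, GRule.valX, h1, h2, eval_adj_lstToL]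
      rw [T.L.nlist_mV, ← hρ]
      rfl
    · simp only [XLeaf.sub, w.valX_lV h1, LstE.bind, GRule.adjX, h2, LstE.eval, XLeaf.eval,
        h4, h5]
      exact congrArg Prod.fst (T.context_label h3)
  | lE z =>
    rcases h.edge_cases z with ⟨e, h1, h2⟩ | ⟨y, q, h1, h2, h3⟩
    · simp only [XLeaf.sub, XLeaf.eval, h1, h2, GRule.valX, eval_adj_lstToL]
      rw [T.L.elist_mE, ← hρ]
      rfl
    · simp only [XLeaf.sub, XLeaf.eval, h1, h2, GRule.valX, LstE.bind, GRule.adjX, LstE.eval,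
        Sum.elim_inr, h3]
      exact congrArg Prod.fst (T.context_edgeLabel q)

variable {T} in
theorem Rel.eval_ITm (h : T.Rel σ a b a' b') (ρ : Env) (i : ITm w.SL n m) :
    (((ITm.sub σ i).bind w.valI).bind w.adjI).eval ρ (ILeaf.eval T.JR a' b') =
      i.eval ρ (ILeaf.eval T.JL a b) := by
  rw [IntE.eval_bind, IntE.eval_bind, ITm.sub, IntE.eval_bind]
  simp only [IntE.eval, ← IntE.eval_bind, h.eval_ileaf]

variable {T} in
theorem Rel.eval_LTm (h : T.Rel σ a b a' b') {ρ : Env}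
    (hρ : w.left.evalAt ρ (T.D.cdeg T.k) = w.left.evalAt ρ₁ (T.D.cdeg T.k)) (i : LTm w.SL n m) :
    (((LTm.sub σ i).bind w.valI w.valX).bind w.adjI w.adjX).eval ρ (ILeaf.eval T.JR a' b')
      (XLeaf.eval T.JR a' b') = i.eval ρ (ILeaf.eval T.JL a b) (XLeaf.eval T.JL a b) := by
  rw [LstE.eval_bind, LstE.eval_bind, LTm.sub, LstE.eval_bind]
  simp only [IntE.eval, LstE.eval, ← IntE.eval_bind, ← LstE.eval_bind, h.eval_ileaf,
    h.eval_xleaf hρ]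

variable {T} in
-- Two constants are compared in L, two context nodes through the injections of `D`. A constant
-- never equals a context node outside the interface. In `H` this remains an equation with a
-- preserved node, false by disjointness, or has become `fls` because the constant was deleted.
theorem Rel.sat_nodeEq (h : T.Rel σ a b a' b') (ρ : Env) (x y : NodeTm w.SL n m) :
    (w.adj (w.val (.at (.nodeEq (x.sub σ) (y.sub σ))))).Sat T.JR a' b' ρ ↔
      x.eval T.JL a b = y.eval T.JL a b := by
  simp only [GRule.val]
  rcases h.node_cases x with ⟨u, h1, h2⟩ | ⟨z, p, h1, h2, h3, h4, h5⟩
  · rcases h.node_cases y with ⟨v, h1', h2'⟩ | ⟨z', p', h1', h2', h3', h4', h5'⟩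
    · simp only [GRule.valAtomic, h1, h1', sat_adj_ofDec, h2, h2', T.L.mV_injective.eq_iff]
    · rw [w.valAtomic_nodeEq (.inr h1'), h1, h2, h4']
      refine iff_of_false ?_ (T.L.dV_ne_mV h3' u).symm
      rcases u with u | u
      · intro hs
        have hs : Fm.Sat T.JR a' b' ρ (w.adjAtomic _) := hs
        rw [w.adjAtomic_nodeEq rfl h2'] at hs
        exact T.R.dV_ne_mV h3' (.inl u) (h5'.symm.trans (Eq.symm hs))
      · intro hs
        have hs : Fm.Sat T.JR a' b' ρ (w.adjAtomic _) := hs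
        rw [w.adjAtomic_nodeEq_none (.inl rfl)] at hs
        exact hs
  · rcases h.node_cases y with ⟨v, h1', h2'⟩ | ⟨z', p', h1', h2', h3', h4', h5'⟩
    · rw [w.valAtomic_nodeEq (.inl h1), h1', h2', h4]
      refine iff_of_false ?_ (T.L.dV_ne_mV h3 v)
      rcases v with u | u
      · intro hs
        have hs : Fm.Sat T.JR a' b' ρ (w.adjAtomic _) := hs
        rw [w.adjAtomic_nodeEq h2 rfl] at hs
        exact T.R.dV_ne_mV h3 (.inl u) (h5.symm.trans hs)
      · intro hs
        have hs : Fm.Sat T.JR a' b' ρ (w.adjAtomic _) := hs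
        rw [w.adjAtomic_nodeEq_none (.inr rfl)] at hs
        exact hs
    · rw [w.valAtomic_nodeEq (.inl h1)]
      simp only [GRule.adj, GRule.adjAtomic, h2, h2', Fm.Sat, Atomic.Sat, h5, h5', h4, h4',
        T.R.dV_injective.eq_iff, T.L.dV_injective.eq_iff]

variable {T} in
theorem Rel.sat_atomic (h : T.Rel σ a b a' b') {ρ : Env}
    (hρ : w.left.evalAt ρ (T.D.cdeg T.k) = w.left.evalAt ρ₁ (T.D.cdeg T.k))
    (A : Atomic w.SL n m) :
    (w.adj (w.val (.at (A.sub σ)))).Sat T.JR a' b' ρ ↔ A.Sat T.JL a b ρ := by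
  cases A with
  | typ t x => exact Iff.rfl
  | leq l l' =>
    simp only [Atomic.sub, GRule.val, GRule.valAtomic, GRule.adj, GRule.adjAtomic, Fm.Sat,
      Atomic.Sat, h.eval_LTm hρ]
  | cmp o i i' =>
    simp only [Atomic.sub, GRule.val, GRule.valAtomic, GRule.adj, GRule.adjAtomic, Fm.Sat,
      Atomic.Sat, h.eval_ITm]
  | root x =>
    simp only [Atomic.sub, GRule.val, Atomic.Sat]
    rcases h.node_cases x with ⟨u, h1, h2⟩ | ⟨z, p, h1, h2, h3, h4, h5⟩
    · simp only [GRule.valAtomic, h1, sat_adj_ofDec, h2, T.L.root_mV]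
      rfl
    · rw [w.valAtomic_root h1]
      simp only [GRule.adj, GRule.adjAtomic, h2, Fm.Sat, Atomic.Sat, h5, h4,
        T.context_root_eq h3]
  | nodeEq x y => exact h.sat_nodeEq ρ x y
  | edgeEq e f =>
    simp only [Atomic.sub, GRule.val, Atomic.Sat]
    rcases h.edge_cases e with ⟨u, h1, h2⟩ | ⟨z, p, h1, h2, h3⟩
    · rcases h.edge_cases f with ⟨u', h1', h2'⟩ | ⟨z', p', h1', h2', h3'⟩
      · simp only [h1, h1', h2, h2', GRule.valAtomic, sat_adj_ofDec, T.L.mE_injective.eq_iff]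
      · simp only [h1, h1', h2, h2', GRule.valAtomic]
        -- All edges of L are deleted, so Adj has turned a mixed equation into `fls`; in `G` rule
        -- edges and context edges differ.
        exact iff_of_false id (T.L.dE_ne_mE p' u).symm
    · rcases h.edge_cases f with ⟨u', h1', h2'⟩ | ⟨z', p', h1', h2', h3'⟩
      · simp only [h1, h1', h2, h2', GRule.valAtomic]
        exact iff_of_false id (T.L.dE_ne_mE p u')
      · simp only [h1, h1', h2, h2', GRule.valAtomic, GRule.adj, GRule.adjAtomic, Fm.Sat,
          Atomic.Sat, Sum.elim_inr, h3, h3', T.L.dE_injective.eq_iff, T.R.dE_injective.eq_iff]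
  | mV x u =>
    simp only [Atomic.sub, GRule.val, Atomic.Sat]
    rcases h.node_cases x with ⟨v, h1, h2⟩ | ⟨z, p, h1, h2, h3, h4, h5⟩
    · simp only [GRule.valAtomic, h1, sat_adj_ofDec, h2, T.L.nmark_mV]
      rfl
    · rw [w.valAtomic_mV u h1]
      have := congrArg Prod.snd (T.context_label h3)
      simp only at this
      simp only [GRule.adj, GRule.adjAtomic, h2, Fm.Sat, Atomic.Sat, h5, h4, this]
  | mE e u =>
    simp only [Atomic.sub, GRule.val, Atomic.Sat]
    rcases h.edge_cases e with ⟨f, h1, h2⟩ | ⟨z, p, h1, h2, h3⟩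
    · simp only [h1, h2, GRule.valAtomic, sat_adj_ofDec, T.L.emark_mE]
      rfl
    · have := congrArg Prod.snd (T.context_edgeLabel p)
      simp only at this
      simp only [h1, h2, GRule.valAtomic, GRule.adj, GRule.adjAtomic, Fm.Sat,
          Atomic.Sat, Sum.elim_inr, h3, this]

end Transition

end GP2

-- Carrying conditions across a transition

namespace GP2
namespace Transition
variable {w : GRule} {G H : HostGraph} {ρ₁ : Env} (T : Transition w G H ρ₁)
variable {n m n' m' : ℕ} {σ : Sub w.SL n m w.SL n' m'} {a : Fin n → G.V} {b : Fin m → G.E}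
  {a' : Fin n' → H.V} {b' : Fin m' → H.E}

/-- The context node may lie in the interface here, because the guards produced by Split are
evaluated before that possibility has been excluded. Equality with a preserved constant then means
equality in `D`, on either side. -/
theorem sat_nodeEq_const {ρ : Env} {t : NodeTm w.SL n m} {z : NodeTm w.SR n m}
    {a' : Fin n → H.V} {b' : Fin m → H.E}
    (h1 : ∀ v, w.valNode t ≠ .ref (.inl v)) (h2 : w.adjNode (w.valNode t) = some z) {x : T.D.V}
    (hx : z.eval T.JR a' b' = T.R.dV x) (v : w.LNode) :
    (w.adj (w.val (.at (.nodeEq t (.ref (.inl v)))))).Sat T.JR a' b' ρ ↔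
      T.L.dV x = T.L.mV v := by
  have e : w.val (.at (.nodeEq t (.ref (.inl v)))) =
      .at (.nodeEq (w.valNode t) (.ref (.inl v))) := w.valAtomic_nodeEq (.inl h1)
  rw [e]
  change Fm.Sat T.JR a' b' ρ (w.adjAtomic _) ↔ _
  rcases v with v | v
  · rw [w.adjAtomic_nodeEq h2 rfl, T.L.mV_inl, T.L.dV_injective.eq_iff]
    change z.eval T.JR a' b' = T.R.mV (.inl v) ↔ _
    rw [hx, T.R.mV_inl, T.R.dV_injective.eq_iff]
  · rw [w.adjAtomic_nodeEq_none (.inr rfl)]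
    exact iff_of_false id (T.L.dV_ne_mV_inr x v)

theorem sat_endpoint {ρ : Env} {t : NodeTm w.SL n m} {z : NodeTm w.SR n m}
    {a' : Fin n → H.V} {b' : Fin m → H.E}
    (h1 : ∀ v, w.valNode t ≠ .ref (.inl v)) (h2 : w.adjNode (w.valNode t) = some z) {x : T.D.V}
    (hx : z.eval T.JR a' b' = T.R.dV x) (o : Option w.LNode) :
    (w.adj (w.val (endpoint (nodeList w.nK w.nD) t o))).Sat T.JR a' b' ρ ↔
      T.End (T.L.dV x) o := by
  cases o with
  | some v => exact T.sat_nodeEq_const h1 h2 hx v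
  | none =>
    simp only [endpoint, GRule.val_bigAnd, GRule.adj_bigAnd, Fm.sat_bigAnd, List.mem_map,
      forall_exists_index, and_imp, forall_apply_eq_imp_iff₂]
    exact ⟨fun h v => (T.sat_nodeEq_const h1 h2 hx v).not.mp (h v (mem_nodeList v)),
      fun h v _ => (T.sat_nodeEq_const h1 h2 hx v).not.mpr (h v)⟩

theorem exists_end (v : G.V) : ∃ o, T.End v o := by
  by_cases h : ∃ u, v = T.L.mV u
  · exact ⟨some h.choose, h.choose_spec⟩
  · exact ⟨none, fun u hu => h ⟨u, hu⟩⟩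

/-- A quantified node in L is handled by a disjunct of Split, every other node by the guarded
quantifier. In `H` the guard of Adj excludes the new nodes and that of Split the interface, leaving
exactly the context nodes outside the interface. -/
theorem sat_split_exV {φ : Fm w.SL (n + 1) m} {ρ : Env} (h : T.Rel σ a b a' b')
    (ih : ∀ {n' m' : ℕ} {σ : Sub w.SL (n + 1) m w.SL n' m'} {a : Fin (n + 1) → G.V}
      {b : Fin m → G.E} {a' : Fin n' → H.V} {b' : Fin m' → H.E}, T.Rel σ a b a' b' →
      ((w.adj (w.val (φ.split (nodeList w.nK w.nD) (List.finRange w.eL) σ))).Sat T.JR a' b' ρ ↔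
        φ.Sat T.JL a b ρ)) :
    (w.adj (w.val ((Fm.exV φ).split (nodeList w.nK w.nD) (List.finRange w.eL) σ))).Sat
      T.JR a' b' ρ ↔ (Fm.exV φ).Sat T.JL a b ρ := by
  have href : ∀ (p : T.D.V) (v : w.LNode),
      (w.adj (w.val (.at (.nodeEq (.ref (.inr 0) : NodeTm w.SL (n' + 1) m')
        (.ref (.inl v)))))).Sat T.JR (Fin.cons (T.R.dV p) a' : Fin (n' + 1) → H.V) b' ρ ↔
        T.L.dV p = T.L.mV v :=
    fun p v => T.sat_nodeEq_const (z := .ref (.inr 0)) (x := p)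
      (a' := (Fin.cons (T.R.dV p) a' : Fin (n' + 1) → H.V)) (b' := b')
      (fun v hv => by cases hv) rfl rfl v
  simp only [Fm.split, GRule.val, GRule.adj, Fm.Sat, GRule.val_bigOr, GRule.adj_bigOr,
    Fm.sat_bigOr, GRule.val_bigAnd, GRule.adj_bigAnd, Fm.sat_bigAnd, List.mem_map,
    forall_exists_index, and_imp, forall_apply_eq_imp_iff₂]
  constructor
  · rintro (⟨_, ⟨_, ⟨_, ⟨v, -, rfl⟩, rfl⟩, rfl⟩, hs⟩ | ⟨u, h1, h2, h3⟩)
    · exact ⟨T.L.mV v, (ih (h.nodeConst v)).mp hs⟩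
    · rcases T.R.node_cases u with ⟨v, rfl⟩ | ⟨p, hp, rfl⟩
      · rcases v with v | v
        -- An interface node of `H` is excluded by the Split guard for the corresponding constant.
        · refine absurd ?_ (h2 (.inl v) (mem_nodeList _))
          rw [T.R.mV_inl]
          exact (href (T.k v) (.inl v)).mpr (T.L.mV_inl v).symm
        · exact absurd rfl (h1 v (List.mem_finRange v))
      · exact ⟨T.L.dV p, (ih (h.nodeVar hp)).mp h3⟩
  · rintro ⟨v, hv⟩
    rcases T.L.node_cases v with ⟨u, rfl⟩ | ⟨p, hp, rfl⟩
    · exact .inl ⟨_, ⟨_, ⟨_, ⟨u, mem_nodeList u, rfl⟩, rfl⟩, rfl⟩, (ih (h.nodeConst u)).mpr hv⟩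
    · refine .inr ⟨T.R.dV p, fun v _ => T.R.dV_ne_mV_inr p v, fun v _ => ?_,
        (ih (h.nodeVar hp)).mpr hv⟩
      exact (href p v).not.mpr (T.L.dV_ne_mV hp v)

theorem mem_options (o : Option w.LNode) :
    o ∈ (nodeList w.nK w.nD).map some ++ [none] := by
  cases o with
  | none => simp
  | some v => simp [mem_nodeList]

/-- The argument parallels that for nodes. The further disjunction over source and target records
which endpoints are rule nodes: the label of an interface endpoint may change, so terms for it must
be valuated in L. -/
theorem sat_split_exE {φ : Fm w.SL n (m + 1)} {ρ : Env} (h : T.Rel σ a b a' b')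
    (ih : ∀ {n' m' : ℕ} {σ : Sub w.SL n (m + 1) w.SL n' m'} {a : Fin n → G.V}
      {b : Fin (m + 1) → G.E} {a' : Fin n' → H.V} {b' : Fin m' → H.E}, T.Rel σ a b a' b' →
      ((w.adj (w.val (φ.split (nodeList w.nK w.nD) (List.finRange w.eL) σ))).Sat T.JR a' b' ρ ↔
        φ.Sat T.JL a b ρ)) :
    (w.adj (w.val ((Fm.exE φ).split (nodeList w.nK w.nD) (List.finRange w.eL) σ))).Sat
      T.JR a' b' ρ ↔ (Fm.exE φ).Sat T.JL a b ρ := by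
  have hsrc : ∀ (q : T.D.E) (o : Option w.LNode),
      (w.adj (w.val (endpoint (nodeList w.nK w.nD)
        (.src (.inr 0) : NodeTm w.SL n' (m' + 1)) o))).Sat T.JR a'
        (Fin.cons (T.R.dE q) b' : Fin (m' + 1) → H.E) ρ ↔ T.End (T.L.dV (T.D.src q)) o :=
    fun q o => T.sat_endpoint (z := .src (.inr 0)) (a' := a')
      (b' := (Fin.cons (T.R.dE q) b' : Fin (m' + 1) → H.E)) (fun v hv => by cases hv) rfl
      (T.R.src_dE q) o
  have htgt : ∀ (q : T.D.E) (o : Option w.LNode),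
      (w.adj (w.val (endpoint (nodeList w.nK w.nD)
        (.tgt (.inr 0) : NodeTm w.SL n' (m' + 1)) o))).Sat T.JR a'
        (Fin.cons (T.R.dE q) b' : Fin (m' + 1) → H.E) ρ ↔ T.End (T.L.dV (T.D.tgt q)) o :=
    fun q o => T.sat_endpoint (z := .tgt (.inr 0)) (a' := a')
      (b' := (Fin.cons (T.R.dE q) b' : Fin (m' + 1) → H.E)) (fun v hv => by cases hv) rfl
      (T.R.tgt_dE q) o
  simp only [Fm.split, GRule.val, GRule.adj, Fm.Sat, GRule.val_bigOr, GRule.adj_bigOr,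
    Fm.sat_bigOr, GRule.val_bigAnd, GRule.adj_bigAnd, Fm.sat_bigAnd, List.mem_map,
    List.mem_flatMap, forall_exists_index, and_imp, forall_apply_eq_imp_iff₂]
  constructor
  · rintro (⟨_, ⟨_, ⟨_, ⟨v, -, rfl⟩, rfl⟩, rfl⟩, hs⟩ |
      ⟨u, h1, -, _, ⟨_, ⟨_, ⟨p, -, q, -, rfl⟩, rfl⟩, rfl⟩, h3, h4, h5⟩)
    · exact ⟨T.L.mE v, (ih (h.edgeConst v)).mp hs⟩
    · rcases T.R.edge_cases u with ⟨v, rfl⟩ | ⟨d, rfl⟩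
      · exact absurd rfl (h1 v (List.mem_finRange v))
      · refine ⟨T.L.dE d, (ih (h.edgeVar ?_ ?_)).mp h5⟩
        · rw [T.L.src_dE]
          exact (hsrc d p).mp h3
        · rw [T.L.tgt_dE]
          exact (htgt d q).mp h4
  · rintro ⟨e, he⟩
    rcases T.L.edge_cases e with ⟨f, rfl⟩ | ⟨d, rfl⟩
    · exact .inl ⟨_, ⟨_, ⟨_, ⟨f, List.mem_finRange f, rfl⟩, rfl⟩, rfl⟩,
        (ih (h.edgeConst f)).mpr he⟩
    · obtain ⟨p, hp⟩ := T.exists_end (T.L.dV (T.D.src d))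
      obtain ⟨q, hq⟩ := T.exists_end (T.L.dV (T.D.tgt d))
      -- The Split guards against edges of L hold trivially: Adj has made each equation `fls`, and
      -- only its negation occurs.
      refine .inr ⟨T.R.dE d, fun f _ => T.R.dE_ne_mE d f, fun f _ => id, _,
        ⟨_, ⟨_, ⟨p, mem_options p, q, mem_options q, rfl⟩, rfl⟩, rfl⟩, (hsrc d p).mpr hp,
        (htgt d q).mpr hq, (ih (h.edgeVar ?_ ?_)).mpr he⟩
      · rw [T.L.src_dE]
        exact hp
      · rw [T.L.tgt_dE]
        exact hq

/-- The transformations Split, Val and Adj carry a condition on `G` over to `H`. -/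
theorem sat_adj_val_split {n m : ℕ} (φ : Fm w.SL n m) (hφ : φ.BoundGe w.fresh) {ρ : Env}
    (hρ : ∀ x : LVar, x.name < w.fresh → ρ x = ρ₁ x) {n' m' : ℕ}
    {σ : Sub w.SL n m w.SL n' m'} {a : Fin n → G.V} {b : Fin m → G.E}
    {a' : Fin n' → H.V} {b' : Fin m' → H.E} (h : T.Rel σ a b a' b') :
    (w.adj (w.val (φ.split (nodeList w.nK w.nD) (List.finRange w.eL) σ))).Sat T.JR a' b' ρ ↔
      φ.Sat T.JL a b ρ := by
  induction φ using Fm.inductionOn generalizing n' m' ρ with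
  | tru => exact Iff.rfl
  | fls => exact Iff.rfl
  | atomic A => exact h.sat_atomic (w.evalAt_left_congr hρ _) A
  | neg φ ih => exact not_congr (ih hφ hρ h)
  | and φ ψ ih1 ih2 => exact and_congr (ih1 hφ.1 hρ h) (ih2 hφ.2 hρ h)
  | or φ ψ ih1 ih2 => exact or_congr (ih1 hφ.1 hρ h) (ih2 hφ.2 hρ h)
  | exV φ ih => exact T.sat_split_exV h fun h' => ih hφ hρ h'
  | exE φ ih => exact T.sat_split_exE h fun h' => ih hφ hρ h'
  | exL x φ ih =>
    -- The bound variable has a name beyond all rule variables, so updating it preserves the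
    -- agreement with `ρ₁`.
    refine exists_congr fun u => ih hφ.2 (fun y hy => ?_) h
    rw [Function.update_of_ne]
    · exact hρ y hy
    · rintro rfl
      exact absurd hφ.1 (not_le.mpr hy)

theorem rel_idS : T.Rel (Sub.idS w.SL 0 0) finZeroElim finZeroElim finZeroElim finZeroElim where
  nodeC _ := rfl
  edgeC _ := rfl
  nodeV x := x.elim0
  edgeV x := x.elim0

theorem sat_prepare (c : Cond) (ρ : Env) :
    (w.prepare c).Sat T.JL finZeroElim finZeroElim ρ ↔
      c.Sat (Interp.FO G) finZeroElim finZeroElim (ρ.rn fun k => k + w.fresh) := by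
  rw [GRule.prepare, ← Fm.sat_rn (add_left_injective w.fresh)]
  refine Fm.sat_sub _ ⟨?_, ?_, fun v => Empty.elim v, fun v => Empty.elim v, fun y => y.elim0,
    fun y => y.elim0⟩ ρ
  · rintro (v | x)
    · exact v.elim
    · exact x.elim0
  · rintro (v | x)
    · exact v.elim
    · exact x.elim0

/-- Val has replaced each degree in Dang(L) by the literal with which it is compared, so only
reflexive equations remain. -/
theorem sat_adj_val_dang (ρ : Env) :
    (w.adj (w.val w.dang)).Sat T.JR finZeroElim finZeroElim ρ := by
  simp only [GRule.dang, GRule.val_bigAnd, GRule.adj_bigAnd, Fm.sat_bigAnd, List.mem_map,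
    forall_exists_index, and_imp, forall_apply_eq_imp_iff₂]
  exact fun d _ => ⟨rfl, rfl⟩

/-- In a gluing no context edge touches a node outside the interface part of the rule graph. Applied
to the inverse transition, this gives Dang(R). -/
theorem sat_dang (ρ : Env) : w.dang.Sat T.JL finZeroElim finZeroElim ρ := by
  simp only [GRule.dang, Fm.sat_bigAnd, List.mem_map, forall_exists_index, and_imp,
    forall_apply_eq_imp_iff₂]
  intro d _
  constructor
  · change [Atom.int (G.indeg (T.L.mV (.inr d)))] = _
    rw [T.L.indeg_inr]
    rfl
  · change [Atom.int (G.outdeg (T.L.mV (.inr d)))] = _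
    rw [T.L.outdeg_inr]
    rfl

/-- Assignments are typed, so each type predicate is witnessed by the value itself. -/
theorem sat_typeOf {G : HostGraph} (J : Interp w.SR G) (ρ : Env) (x : LVar) :
    (w.typeOf x).Sat J finZeroElim finZeroElim ρ := by
  rcases x with ⟨t, i⟩
  cases t with
  | list => trivial
  | atom => exact ⟨_, rfl⟩
  | int => exact ⟨_, rfl⟩
  | string => exact ⟨_, rfl⟩
  | char => exact ⟨_, rfl⟩

theorem sat_spec {ρ : Env} (hρ : ∀ x : LVar, x.name < w.fresh → ρ x = ρ₁ x) :
    w.spec.Sat T.JR finZeroElim finZeroElim ρ := by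
  have hr := w.evalAt_right_congr hρ (T.D.cdeg T.k)
  simp only [GRule.spec, Fm.sat_bigAnd, List.mem_append, List.mem_map]
  rintro φ ((⟨x, -, rfl⟩ | ⟨v, -, rfl⟩) | ⟨e, -, rfl⟩)
  · exact sat_typeOf _ _ _
  · refine ⟨?_, T.R.nmark_mV v, ?_⟩
    · change H.nlist (T.R.mV v) = _
      rw [eval_lstToR, T.R.nlist_mV, ← hr]
      rfl
    · have e : H.root (T.R.mV v) = w.right.root v := T.R.root_mV v
      split
      · next h => exact e.trans h
      · next h => exact fun h' => h (e.symm.trans h')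
  · refine ⟨T.R.src_mE e, T.R.tgt_mE e, ?_, T.R.emark_mE e⟩
    change H.elist (T.R.mE e) = _
    rw [eval_lstToR, T.R.elist_mE, ← hr]
    rfl

/-- The strongest postcondition holds after a transition. -/
theorem models_post {c : Cond} (hc : c.Models G) (hb : w.acL.BoundGe w.fresh)
    (hL : w.acL.Sat T.JL finZeroElim finZeroElim ρ₁)
    (hR : w.acR.Sat T.JR finZeroElim finZeroElim ρ₁) : (w.post c).Models H := by
  obtain ⟨ρc, hc⟩ := hc
  -- Use the rule's assignment below `w.fresh` and the witness for `c`, shifted upwards, from there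
  -- on; this satisfies the rule data and the renamed precondition simultaneously.
  let ρ : Env := fun x => if x.name < w.fresh then ρ₁ x else ρc ⟨x.ty, x.name - w.fresh⟩
  have hρ : ∀ x : LVar, x.name < w.fresh → ρ x = ρ₁ x := fun x hx => if_pos hx
  have hrn : (ρ.rn fun k => k + w.fresh) = ρc := by
    funext x
    have e1 : (ρ.rn fun k => k + w.fresh) x = ρc ⟨x.ty, x.name + w.fresh - w.fresh⟩ :=
      if_neg (not_lt.mpr (Nat.le_add_left _ _))
    rw [e1]
    rcases x with ⟨t, i⟩
    change ρc ⟨t, i + w.fresh - w.fresh⟩ = ρc ⟨t, i⟩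
    rw [Nat.add_sub_cancel]
  refine ⟨ρ, (w.sat_post c ρ).mpr ⟨ρ, T.R.mV, T.R.mE, T.R.mV_injective, T.R.mE_injective,
    ⟨⟨?_, T.sat_adj_val_dang ρ⟩, ?_, T.sat_spec hρ, T.inv.sat_dang ρ⟩⟩⟩
  · refine (T.sat_adj_val_split (.and (w.prepare c) w.acL) ⟨(c.boundGe_rn _).sub _, hb⟩ hρ
      T.rel_idS).mpr ⟨?_, ?_⟩
    · rw [T.sat_prepare, hrn]
      exact hc
    · exact (w.acL.sat_congr fun x hx => hρ x (w.lt_fresh_acL hx)).mpr hL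
  · exact (w.acR.sat_congr fun x hx => hρ x (w.lt_fresh_acR hx)).mpr hR

end Transition
end GP2

-- Direct derivations as transitions and the correctness of Slp

namespace GP2

/-- The instance of the left-hand graph as an evaluated rule graph. -/
noncomputable def RuleSchema.leftEval (r : RuleSchema) (G : HostGraph) (g : r.LNode → G.V) (ρ : Env)
    (μ : r.NMarks) (η : r.EMarks) : EGraph r.nK r.nD r.eL where
  src := r.left.src
  tgt := r.left.tgt
  nlist := fun v => rEval G g ρ (r.left.nlist v)
  nmark := fun v => (r.left.nmark v).inst (μ v).1
  root := r.left.root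
  elist := fun e => rEval G g ρ (r.left.elist e)
  emark := fun e => (r.left.emark e).inst (η e).1

/-- The instance of the right-hand graph as an evaluated rule graph. -/
noncomputable def RuleSchema.rightEval (r : RuleSchema) (G : HostGraph) (g : r.LNode → G.V)
    (ρ : Env) (μ : r.NMarks) (η : r.EMarks) : EGraph r.nK r.nN r.eR where
  src := r.right.src
  tgt := r.right.tgt
  nlist := fun v => rEval G g ρ (r.right.nlist v)
  nmark := r.rightNMark μ
  root := r.right.root
  elist := fun e => rEval G g ρ (r.right.elist e)
  emark := r.rightEMark η

section
variable {r : Rule} {G : HostGraph} {g : r.LNode → G.V} {ρ : Env} {μ : r.NMarks} {η : r.EMarks}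
  {c : CDeg (Fin r.nK) → ℤ}

theorem RuleSchema.eval_lstToC (hc : ∀ d, (r.degToC d).eval ρ c = d.eval G g) (l : RLst r.LNode) :
    (r.lstToC l).eval ρ c Empty.elim = rEval G g ρ l := by
  rw [RuleSchema.lstToC, LstE.eval_bind, rEval]
  simp only [hc]
  congr 1
  exact funext fun x => x.elim

theorem Rule.evalAt_gen_left (hc : ∀ d, (r.degToC d).eval ρ c = d.eval G g) :
    (r.gen μ η).left.evalAt ρ c = r.leftEval G g ρ μ η := by
  unfold RGraph.evalAt RuleSchema.leftEval
  congr 1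
  · exact funext fun v => RuleSchema.eval_lstToC hc _
  · exact funext fun v => RuleSchema.eval_lstToC hc _

theorem Rule.evalAt_gen_right (hc : ∀ d, (r.degToC d).eval ρ c = d.eval G g) :
    (r.gen μ η).right.evalAt ρ c = r.rightEval G g ρ μ η := by
  unfold RGraph.evalAt RuleSchema.rightEval
  congr 1
  · exact funext fun v => RuleSchema.eval_lstToC hc _
  · exact funext fun v => RuleSchema.eval_lstToC hc _

/-- Degrees in rule labels refer to `G`. By the degree formulas of a gluing they equal the
expressions through incon and outcon by which the generalised rule replaces them. -/
theorem Glue.eval_degToC {D : PGraph} {k : Fin r.nK → D.V}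
    (γ : Glue (r.leftEval G g ρ μ η) D k G) (hg : γ.mV = g) (d : Deg r.LNode) :
    (r.degToC d).eval ρ (D.cdeg k) = d.eval G g := by
  rcases d with (v | v) | (v | v)
  · exact (γ.indeg_inl v).symm.trans (congrArg G.indeg (congrFun hg _))
  · exact (γ.indeg_inr v).symm.trans (congrArg G.indeg (congrFun hg _))
  · exact (γ.outdeg_inl v).symm.trans (congrArg G.outdeg (congrFun hg _))
  · exact (γ.outdeg_inr v).symm.trans (congrArg G.outdeg (congrFun hg _))

end

/-- Every direct derivation is a transition by the generalised rule, and the application condition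
holds. -/
theorem DerivesBy.exists_transition {r : Rule} {G H : HostGraph} {g : PreMatch r.toRuleSchema G}
    (h : DerivesBy r g H) : ∃ (ρ : Env) (μ : r.NMarks) (η : r.EMarks)
      (T : Transition (r.gen μ η) G H ρ),
      (r.gen μ η).acL.Sat T.JL finZeroElim finZeroElim ρ := by
  obtain ⟨ρ, μ, η, m, hV, hE, hΓ, D, k, d, h', m', hL, hR⟩ := h
  have comm : ∀ v, m.fV (Sum.inl v) = d.fV (k.fV v) :=
    fun v => congrFun (congrArg PGraph.Hom.fV hL.w) v
  -- Injectivity of the match forces injectivity of the interface map into the context, as required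
  -- for the gluing.
  have hk : Function.Injective k.fV := by
    intro u v huv
    have := (comm u).trans ((congrArg d.fV huv).trans (comm v).symm)
    rw [hV] at this
    exact Sum.inl_injective (g.injV this)
  obtain ⟨γ, hγ, -⟩ := glue_of_bicartesianSq (A := r.leftEval G g.gV ρ μ η) hL hk
  obtain ⟨γ', -, -⟩ := glue_of_bicartesianSq (A := r.rightEval G g.gV ρ μ η) hR hk
  have hmV : γ.mV = g.gV := (congrArg PGraph.Hom.fV hγ).trans hV
  have hc := γ.eval_degToC hmV
  have e1 := Rule.evalAt_gen_left (μ := μ) (η := η) hc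
  have e2 := Rule.evalAt_gen_right (μ := μ) (η := η) hc
  -- Quantifying over the rule graph transports the gluing along `e1` while keeping track of its
  -- node map.
  have hT : ∀ A, A = r.leftEval G g.gV ρ μ η → ∃ γ₁ : Glue A D k.fV G, γ₁.mV = g.gV := by
    rintro A rfl
    exact ⟨γ, hmV⟩
  obtain ⟨γ₁, hγ₁⟩ := hT _ e1
  refine ⟨ρ, μ, η, ⟨D, k.fV, γ₁, e2.symm ▸ γ'⟩, ?_⟩
  -- The application condition refers only to nodes of L, so the edge map may be arbitrary and only
  -- the node map needs identifying with the match.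
  have hac : ∀ J : r.LNode → G.V, J = g.gV → ∀ J' : Fin r.eL → G.E,
      (r.gen μ η).acL.Sat (Interp.over J J' : Interp (r.gen μ η).SL G)
        finZeroElim finZeroElim ρ := by
    rintro _ rfl J'
    simp only [Rule.gen]
    cases hcond : r.cond with
    | none => trivial
    | some γ => exact (γ.sat_toFm _ _ _).mpr (hΓ γ hcond)
  exact hac _ hγ₁ _

theorem Rule.boundGe_acL (r : Rule) (μ : r.NMarks) (η : r.EMarks) (N : ℕ) :
    (r.gen μ η).acL.BoundGe N := by
  simp only [Rule.gen]
  cases r.cond with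
  | none => trivial
  | some γ => exact γ.boundGe_toFm N

theorem Cond.models_bigOr {G : HostGraph} (l : List Cond) :
    Cond.Models (Fm.bigOr l) G ↔ ∃ c ∈ l, Cond.Models c G := by
  simp only [Cond.Models, Fm.sat_bigOr]
  exact ⟨fun ⟨ρ, c, hc, h⟩ => ⟨c, hc, ρ, h⟩, fun ⟨c, hc, ρ, h⟩ => ⟨ρ, c, hc, h⟩⟩

theorem models_Slp {c : Cond} {r : Rule} {G : HostGraph} :
    (Slp c r).Models G ↔ ∃ μ η, ((r.gen μ η).post c).Models G := by
  rw [Slp, Cond.models_bigOr]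
  simp [Rule.choices]

theorem models_SlpInv {c : Cond} {r : Rule} {G : HostGraph} :
    (SlpInv c r).Models G ↔ ∃ μ η, ((r.gen μ η).inv.post c).Models G := by
  rw [SlpInv, Cond.models_bigOr]
  simp [Rule.choices]

theorem DerivesBy.models_Slp {r : Rule} {G H : HostGraph} {g : PreMatch r.toRuleSchema G}
    (h : DerivesBy r g H) {c : Cond} (hc : c.Models G) : (Slp c r).Models H := by
  obtain ⟨ρ, μ, η, T, hL⟩ := h.exists_transition
  exact GP2.models_Slp.mpr ⟨μ, η, T.models_post hc (r.boundGe_acL μ η _) hL trivial⟩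

/-- For the inverse transition the application condition is the right one, and the left one is
`tru`; it is evaluated in `G`, as it was in the derivation. -/
theorem DerivesBy.models_SlpInv {r : Rule} {G H : HostGraph} {g : PreMatch r.toRuleSchema G}
    (h : DerivesBy r g H) {c : Cond} (hc : c.Models H) : (SlpInv c r).Models G := by
  obtain ⟨ρ, μ, η, T, hL⟩ := h.exists_transition
  exact GP2.models_SlpInv.mpr ⟨μ, η, T.inv.models_post hc trivial trivial hL⟩

/-! ### Applicability -/

/-- A match that satisfies the dangling condition and the application condition gives rise to a
direct derivation. -/
theorem exists_derivesBy {r : Rule} {G : HostGraph} (g : PreMatch r.toRuleSchema G) (ρ : Env)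
    (μ : r.NMarks) (η : r.EMarks)
    (hn : ∀ v, G.nlist (g.gV v) = rEval G g.gV ρ (r.left.nlist v) ∧
      G.nmark (g.gV v) = (r.left.nmark v).inst (μ v).1)
    (he : ∀ e, G.elist (g.gE e) = rEval G g.gV ρ (r.left.elist e) ∧
      G.emark (g.gE e) = (r.left.emark e).inst (η e).1)
    (hΓ : ∀ γ ∈ r.cond, γ.Holds G g.gV ρ)
    (dang : ∀ e j, G.src e = g.gV (.inr j) ∨ G.tgt e = g.gV (.inr j) → e ∈ Set.range g.gE) :
    ∃ H, DerivesBy r g H := by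
  let m : (r.leftEval G g.gV ρ μ η).toPGraph ⟶ G.toPGraph :=
    PGraph.Hom.mk (A := (r.leftEval G g.gV ρ μ η).toPGraph) (B := G.toPGraph) g.gV g.gE g.src g.tgt
      (by
        intro v l hl
        refine Eq.trans ?_ hl
        exact congrArg some (Prod.ext (hn v).1 (hn v).2))
      (by
        intro v l hl
        refine Eq.trans ?_ hl
        exact congrArg some (g.root v))
      (fun e => Prod.ext (he e).1 (he e).2)
  obtain ⟨γ, hγ⟩ := exists_glue_context m dang g.injV g.injE
  obtain ⟨H, ⟨γ'⟩⟩ := exists_glueHost γ (r.rightEval G g.gV ρ μ η)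
  refine ⟨H, ρ, μ, η, m, rfl, rfl, hΓ, _, _, γ.d, γ'.d, γ'.m, ?_, γ'.bicartesianSq⟩
  have := γ.bicartesianSq
  rw [hγ] at this
  exact this

/-- The matched edges at the node already account for its whole degree. By finiteness there can be
no others. -/
theorem mem_range_of_ncard {N α ι : Type} [Finite α] [Fintype ι] [DecidableEq N] {V : Type}
    {g : N → V} {h : ι → α} (hh : Function.Injective h) {s : α → V}
    {t : ι → N} (hst : ∀ i, s (h i) = g (t i)) {v : N}
    (hc : {e | s e = g v}.ncard = (Finset.univ.filter fun i => t i = v).card) {e : α}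
    (he : s e = g v) : e ∈ Set.range h := by
  have h1 : h '' (↑(Finset.univ.filter fun i => t i = v) : Set ι) ⊆ {e | s e = g v} := by
    rintro _ ⟨i, hi, rfl⟩
    have hi : t i = v := by simpa using hi
    exact (hst i).trans (congrArg g hi)
  have h2 := Set.eq_of_subset_of_ncard_le h1
    (by rw [Set.ncard_image_of_injective _ hh, Set.ncard_coe_finset, hc]) (Set.toFinite _)
  have h3 : e ∈ {e | s e = g v} := he
  rw [← h2] at h3
  exact Set.image_subset_range _ _ h3

theorem GRule.sat_spec {w : GRule} {G : HostGraph} {g : w.RNode → G.V} {h : Fin w.eR → G.E}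
    {ρ : Env} (hs : w.spec.Sat (Interp.over g h) finZeroElim finZeroElim ρ) :
    (∀ v, G.nlist (g v) = (w.lstToR (w.right.nlist v) : LTm w.SR 0 0).eval ρ
        (ILeaf.eval (Interp.over g h) finZeroElim finZeroElim)
        (XLeaf.eval (Interp.over g h) finZeroElim finZeroElim) ∧
      G.nmark (g v) = w.right.nmark v ∧ G.root (g v) = w.right.root v) ∧
    ∀ e, G.src (h e) = g (w.right.src e) ∧ G.tgt (h e) = g (w.right.tgt e) ∧
      G.elist (h e) = (w.lstToR (w.right.elist e) : LTm w.SR 0 0).eval ρ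
        (ILeaf.eval (Interp.over g h) finZeroElim finZeroElim)
        (XLeaf.eval (Interp.over g h) finZeroElim finZeroElim) ∧
      G.emark (h e) = w.right.emark e := by
  simp only [GRule.spec, Fm.sat_bigAnd, List.mem_append, List.mem_map] at hs
  constructor
  · intro v
    obtain ⟨h1, h2, h3⟩ := hs _ (.inl (.inr ⟨v, mem_nodeList v, rfl⟩))
    refine ⟨h1, h2, ?_⟩
    split_ifs at h3 with hr
    · exact Eq.trans h3 hr.symm
    · rw [Bool.not_eq_true] at hr
      exact Eq.trans (Bool.not_eq_true _ ▸ h3) hr.symm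
  · intro e
    exact hs _ (.inr ⟨e, List.mem_finRange e, rfl⟩)

theorem GRule.sat_dang {w : GRule} {G : HostGraph} {g : w.LNode → G.V} {h : Fin w.eL → G.E}
    {ρ : Env} (hs : w.dang.Sat (Interp.over g h) finZeroElim finZeroElim ρ) (d : Fin w.nD) :
    G.indeg (g (.inr d)) = w.left.indeg (.inr d) ∧
      G.outdeg (g (.inr d)) = w.left.outdeg (.inr d) := by
  simp only [GRule.dang, Fm.sat_bigAnd, List.mem_map] at hs
  obtain ⟨h1, h2⟩ := hs _ ⟨d, List.mem_finRange d, rfl⟩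
  exact ⟨Atom.int.inj (List.cons.inj h1).1, Atom.int.inj (List.cons.inj h2).1⟩

/-- For the inverse rule the shifted formula contains Γ, Spec(L) and Dang(L), which together
describe an applicable match. The conjunct coming from `c` plays no role, so the result need not
satisfy `c`; applicability is enough for Fail of a rule set. -/
theorem exists_derivesBy_of_models {r : Rule} {G : HostGraph} {c : Cond}
    (h : (SlpInv c r).Models G) : ∃ (g : PreMatch r.toRuleSchema G) (H : HostGraph),
      DerivesBy r g H := by
  obtain ⟨μ, η, ρ₀, hp⟩ := models_SlpInv.mp h
  obtain ⟨ρ, g, h, hg, hh, -, hΓ, hs, hd⟩ := (GRule.sat_post _ _ _).mp hp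
  obtain ⟨hV, hE⟩ := GRule.sat_spec hs
  have hd : ∀ d : Fin r.nD, G.indeg (g (.inr d)) = r.left.indeg (.inr d) ∧
      G.outdeg (g (.inr d)) = r.left.outdeg (.inr d) :=
    GRule.sat_dang (w := r.gen μ η) hd
  -- For preserved nodes the degree in L is added and subtracted again; for deleted nodes Dang
  -- supplies the literal.
  have hdeg : ∀ d : Deg r.LNode, (r.degToC d).eval ρ
      (fun c => ((r.gen μ η).inv.cToR c : ITm (r.gen μ η).inv.SR 0 0).eval ρ
        (ILeaf.eval (Interp.over g h) finZeroElim finZeroElim)) = d.eval G g := by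
    rintro ((v | v) | (v | v))
    · exact sub_add_cancel (G.indeg (g (.inl v))) _
    · exact (hd v).1.symm
    · exact sub_add_cancel (G.outdeg (g (.inl v))) _
    · exact (hd v).2.symm
  have hl : ∀ l : RLst r.LNode,
      ((r.gen μ η).inv.lstToR (r.lstToC l) : LTm (r.gen μ η).inv.SR 0 0).eval ρ
        (ILeaf.eval (Interp.over g h) finZeroElim finZeroElim)
        (XLeaf.eval (Interp.over g h) finZeroElim finZeroElim) = rEval G g ρ l :=
    fun l => (GRule.eval_lstToR _ _ _ _ _).trans (RuleSchema.eval_lstToC hdeg l)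
  let pm : PreMatch r.toRuleSchema G :=
    ⟨g, h, hg, hh, fun e => (hE e).1, fun e => (hE e).2.1, fun v => (hV v).2.2⟩
  have := G.finE
  refine ⟨pm, exists_derivesBy pm ρ μ η (fun v => ⟨(hV v).1.trans (hl _), (hV v).2.1⟩)
    (fun e => ⟨(hE e).2.2.1.trans (hl _), (hE e).2.2.2⟩) ?_ ?_⟩
  · intro γ hγ
    have e : (r.gen μ η).inv.acR = γ.toFm := by
      change (match r.cond with
        | some γ => γ.toFm
        | none => .tru) = γ.toFm
      rw [hγ]
    rw [e] at hΓ
    exact (γ.sat_toFm _ _ _).mp hΓ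
  · rintro e j (he | he)
    · exact mem_range_of_ncard hh (fun i => (hE i).1) (Int.ofNat.inj (hd j).2) he
    · exact mem_range_of_ncard hh (fun i => (hE i).2.1) (Int.ofNat.inj (hd j).1) he

/-- Assignments exist because every domain is nonempty; a formula independent of its label variables
can then be tested at the default assignment. -/
instance (t : LTy) : Inhabited t.Dom where
  default := match t with
    | .list => []
    | .atom => Atom.int 0
    | .int => (0 : ℤ)
    | .string => []
    | .char => ⟨32, .inl rfl⟩

/-- A rule schema with empty left-hand graph and no application condition is always applicable. -/
theorem exists_derivesBy_of_empty {r : Rule} (hK : r.nK = 0) (hD : r.nD = 0) (hc : r.cond = none)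
    (G : HostGraph) : ∃ (g : PreMatch r.toRuleSchema G) (H : HostGraph), DerivesBy r g H := by
  have hV : r.LNode → False := by
    rintro (v | v)
    · exact (Fin.cast hK v).elim0
    · exact (Fin.cast hD v).elim0
  -- Without nodes in L there are no edges either, since an edge would have a source.
  have hE : Fin r.eL → False := fun e => hV (r.left.src e)
  let pm : PreMatch r.toRuleSchema G :=
    ⟨fun v => (hV v).elim, fun e => (hE e).elim, fun v => (hV v).elim, fun e => (hE e).elim,
      fun e => (hE e).elim, fun e => (hE e).elim, fun v => (hV v).elim⟩
  refine ⟨pm, exists_derivesBy pm default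
    (fun v => (hV v).elim) (fun e => (hE e).elim) (fun v => (hV v).elim) (fun e => (hE e).elim)
    ?_ (fun e j => (hV (.inr j)).elim)⟩
  intro γ hγ
  rw [hc] at hγ
  cases hγ

end GP2

namespace GP2

/-! ### Program runs -/

/-- `Leads x y`: the configuration `y` is reachable from `x`. -/
abbrev Leads : Config → Config → Prop := Relation.ReflTransGen Step

/-- Terminal configurations: host graphs and failure. -/
def Config.Final : Config → Prop
  | .run _ _ => False
  | _ => True

theorem Config.Final.graph (H : HostGraph) : (Config.graph H).Final := trivial

theorem Config.Final.fail : Config.fail.Final := trivial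

theorem Leads.of_final {x y : Config} (h : Leads x y) (hx : x.Final) : y = x := by
  cases x with
  | run => exact hx.elim
  | graph => exact (Relation.ReflTransGen.cases_head h).elim Eq.symm fun ⟨_, h, _⟩ => by cases h
  | fail => exact (Relation.ReflTransGen.cases_head h).elim Eq.symm fun ⟨_, h, _⟩ => by cases h

theorem Leads.exists_step {P : Com} {G : HostGraph} {y : Config} (h : Leads (.run P G) y)
    (hy : y.Final) : ∃ x, Step (.run P G) x ∧ Leads x y := by
  rcases Relation.ReflTransGen.cases_head h with rfl | h
  · exact hy.elim
  · exact h

/-- A running configuration is never final, so reaching a final one takes at least one step. This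
permits working with the reflexive closure, which is better suited to induction. -/
theorem leads_iff_plus {P : Com} {G : HostGraph} {y : Config} (hy : y.Final) :
    Leads (.run P G) y ↔ Plus Step (.run P G) y := by
  rw [plus_iff, Leads, Relation.reflTransGen_iff_eq_or_transGen]
  refine ⟨fun h => h.resolve_left ?_, .inr⟩
  rintro rfl
  exact hy

theorem graph_mem_sem {P : Com} {G H : HostGraph} :
    Outcome.graph H ∈ P.sem G ↔ Leads (.run P G) (.graph H) := by
  rw [leads_iff_plus (.graph _), plus_iff]
  rfl

theorem fail_mem_sem {P : Com} {G : HostGraph} :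
    Outcome.fail ∈ P.sem G ↔ Leads (.run P G) .fail := by
  rw [leads_iff_plus .fail, plus_iff]
  rfl

theorem leads_call_graph {R : List Rule} {G H : HostGraph} :
    Leads (.run (.call R) G) (.graph H) ↔ Derives R G H := by
  constructor
  · intro h
    obtain ⟨x, h1, h2⟩ := h.exists_step trivial
    cases h1 with
    | call₁ h1 =>
      cases Leads.of_final h2 trivial
      exact h1
    | call₂ h1 => cases Leads.of_final h2 trivial
  · exact fun h => .single (.call₁ h)

theorem leads_call_fail {R : List Rule} {G : HostGraph} (h : Leads (.run (.call R) G) .fail) :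
    ¬ ∃ H, Derives R G H := by
  obtain ⟨x, h1, h2⟩ := h.exists_step trivial
  cases h1 with
  | call₁ h1 => cases Leads.of_final h2 trivial
  | call₂ h1 => exact h1

theorem not_leads_brk {G : HostGraph} {y : Config} (hy : y.Final) : ¬ Leads (.run .brk G) y := by
  intro h
  obtain ⟨x, h1, -⟩ := h.exists_step hy
  cases h1

theorem Leads.ifte {C P Q : Com} {G : HostGraph} {y : Config}
    (h : Leads (.run (.ifte C P Q) G) y) (hy : y.Final) :
    ((∃ H, Leads (.run C G) (.graph H)) ∧ Leads (.run P G) y) ∨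
      (Leads (.run C G) .fail ∧ Leads (.run Q G) y) := by
  obtain ⟨x, h1, h2⟩ := h.exists_step hy
  cases h1 with
  | if₁ h1 => exact .inl ⟨⟨_, (leads_iff_plus (.graph _)).mpr h1⟩, h2⟩
  | if₂ h1 => exact .inr ⟨(leads_iff_plus .fail).mpr h1, h2⟩

theorem Leads.tryte {C P Q : Com} {G : HostGraph} {y : Config}
    (h : Leads (.run (.tryte C P Q) G) y) (hy : y.Final) :
    (∃ H, Leads (.run C G) (.graph H) ∧ Leads (.run P H) y) ∨
      (Leads (.run C G) .fail ∧ Leads (.run Q G) y) := by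
  obtain ⟨x, h1, h2⟩ := h.exists_step hy
  cases h1 with
  | try₁ h1 => exact .inl ⟨_, (leads_iff_plus (.graph _)).mpr h1, h2⟩
  | try₂ h1 => exact .inr ⟨(leads_iff_plus .fail).mpr h1, h2⟩

theorem Leads.choice {P Q : Com} {G : HostGraph} {y : Config}
    (h : Leads (.run (.choice P Q) G) y) (hy : y.Final) :
    Leads (.run P G) y ∨ Leads (.run Q G) y := by
  obtain ⟨x, h1, h2⟩ := h.exists_step hy
  cases h1 with
  | or₁ => exact .inl h2
  | or₂ => exact .inr h2

/-- Follow the first component until it ends in a graph or in failure; failure of the whole sequence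
is immediate in the latter case. -/
theorem Leads.seq {Q : Com} {y : Config} (hy : y.Final) {P : Com} {G : HostGraph}
    (h : Leads (.run (.seq P Q) G) y) :
    (y = .fail ∧ Leads (.run P G) .fail) ∨
      ∃ H, Leads (.run P G) (.graph H) ∧ Leads (.run Q H) y := by
  generalize hx : Config.run (.seq P Q) G = x at h
  induction h using Relation.ReflTransGen.head_induction_on generalizing P G with
  | refl =>
    subst hx
    exact hy.elim
  | head h1 h2 ih =>
    subst hx
    cases h1 with
    | seq₁ h1 =>
      rcases ih rfl with ⟨e, h⟩ | ⟨H, h, h'⟩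
      · exact .inl ⟨e, .head h1 h⟩
      · exact .inr ⟨H, .head h1 h, h'⟩
    | seq₂ h1 => exact .inr ⟨_, .single h1, h2⟩
    | seq₃ h1 => exact .inl ⟨Leads.of_final h2 trivial, .single h1⟩
    -- A break discards the second component and then remains stuck outside a loop, so no final
    -- configuration is reached.
    | brk => exact absurd h2 (not_leads_brk hy)

theorem Leads.seq_graph {P Q : Com} {G H : HostGraph} {y : Config}
    (h : Leads (.run P G) (.graph H)) (h' : Leads (.run Q H) y) : Leads (.run (.seq P Q) G) y := by
  generalize hx : Config.run P G = x at h
  induction h using Relation.ReflTransGen.head_induction_on generalizing P G with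
  | refl => cases hx
  | @head x z h1 h2 ih =>
    subst hx
    cases z with
    | run P' G' => exact .head (.seq₁ h1) (ih rfl)
    | graph H' =>
      cases Leads.of_final h2 trivial
      exact .head (.seq₂ h1) h'
    | fail => cases Leads.of_final h2 trivial

theorem Leads.seq_fail {P Q : Com} {G : HostGraph}
    (h : Leads (.run P G) .fail) : Leads (.run (.seq P Q) G) .fail := by
  generalize hx : Config.run P G = x at h
  induction h using Relation.ReflTransGen.head_induction_on generalizing P G with
  | refl => cases hx
  | @head x z h1 h2 ih =>
    subst hx
    cases z with
    | run P' G' => exact .head (.seq₁ h1) (ih rfl)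
    | graph H' => cases Leads.of_final h2 trivial
    | fail => exact .single (.seq₃ h1)

theorem leads_seq_graph_iff {P Q : Com} {G H : HostGraph} :
    Leads (.run (.seq P Q) G) (.graph H) ↔
      ∃ H', Leads (.run P G) (.graph H') ∧ Leads (.run Q H') (.graph H) := by
  refine ⟨fun h => ?_, fun ⟨_, h, h'⟩ => h.seq_graph h'⟩
  rcases Leads.seq (.graph _) h with ⟨e, -⟩ | h
  · cases e
  · exact h

theorem leads_seq_fail_iff {P Q : Com} {G : HostGraph} :
    Leads (.run (.seq P Q) G) .fail ↔ Leads (.run P G) .fail ∨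
      ∃ H', Leads (.run P G) (.graph H') ∧ Leads (.run Q H') .fail :=
  ⟨fun h => (Leads.seq .fail h).imp And.right id,
    fun h => h.elim Leads.seq_fail fun ⟨_, h, h'⟩ => h.seq_graph h'⟩

/-- Each completed iteration preserves `c`. The loop is left either by failure of the body, which
returns the current graph, or by a break, which yields `d`. Failure is never an outcome of the loop
itself. -/
theorem Leads.loop {c d : Assertion} {P : Com} (hP : PartiallyCorrect c P c) (hB : Break c P d)
    {G : HostGraph} {y : Config} (h : Leads (.run (.loop P) G) y) (hy : y.Final) (hc : c G) :
    ∃ H, y = .graph H ∧ ((c H ∧ FAIL P H) ∨ d H) := by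
  generalize hx : Config.run (.loop P) G = x at h
  induction h using Relation.ReflTransGen.head_induction_on generalizing G with
  | refl =>
    subst hx
    exact hy.elim
  | head h1 h2 ih =>
    subst hx
    cases h1 with
    | loop₁ h1 =>
      exact ih (hP G hc _ (graph_mem_sem.mpr ((leads_iff_plus (.graph _)).mpr h1))) rfl
    | loop₂ h1 =>
      exact ⟨_, Leads.of_final h2 trivial,
        .inl ⟨hc, fail_mem_sem.mpr ((leads_iff_plus .fail).mpr h1)⟩⟩
    | loop₃ h1 => exact ⟨_, Leads.of_final h2 trivial, .inr (hB _ _ (star_iff.mp h1) hc)⟩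

/-- The base cases are rules with empty left-hand graph, always applicable, loops, which absorb
failure, and break, which gets stuck. Conditions of branches may fail, but this only selects the
other branch. -/
theorem Com.NonFailing.not_leads_fail {P : Com} (h : P.NonFailing) (G : HostGraph) :
    ¬ Leads (.run P G) .fail := by
  induction P generalizing G with
  | call R =>
    intro hf
    obtain ⟨r, hr⟩ := List.exists_mem_of_ne_nil R h.1
    obtain ⟨hK, hD, hc⟩ := h.2 r hr
    obtain ⟨g, H, hd⟩ := exists_derivesBy_of_empty hK hD hc G
    exact leads_call_fail hf ⟨H, r, hr, g, hd⟩
  | seq P Q ih1 ih2 =>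
    intro hf
    rcases leads_seq_fail_iff.mp hf with hf | ⟨H, -, hf⟩
    · exact ih1 h.1 _ hf
    · exact ih2 h.2 _ hf
  | ifte C P Q _ ih1 ih2 =>
    intro hf
    rcases hf.ifte trivial with ⟨-, hf⟩ | ⟨-, hf⟩
    · exact ih1 h.1 _ hf
    · exact ih2 h.2 _ hf
  | tryte C P Q _ ih1 ih2 =>
    intro hf
    rcases hf.tryte trivial with ⟨H, -, hf⟩ | ⟨-, hf⟩
    · exact ih1 h.1 _ hf
    · exact ih2 h.2 _ hf
  | loop P _ =>
    intro hf
    -- Trivial assertions suffice, as only the shape of the final configuration is needed.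
    obtain ⟨H, e, -⟩ := Leads.loop (c := fun _ => True) (d := fun _ => True)
      (fun _ _ _ _ => trivial) (fun _ _ _ _ => trivial) hf trivial trivial
    cases e
  | choice P Q => exact h.elim
  | brk => exact not_leads_brk trivial

/-- A sequence of commands leads from `G` to `H`. -/
def LeadsSeq : List Com → HostGraph → HostGraph → Prop
  | [], G, H => G = H
  | P :: l, G, H => ∃ H', Leads (.run P G) (.graph H') ∧ LeadsSeq l H' H

/-- A sequence of commands fails on `G`. -/
def FailsSeq : List Com → HostGraph → Prop
  | [], _ => False
  | P :: l, G => Leads (.run P G) .fail ∨ ∃ H, Leads (.run P G) (.graph H) ∧ FailsSeq l H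

theorem leadsSeq_append {l l' : List Com} {G H : HostGraph} :
    LeadsSeq (l ++ l') G H ↔ ∃ H', LeadsSeq l G H' ∧ LeadsSeq l' H' H := by
  induction l generalizing G with
  | nil => simp [LeadsSeq]
  | cons P l ih =>
    simp only [List.cons_append, LeadsSeq, ih]
    exact ⟨fun ⟨A, h1, B, h2, h3⟩ => ⟨B, ⟨A, h1, h2⟩, h3⟩,
      fun ⟨B, ⟨A, h1, h2⟩, h3⟩ => ⟨A, h1, B, h2, h3⟩⟩

theorem failsSeq_append {l l' : List Com} {G : HostGraph} :
    FailsSeq (l ++ l') G ↔ FailsSeq l G ∨ ∃ H, LeadsSeq l G H ∧ FailsSeq l' H := by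
  induction l generalizing G with
  | nil => simp [LeadsSeq, FailsSeq]
  | cons P l ih =>
    simp only [List.cons_append, LeadsSeq, FailsSeq, ih]
    constructor
    · rintro (h | ⟨A, h1, h2 | ⟨B, h2, h3⟩⟩)
      · exact .inl (.inl h)
      · exact .inl (.inr ⟨A, h1, h2⟩)
      · exact .inr ⟨B, ⟨A, h1, h2⟩, h3⟩
    · rintro ((h | ⟨A, h1, h2⟩) | ⟨B, ⟨A, h1, h2⟩, h3⟩)
      · exact .inl h
      · exact .inr ⟨A, h1, .inl h2⟩
      · exact .inr ⟨A, h1, .inr ⟨B, h2, h3⟩⟩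

theorem leadsSeq_singleton {P : Com} {G H : HostGraph} :
    LeadsSeq [P] G H ↔ Leads (.run P G) (.graph H) := by
  simp [LeadsSeq]

theorem failsSeq_singleton {P : Com} {G : HostGraph} :
    FailsSeq [P] G ↔ Leads (.run P G) .fail := by
  simp [FailsSeq]

theorem leadsSeq_items {P : Com} {G H : HostGraph} :
    LeadsSeq P.items G H ↔ Leads (.run P G) (.graph H) := by
  induction P generalizing G H with
  | seq P Q ih1 ih2 => simp only [Com.items, leadsSeq_append, ih1, ih2, leads_seq_graph_iff]
  | _ => exact leadsSeq_singleton

/-- Failure depends only on the list of commands, so a sequence may be rebracketed as in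
`Com.IsSeq`. -/
theorem failsSeq_items {P : Com} {G : HostGraph} :
    FailsSeq P.items G ↔ Leads (.run P G) .fail := by
  induction P generalizing G with
  | seq P Q ih1 ih2 =>
    simp only [Com.items, failsSeq_append, leadsSeq_items, ih1, ih2, leads_seq_fail_iff]
  | _ => exact failsSeq_singleton

/-! ### Success and failure as formulas -/

/-- The truth of a condition does not depend on the values of label variables. -/
def Cond.Closed (c : Cond) : Prop :=
  ∀ (G : HostGraph) (ρ ρ' : Env), c.Sat (Interp.FO G) finZeroElim finZeroElim ρ →
    c.Sat (Interp.FO G) finZeroElim finZeroElim ρ'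

theorem Cond.Closed.neg {c : Cond} (hc : c.Closed) : Cond.Closed (.neg c) :=
  fun G ρ ρ' h h' => h (hc G ρ' ρ h')

theorem Cond.Closed.and {c d : Cond} (hc : c.Closed) (hd : d.Closed) : Cond.Closed (.and c d) :=
  fun G ρ ρ' h => ⟨hc G ρ ρ' h.1, hd G ρ ρ' h.2⟩

theorem Cond.Closed.or {c d : Cond} (hc : c.Closed) (hd : d.Closed) : Cond.Closed (.or c d) :=
  fun G ρ ρ' h => h.imp (hc G ρ ρ') (hd G ρ ρ')

theorem Cond.closed_fls : Cond.Closed .fls := fun _ _ _ h => h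

theorem Cond.closed_bigOr {l : List Cond} (h : ∀ c ∈ l, Cond.Closed c) :
    Cond.Closed (Fm.bigOr l) := by
  intro G ρ ρ' hs
  rw [Fm.sat_bigOr] at hs ⊢
  obtain ⟨c, hc, hs⟩ := hs
  exact ⟨c, hc, h c hc G ρ ρ' hs⟩

/-- The characterisation by `sat_post` does not mention the outer assignment. -/
theorem GRule.closed_post (w : GRule) (c : Cond) : Cond.Closed (w.post c) :=
  fun _ _ _ h => (w.sat_post c _).mpr ((w.sat_post c _).mp h)

theorem closed_SlpInv (c : Cond) (r : Rule) : Cond.Closed (SlpInv c r) := by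
  refine Cond.closed_bigOr fun φ hφ => ?_
  obtain ⟨p, -, rfl⟩ := List.mem_map.mp hφ
  exact GRule.closed_post _ _

/-- Pre is built from Post formulas, which are closed whatever condition they start from, so `c` may
have free label variables. Both formulas are treated together because their definitions call each
other. -/
theorem Com.closed_pre (P : Com) (c : Cond) : Cond.Closed (P.pre c) ∧ Cond.Closed P.failLF := by
  induction P generalizing c with
  | call R =>
    have h : ∀ c, Cond.Closed (.bigOr (R.map fun r => SlpInv c r)) := by
      refine fun c => Cond.closed_bigOr fun φ hφ => ?_
      obtain ⟨r, -, rfl⟩ := List.mem_map.mp hφ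
      exact closed_SlpInv _ _
    rw [Com.pre, Com.failLF]
    exact ⟨h c, (h .tru).neg⟩
  | seq P Q ih1 ih2 =>
    rw [Com.pre, Com.failLF]
    exact ⟨(ih1 _).1, (ih1 c).2.or (ih1 _).1⟩
  | ifte C P Q ih ih1 ih2 =>
    rw [Com.pre, Com.failLF]
    exact ⟨((ih _).1.and (ih1 _).1).or ((ih c).2.and (ih2 _).1),
      ((ih _).1.and (ih1 c).2).or ((ih c).2.and (ih2 c).2)⟩
  | tryte C P Q ih ih1 ih2 =>
    rw [Com.pre, Com.failLF]
    exact ⟨(ih _).1.or ((ih c).2.and (ih2 _).1), (ih _).1.or ((ih c).2.and (ih2 c).2)⟩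
  | loop P ih =>
    rw [Com.pre, Com.failLF]
    exact ⟨Cond.closed_fls, Cond.closed_fls⟩
  | choice P Q ih1 ih2 =>
    rw [Com.pre, Com.failLF]
    exact ⟨(ih1 _).1.or (ih2 _).1, (ih1 c).2.or (ih2 c).2⟩
  | brk =>
    rw [Com.pre, Com.failLF]
    exact ⟨Cond.closed_fls, Cond.closed_fls⟩

theorem Com.closed_success (P : Com) : Cond.Closed P.success := (P.closed_pre _).1

theorem Com.closed_failLF (P : Com) : Cond.Closed P.failLF := (P.closed_pre .tru).2

theorem Cond.models_tru (G : HostGraph) : Cond.Models .tru G := ⟨default, trivial⟩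

theorem Cond.models_or {c d : Cond} {G : HostGraph} :
    Cond.Models (.or c d) G ↔ c.Models G ∨ d.Models G := exists_or

/-- The conjuncts may be witnessed by different assignments; closedness of one lets the witness of
the other serve both. -/
theorem Cond.Closed.models_and {c d : Cond} (hd : d.Closed) {G : HostGraph} :
    Cond.Models (.and c d) G ↔ c.Models G ∧ d.Models G :=
  ⟨fun ⟨ρ, h1, h2⟩ => ⟨⟨ρ, h1⟩, ⟨ρ, h2⟩⟩, fun ⟨⟨ρ, h1⟩, ⟨ρ', h2⟩⟩ => ⟨ρ, h1, hd G ρ' ρ h2⟩⟩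

/-- In general the negation of a condition only asserts that some assignment violates it. For a
closed condition this means that none satisfies it. -/
theorem Cond.Closed.models_neg {c : Cond} (hc : c.Closed) {G : HostGraph} :
    Cond.Models (.neg c) G ↔ ¬ c.Models G :=
  ⟨fun ⟨ρ, h⟩ ⟨ρ', h'⟩ => h (hc G ρ' ρ h'), fun h => ⟨default, fun h' => h ⟨_, h'⟩⟩⟩

/-- The formulas `Pre` and `Fail` hold on a graph whenever a run succeeds or fails,
respectively. -/
theorem Com.LoopFree.models {P : Com} (hP : P.LoopFree) :
    (∀ {G H : HostGraph} {c : Cond}, Leads (.run P G) (.graph H) → c.Models H →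
      (P.pre c).Models G) ∧ ∀ {G : HostGraph}, Leads (.run P G) .fail → P.failLF.Models G := by
  induction P with
  | call R =>
    constructor
    · intro G H c h hc
      obtain ⟨r, hr, g, hd⟩ := leads_call_graph.mp h
      rw [Com.pre, Cond.models_bigOr]
      exact ⟨_, List.mem_map.mpr ⟨r, hr, rfl⟩, hd.models_SlpInv hc⟩
    · intro G h
      have hcl := ((Com.call R).closed_pre .tru).1
      rw [Com.pre] at hcl
      -- Failure negates Success, so here the converse is needed: truth of the formula would make
      -- some rule applicable.
      rw [Com.failLF, hcl.models_neg, Cond.models_bigOr]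
      rintro ⟨_, hc, hm⟩
      obtain ⟨r, hr, rfl⟩ := List.mem_map.mp hc
      obtain ⟨g, H, hd⟩ := exists_derivesBy_of_models hm
      exact leads_call_fail h ⟨H, r, hr, g, hd⟩
  | seq P Q ih1 ih2 =>
    obtain ⟨p1, f1⟩ := ih1 hP.1
    obtain ⟨p2, f2⟩ := ih2 hP.2
    constructor
    · intro G H c h hc
      obtain ⟨H', h1, h2⟩ := leads_seq_graph_iff.mp h
      rw [Com.pre]
      exact p1 h1 (p2 h2 hc)
    · intro G h
      rw [Com.failLF, Cond.models_or]
      exact (leads_seq_fail_iff.mp h).imp f1 fun ⟨H', h1, h2⟩ => p1 h1 (f2 h2)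
  | ifte C P Q ih ih1 ih2 =>
    obtain ⟨p, f⟩ := ih hP.1
    obtain ⟨p1, f1⟩ := ih1 hP.2.1
    obtain ⟨p2, f2⟩ := ih2 hP.2.2
    constructor
    · intro G H c h hc
      rw [Com.pre, Cond.models_or, (P.closed_pre c).1.models_and, (Q.closed_pre c).1.models_and]
      exact (h.ifte trivial).imp (fun ⟨⟨H', h1⟩, h2⟩ => ⟨p h1 (Cond.models_tru _), p1 h2 hc⟩)
        fun ⟨h1, h2⟩ => ⟨f h1, p2 h2 hc⟩
    · intro G h
      rw [Com.failLF, Cond.models_or, P.closed_failLF.models_and, Q.closed_failLF.models_and]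
      exact (h.ifte trivial).imp (fun ⟨⟨H', h1⟩, h2⟩ => ⟨p h1 (Cond.models_tru _), f1 h2⟩)
        fun ⟨h1, h2⟩ => ⟨f h1, f2 h2⟩
  | tryte C P Q ih ih1 ih2 =>
    obtain ⟨p, f⟩ := ih hP.1
    obtain ⟨p1, f1⟩ := ih1 hP.2.1
    obtain ⟨p2, f2⟩ := ih2 hP.2.2
    constructor
    · intro G H c h hc
      rw [Com.pre, Cond.models_or, (Q.closed_pre c).1.models_and]
      exact (h.tryte trivial).imp (fun ⟨H', h1, h2⟩ => p h1 (p1 h2 hc))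
        fun ⟨h1, h2⟩ => ⟨f h1, p2 h2 hc⟩
    · intro G h
      rw [Com.failLF, Cond.models_or, Q.closed_failLF.models_and]
      exact (h.tryte trivial).imp (fun ⟨H', h1, h2⟩ => p h1 (f1 h2))
        fun ⟨h1, h2⟩ => ⟨f h1, f2 h2⟩
  | loop P ih => exact hP.elim
  | choice P Q ih1 ih2 =>
    obtain ⟨p1, f1⟩ := ih1 hP.1
    obtain ⟨p2, f2⟩ := ih2 hP.2
    constructor
    · intro G H c h hc
      rw [Com.pre, Cond.models_or]
      exact (h.choice trivial).imp (fun h => p1 h hc) fun h => p2 h hc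
    · intro G h
      rw [Com.failLF, Cond.models_or]
      exact (h.choice trivial).imp f1 f2
  | brk => exact ⟨fun h => absurd h (not_leads_brk trivial),
      fun h => absurd h (not_leads_brk trivial)⟩

theorem Com.LoopFree.models_success {C : Com} (hC : C.LoopFree) {G : HostGraph}
    (h : SUCCESS C G) : C.success.Models G := by
  obtain ⟨H, h⟩ := h
  exact hC.models.1 (graph_mem_sem.mp h) (Cond.models_tru H)

theorem Com.LoopFree.models_failLF {C : Com} (hC : C.LoopFree) {G : HostGraph}
    (h : FAIL C G) : C.failLF.Models G :=
  hC.models.2 (fail_mem_sem.mp h)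

theorem FailOf.closed {S : Com} {f : Cond} (h : FailOf S f) : f.Closed := by
  cases h with
  | nonFailing => exact Cond.closed_fls
  | loopFree => exact S.closed_failLF
  | seq => exact Com.closed_failLF _

/-- A failing run of `C;P` with non-failing `P` must already fail in `C`. The split is made on
command lists, as bracketings may differ. -/
theorem FailOf.models {S : Com} {f : Cond} (h : FailOf S f) {G : HostGraph} (hf : FAIL S G) :
    f.Models G := by
  rw [FAIL, fail_mem_sem] at hf
  cases h with
  | nonFailing h => exact absurd hf (h.not_leads_fail G)
  | loopFree h => exact h.models.2 hf
  | seq hC hP hS =>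
    rw [← failsSeq_items, hS, failsSeq_append] at hf
    rcases hf with hf | ⟨H, -, hf⟩
    · exact hC.models.2 (failsSeq_items.mp hf)
    · exact absurd (failsSeq_items.mp hf) (hP.not_leads_fail H)

/-! ### Soundness of the proof rules -/

theorem partiallyCorrect_call {c d : Assertion} {R : List Rule}
    (h : ∀ r ∈ R, PartiallyCorrect c (.call [r]) d) : PartiallyCorrect c (.call R) d := by
  intro G hc H hH
  obtain ⟨r, hr, g, hd⟩ := leads_call_graph.mp (graph_mem_sem.mp hH)
  exact h r hr G hc H
    (graph_mem_sem.mpr (leads_call_graph.mpr ⟨r, List.mem_singleton_self r, g, hd⟩))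

theorem PartiallyCorrect.seq {c e d : Assertion} {P Q : Com} (hP : PartiallyCorrect c P e)
    (hQ : PartiallyCorrect e Q d) : PartiallyCorrect c (.seq P Q) d := by
  intro G hc H hH
  obtain ⟨H', h1, h2⟩ := leads_seq_graph_iff.mp (graph_mem_sem.mp hH)
  exact hQ H' (hP G hc H' (graph_mem_sem.mpr h1)) H (graph_mem_sem.mpr h2)

theorem PartiallyCorrect.mono {c c' d d' : Assertion} {P : Com} (h : PartiallyCorrect c' P d')
    (hc : ∀ G, c G → c' G) (hd : ∀ G, d' G → d G) : PartiallyCorrect c P d :=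
  fun G hG H hH => hd H (h G (hc G hG) H hH)

theorem PartiallyCorrect.ifte {c d : Assertion} {C P Q : Com}
    (hP : PartiallyCorrect (fun G => c G ∧ SUCCESS C G) P d)
    (hQ : PartiallyCorrect (fun G => c G ∧ FAIL C G) Q d) :
    PartiallyCorrect c (.ifte C P Q) d := by
  intro G hc H hH
  rcases (graph_mem_sem.mp hH).ifte trivial with ⟨⟨H', h1⟩, h2⟩ | ⟨h1, h2⟩
  · exact hP G ⟨hc, H', graph_mem_sem.mpr h1⟩ H (graph_mem_sem.mpr h2)
  · exact hQ G ⟨hc, fail_mem_sem.mpr h1⟩ H (graph_mem_sem.mpr h2)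

/-- The then-branch continues from the result of the condition, so the two runs are joined into one
run of `C;P` from the original graph. -/
theorem PartiallyCorrect.tryte {c d : Assertion} {C P Q : Com}
    (hP : PartiallyCorrect (fun G => c G ∧ SUCCESS C G) (.seq C P) d)
    (hQ : PartiallyCorrect (fun G => c G ∧ FAIL C G) Q d) :
    PartiallyCorrect c (.tryte C P Q) d := by
  intro G hc H hH
  rcases (graph_mem_sem.mp hH).tryte trivial with ⟨H', h1, h2⟩ | ⟨h1, h2⟩
  · exact hP G ⟨hc, H', graph_mem_sem.mpr h1⟩ H (graph_mem_sem.mpr (h1.seq_graph h2))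
  · exact hQ G ⟨hc, fail_mem_sem.mpr h1⟩ H (graph_mem_sem.mpr h2)

theorem PartiallyCorrect.loop {c d : Assertion} {P : Com} (hP : PartiallyCorrect c P c)
    (hB : Break c P d) : PartiallyCorrect c (.loop P) (fun G => (c G ∧ FAIL P G) ∨ d G) := by
  intro G hc H hH
  obtain ⟨H', e, h⟩ := (graph_mem_sem.mp hH).loop hP hB trivial hc
  cases e
  exact h

/-- The axioms use only that the pre- and postconditions are liberal; that they are weakest or
strongest does not matter for soundness. -/
theorem SEM.sound {P : Com} {c d : Assertion} (h : SEM c P d) : PartiallyCorrect c P d := by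
  induction h with
  | ruleapp_slp r h => exact fun G hc H hH => h.1 G H ⟨hc, hH⟩
  | ruleapp_wlp r h => exact fun G hc H hH => h.1 G H ⟨hc, hH⟩
  | ruleset R _ ih => exact partiallyCorrect_call ih
  | comp _ _ ih1 ih2 => exact ih1.seq ih2
  | cons h1 _ h2 ih => exact ih.mono h1 h2
  | ite _ _ ih1 ih2 => exact ih1.ifte ih2
  | tryte _ _ ih1 ih2 => exact ih1.tryte ih2
  | alap _ hB ih => exact ih.loop hB

/-- The branching and loop rules reduce to their semantic counterparts because SUCCESS and FAIL
imply the formulas. Closedness makes the conjunctions in premises and conclusions behave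
semantically. -/
theorem SYN.sound {P : Com} {c d : Cond} (h : SYN c P d) :
    PartiallyCorrect c.Models P d.Models := by
  induction h with
  | ruleapp_slp c r =>
    intro G hc H hH
    obtain ⟨r', hr, g, hd⟩ := leads_call_graph.mp (graph_mem_sem.mp hH)
    cases List.mem_singleton.mp hr
    exact hd.models_Slp hc
  | ruleapp_wlp d r =>
    intro G hc H hH
    obtain ⟨r', hr, g, hd⟩ := leads_call_graph.mp (graph_mem_sem.mp hH)
    cases List.mem_singleton.mp hr
    by_contra hn
    -- If `H` does not satisfy `d`, then every assignment, in particular the default one, satisfies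
    -- the negation of `d` in `H`. Hence Slp of this negation along the inverse rule holds in `G`,
    -- contrary to the precondition.
    exact (closed_SlpInv _ _).models_neg.mp hc
      (hd.models_SlpInv ⟨default, fun h => hn ⟨_, h⟩⟩)
  | ruleset R _ ih => exact partiallyCorrect_call ih
  | comp _ _ _ _ ih1 ih2 => exact ih1.seq ih2
  | cons _ h1 _ h2 ih => exact ih.mono h1 h2
  | @ite c d C P Q hC _ _ _ _ ih1 ih2 =>
    refine PartiallyCorrect.ifte (C := C) (ih1.mono ?_ fun _ => id) (ih2.mono ?_ fun _ => id)
    · exact fun G h => C.closed_success.models_and.mpr ⟨h.1, hC.models_success h.2⟩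
    · exact fun G h => C.closed_failLF.models_and.mpr ⟨h.1, hC.models_failLF h.2⟩
  | @tryte c d C P Q hC _ _ _ _ ih1 ih2 =>
    refine PartiallyCorrect.tryte (C := C) (ih1.mono ?_ fun _ => id) (ih2.mono ?_ fun _ => id)
    · exact fun G h => C.closed_success.models_and.mpr ⟨h.1, hC.models_success h.2⟩
    · exact fun G h => C.closed_failLF.models_and.mpr ⟨h.1, hC.models_failLF h.2⟩
  | alap _ hf _ hB ih =>
    refine (ih.loop hB).mono (fun _ => id) fun G h => ?_
    exact Cond.models_or.mpr
      (h.imp_left fun h => hf.closed.models_and.mpr ⟨h.1, hf.models h.2⟩)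

end GP2

/-- Soundness of the semantic and of the syntactic partial correctness calculus. -/
theorem mainTheorem4 :
    (∀ (P : GP2.Com) (c d : GP2.Assertion), GP2.SEM c P d → GP2.PartiallyCorrect c P d) ∧
    (∀ (P : GP2.Com) (c d : GP2.Cond), GP2.SYN c P d →
      GP2.PartiallyCorrect c.Models P d.Models) :=
  ⟨fun _ _ _ h => h.sound, fun _ _ _ h => h.sound⟩
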